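/- Let $A$ be a discriminant form: a finite abelian group with a non-degenerate quadratic form $\lambda\mapsto\lambda^2/2\in\mathbb{Q}/\mathbb{Z}$ and bilinear form $(\lambda,\mu)$. Let $N$ be its level (the least $N\ge 1$ with $N\lambda^2/2=0$ for all $\lambda\in A$) and $\operatorname{sig}(A)\in\mathbb{Z}/8\mathbb{Z}$ its signature, i.e. $b^+-b^-$ mod $8$ for any non-degenerate even lattice $L$ of type $(b^+,b^-)$ with $L'/L\cong A$. Assume that $\operatorname{sig}(A)$ is odd, and let $k\in\frac12+\mathbb{Z}$. Write $e(z)=e^{2\pi i z}$, and let $(\mathfrak e_\lambda)_{\lambda\in A}$ be the standard basis of $\mathbb{C}[A]$. Let $\widetilde{\mathrm{GL}}{}_2^+(\mathbb{R})$ be the group of pairs $(M,\phi)$ with $M=\begin{pmatrix}a&b\\c&d\end{pmatrix}\in \mathrm{GL}_2^+(\mathbb{R})$ and $\phi:\mathbb{H}\to\mathbb{C}$ holomorphic with $\phi(\tau)^2=c\tau+d$, with product $(M,\phi(\tau))(M',\phi'(\tau))=(MM',\phi(M'\tau)\phi'(\tau))$. Let $\tilde\Gamma$ be the inverse image of $\mathrm{SL}_2(\mathbb{Z})$,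 and let $\rho_A$ be the Weil representation of $\tilde\Gamma$ on $\mathbb{C}[A]$, determined by $$\rho_A\!\left(\begin{pmatrix}1&1\\0&1\end{pmatrix},1\right)\mathfrak e_\lambda=e(\lambda^2/2)\,\mathfrak e_\lambda,\qquad \rho_A\!\left(\begin{pmatrix}0&-1\\1&0\end{pmatrix},\sqrt\tau\right)\mathfrak e_\lambda=\frac{e(-\operatorname{sig}(A)/8)}{\sqrt{|A|}}\sum_{\mu\in A}e(-(\lambda,\mu))\,\mathfrak e_\mu .$$ Let $M_{k,A}$ be the space of holomorphic $f:\mathbb{H}\to\mathbb{C}[A]$ with $f(M\tau)=\phi(\tau)^{2k}\rho_A(M,\phi)f(\tau)$ for all $(M,\phi)\in\tilde\Gamma$ which are holomorphic at $\infty$. Let $U(N)=(\mathbb{Z}/N\mathbb{Z})^\times$ and $g_r(A)=\sum_{\lambda\in A}e(r\lambda^2/2)$, $g(A)=g_1(A)$. Let $\mathcal{Q}_2(N)$ be the group of triples $(\alpha,r,U)$ (with componentwise product) where $\alpha=(M,\phi)\in\widetilde{\mathrm{GL}}{}_2^+(\mathbb{R})$, some integral multiple $nM$ with $n\neq0$,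 $(n,N)=1$ is an integral matrix of determinant prime to $N$, $r\in U(N)$ satisfies $\det M\equiv r^2\pmod N$, and $U=\frac{g(A)}{g_r(A)}\rho_A(\gamma)$ for some $\gamma\in\tilde\Gamma$ lying over a matrix $G\in \mathrm{SL}_2(\mathbb{Z})$ with $M\equiv rG\pmod N$ (so $U$ is determined by $(M,r)$ up to sign). It acts on functions $f=\sum_\lambda f_\lambda\otimes\mathfrak e_\lambda:\mathbb{H}\to\mathbb{C}[A]$ by $$\big(f|_{k,A}(M,\phi,r,U)\big)(\tau)=\det(M)^{k/2}\phi(\tau)^{-2k}\sum_\lambda f_\lambda(M\tau)\otimes U^{-1}\mathfrak e_\lambda .$$ Let $\Delta=\{(\gamma,1,\rho_A(\gamma)):\gamma\in\tilde\Gamma\}$. For $\xi=(\alpha,r,U)\in\mathcal{Q}_2(N)$ with a finite disjoint decomposition $\Delta\xi\Delta=\bigcup_i\Delta\xi_i$, the Hecke operator $T(\xi)$ on $M_{k,A}$ is $f|_{k,A}T(\xi)=\det(\alpha)^{k/2-1}\sum_i f|_{k,A}\xi_i$. **Theorem.** Let $p$ be a prime coprime to $N$, and let $\xi=(\alpha,p,U)$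 with $\alpha=\left(\begin{pmatrix}p^2&0\\0&1\end{pmatrix},1\right)$ and $U\mathfrak e_\lambda=\mathfrak e_{p^{-1}\lambda}$. Then $\xi\in\mathcal{Q}_2(N)$ and $\Delta\xi\Delta$ is a finite union of cosets $\Delta\xi_i$. Let $f\in M_{k,A}$. Then $f$ and $f|_{k,A}T(\xi)$ have unique Fourier expansions $$f(\tau)=\sum_{\lambda\in A}\ \sum_{n\in\mathbb{Z}+\lambda^2/2}c(\lambda,n)e(n\tau)\otimes\mathfrak e_\lambda,\qquad (f|_{k,A}T(\xi))(\tau)=\sum_{\lambda\in A}\ \sum_{n\in\mathbb{Z}+\lambda^2/2}b(\lambda,n)e(n\tau)\otimes\mathfrak e_\lambda ,$$ and for all $\lambda\in A$ and $n\in\mathbb{Z}+\lambda^2/2$, $$b(\lambda,n)=c(p\lambda,p^2n)+\epsilon_p^{\operatorname{sig}(A)+\left(\frac{-1}{|A|}\right)}\left(\frac{p}{|A|2^{\operatorname{sig}(A)}}\right)p^{k-3/2}\left(\frac{-n}{p}\right)c(\lambda,n)+p^{2k-2}c(\lambda/p,n/p^2).$$ Here $\epsilon_p=1$ if $p\equiv1\pmod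 4$ and $\epsilon_p=i$ if $p\equiv-1\pmod 4$; the symbols $\left(\frac{-1}{|A|}\right)$ and $\left(\frac{p}{|A|2^{\operatorname{sig}(A)}}\right)$ are Kronecker symbols, where $\operatorname{sig}(A)$ is represented by an integer in $\{0,\dots,7\}$; $\left(\frac{-n}{p}\right)$ is the Legendre symbol of the residue class of $-n$ modulo $p$ (the denominator of $n$ divides $N$, so it is prime to $p$); $\lambda/p$ is the element $\mu\in A$ with $p\mu=\lambda$; and $c(\lambda/p,n/p^2)$ is understood to be $0$ if $p^2\nmid n$ (i.e. if $p^2$ does not divide the numerator of $n$). -/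

import Mathlib

open UpperHalfPlane MatrixGroups Manifold

noncomputable section

namespace WeilHecke

/-! ## Discriminant forms -/

/-- The group `ℚ/ℤ`. -/
abbrev QModZ : Type := AddCircle (1 : ℚ)

/-- The character `e(x) = exp(2πix)` of `ℚ/ℤ`. -/
def e : QModZ → ℂ :=
  Function.Periodic.lift (f := fun x : ℚ => Complex.exp (2 * Real.pi * Complex.I * x)) (c := 1)
    (fun x => by
      push_cast
      rw [mul_add, mul_one, Complex.exp_periodic])

/-- A discriminant form on the finite abelian group `A`: a non-degenerate quadratic form
`q : A → ℚ/ℤ`, `q λ = λ²/2`. -/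
structure DiscriminantForm (A : Type*) [AddCommGroup A] where
  q : QuadraticMap ℤ A QModZ
  nondegenerate : ∀ x, (∀ y, QuadraticMap.polar q x y = 0) → x = 0

/-- The dual lattice `L' = {y ∈ ℚⁿ : (x, y) ∈ ℤ for all x ∈ ℤⁿ}` of the lattice `L = ℤⁿ` with
bilinear form `(x, y) = xᵀ G y`. -/
def dualLattice {n : ℕ} (G : Matrix (Fin n) (Fin n) ℤ) : AddSubgroup (Fin n → ℚ) where
  carrier := {y | ∀ x : Fin n → ℤ, ∃ m : ℤ,
    (fun i => (x i : ℚ)) ⬝ᵥ (G.map (Int.cast : ℤ → ℚ)).mulVec y = m}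
  zero_mem' := fun x => ⟨0, by simp⟩
  add_mem' := fun {a b} ha hb x => by
    obtain ⟨m, hm⟩ := ha x
    obtain ⟨m', hm'⟩ := hb x
    exact ⟨m + m', by rw [Matrix.mulVec_add, dotProduct_add, hm, hm']; push_cast; rfl⟩
  neg_mem' := fun {a} ha x => by
    obtain ⟨m, hm⟩ := ha x
    exact ⟨-m, by rw [Matrix.mulVec_neg, dotProduct_neg, hm]; push_cast; rfl⟩

namespace DiscriminantForm

variable {A : Type*} [AddCommGroup A] (D : DiscriminantForm A)

/-- The bilinear form `(λ, μ)` with values in `ℚ/ℤ`. -/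
def bilin (x y : A) : QModZ := QuadraticMap.polar D.q x y

/-- `D` is the discriminant form `L'/L` of the non-degenerate even lattice `L = ℤⁿ` with Gram
matrix `G`: there is a surjection `L' → A` with kernel `L` which carries `y²/2` modulo `1`
to the quadratic form of `D`. -/
def IsDiscriminantFormOf {n : ℕ} (G : Matrix (Fin n) (Fin n) ℤ) : Prop :=
  G.IsSymm ∧ (∀ i, Even (G i i)) ∧ G.det ≠ 0 ∧
  ∃ ψ : dualLattice G →+ A, Function.Surjective ψ ∧
    (∀ y, ψ y = 0 ↔ ∃ x : Fin n → ℤ, (y : Fin n → ℚ) = fun i => (x i : ℚ)) ∧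
    ∀ y, D.q (ψ y) =
      (((y : Fin n → ℚ) ⬝ᵥ (G.map (Int.cast : ℤ → ℚ)).mulVec (y : Fin n → ℚ) / 2 : ℚ) : QModZ)

/-- `s` is the signature `b⁺ - b⁻` modulo `8` of some non-degenerate even lattice with
discriminant form `D`. -/
def IsSignature (s : ZMod 8) : Prop :=
  ∃ (n : ℕ) (G : Matrix (Fin n) (Fin n) ℤ), D.IsDiscriminantFormOf G ∧
    s = (sigPos (G.map (Int.cast : ℤ → ℚ)).toQuadraticForm' : ZMod 8) -
      (sigNeg (G.map (Int.cast : ℤ → ℚ)).toQuadraticForm' : ZMod 8)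

open scoped Classical in
/-- The signature `sig(A) ∈ ℤ/8ℤ`: the signature of any non-degenerate even lattice with
discriminant form `D`. -/
def sig : ZMod 8 := if h : ∃ s, D.IsSignature s then h.choose else 0

/-- The level: the smallest positive integer `N` with `N λ²/2 = 0` for all `λ`. -/
def level : ℕ := sInf {N : ℕ | 0 < N ∧ ∀ x, N • D.q x = 0}

lemma level_smul [Finite A] (x : A) : D.level • x = 0 := by
  have hne : {N : ℕ | 0 < N ∧ ∀ x, N • D.q x = 0}.Nonempty := by
    refine ⟨Nat.card A * Nat.card A, Nat.mul_pos Nat.card_pos Nat.card_pos, fun x => ?_⟩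
    have h := QuadraticMap.map_smul D.q (Nat.card A : ℤ) x
    rw [natCast_zsmul, card_nsmul_eq_zero', QuadraticMap.map_zero] at h
    rw [h]
    norm_cast
  have h := (Nat.sInf_mem hne).2
  change ∀ x, D.level • D.q x = 0 at h
  apply D.nondegenerate
  intro y
  rw [← natCast_zsmul, QuadraticMap.polar_smul_left, natCast_zsmul, QuadraticMap.polar, smul_sub,
    smul_sub, h, h, h]
  simp

/-- Since `N` annihilates `A`, the group `A` is a module over `ℤ/Nℤ`. -/
abbrev zmodModule [Finite A] : Module (ZMod D.level) A := AddCommGroup.zmodModule D.level_smul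

/-- Multiplication by a unit `r ∈ U(N)` on `A`. -/
def unitMul [Finite A] (r : (ZMod D.level)ˣ) : A ≃ A :=
  letI := D.zmodModule
  MulAction.toPerm r

/-- The Gauss sum `g_r(A) = ∑ e(r λ²/2)`. -/
def gauss [Fintype A] (r : (ZMod D.level)ˣ) : ℂ :=
  ∑ x : A, e ((r : ZMod D.level).val • D.q x)

end DiscriminantForm

/-! ## The metaplectic group -/

/-- The metaplectic two-fold cover of `GL₂⁺(ℝ)`: pairs `(M, φ)` with `φ : ℍ → ℂ` holomorphic and
`φ(τ)² = cτ + d`. -/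
@[ext] structure MpGL where
  mat : GL (Fin 2) ℝ
  φ : ℍ → ℂ
  det_pos : 0 < mat.det.val
  holo : MDiff φ
  sq : ∀ τ : ℍ, φ τ ^ 2 = denom mat τ

namespace MpGL

lemma ne_zero (g : MpGL) (τ : ℍ) : g.φ τ ≠ 0 := fun h =>
  denom_ne_zero g.mat τ (by rw [← g.sq τ, h]; simp)

lemma denom_mul {g h : GL (Fin 2) ℝ} (hh : 0 < h.det.val) (τ : ℍ) :
    denom (g * h) τ = denom g ↑(h • τ) * denom h τ := by
  rw [denom_cocycle g h τ.im_ne_zero, coe_smul_of_det_pos hh]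

instance : One MpGL := ⟨⟨1, fun _ => 1, by simp, mdifferentiable_const, by simp⟩⟩

/-- `(M, φ(τ)) (M', φ'(τ)) = (M M', φ(M'τ) φ'(τ))`. -/
instance : Mul MpGL := ⟨fun g h =>
  ⟨g.mat * h.mat, fun τ => g.φ (h.mat • τ) * h.φ τ,
    by rw [map_mul, Units.val_mul]; exact mul_pos g.det_pos h.det_pos,
    (g.holo.comp (mdifferentiable_smul h.det_pos)).mul h.holo,
    fun τ => by rw [mul_pow, g.sq, h.sq, denom_mul h.det_pos]⟩⟩

lemma inv_det_pos (g : MpGL) : 0 < (g.mat⁻¹).det.val := by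
  rw [map_inv, Units.val_inv_eq_inv_val]; exact inv_pos.mpr g.det_pos

instance : Inv MpGL := ⟨fun g =>
  ⟨g.mat⁻¹, fun τ => (g.φ (g.mat⁻¹ • τ))⁻¹, g.inv_det_pos,
    by
      have h := g.holo.comp (mdifferentiable_smul g.inv_det_pos)
      rw [UpperHalfPlane.mdifferentiable_iff] at h ⊢
      exact h.inv (fun z _ => g.ne_zero _),
    fun τ => by
      have h := denom_mul (g := g.mat) g.inv_det_pos τ
      rw [mul_inv_cancel, denom_one] at h
      rw [inv_pow, g.sq]
      exact inv_eq_of_mul_eq_one_right h.symm⟩⟩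

@[simp] lemma one_mat : (1 : MpGL).mat = 1 := rfl
@[simp] lemma one_φ (τ : ℍ) : (1 : MpGL).φ τ = 1 := rfl
@[simp] lemma mul_mat (g h : MpGL) : (g * h).mat = g.mat * h.mat := rfl
@[simp] lemma mul_φ (g h : MpGL) (τ : ℍ) : (g * h).φ τ = g.φ (h.mat • τ) * h.φ τ := rfl
@[simp] lemma inv_mat (g : MpGL) : (g⁻¹).mat = g.mat⁻¹ := rfl
@[simp] lemma inv_φ (g : MpGL) (τ : ℍ) : (g⁻¹).φ τ = (g.φ (g.mat⁻¹ • τ))⁻¹ := rfl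

instance : Group MpGL where
  mul_assoc a b c := by
    ext : 1
    · simp [mul_assoc]
    · funext τ; simp [mul_assoc, mul_smul]
  one_mul a := by
    ext : 1
    · simp
    · funext τ; simp
  mul_one a := by
    ext : 1
    · simp
    · funext τ; simp
  inv_mul_cancel a := by
    ext : 1
    · simp
    · funext τ; simp [a.ne_zero]

/-- The projection `(M, φ) ↦ M`. -/
def proj : MpGL →* GL (Fin 2) ℝ where
  toFun := mat
  map_one' := rfl
  map_mul' _ _ := rfl

end MpGL

/-- The inverse image of `SL₂(ℤ)` in the metaplectic group. -/
def Mp2Z : Subgroup MpGL :=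
  ((Matrix.SpecialLinearGroup.mapGL ℝ : SL(2, ℤ) →* GL (Fin 2) ℝ).range).comap MpGL.proj

lemma denom_mapGL (G : SL(2, ℤ)) (τ : ℍ) :
    denom (Matrix.SpecialLinearGroup.mapGL ℝ G) τ = (G 1 0 : ℂ) * τ + (G 1 1 : ℂ) := by
  simp [denom]

/-- `T = ((1, 1; 0, 1), 1)`. -/
def mpT : Mp2Z :=
  ⟨⟨Matrix.SpecialLinearGroup.mapGL ℝ ModularGroup.T, fun _ => 1, by simp,
    mdifferentiable_const, fun τ => by
      rw [denom_mapGL]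
      simp [ModularGroup.T]⟩, ⟨ModularGroup.T, rfl⟩⟩

/-- `S = ((0, -1; 1, 0), √τ)`, with the principal branch of the square root. -/
def mpS : Mp2Z :=
  ⟨⟨Matrix.SpecialLinearGroup.mapGL ℝ ModularGroup.S, fun τ => (τ : ℂ) ^ (1 / 2 : ℂ), by simp,
    by
      rw [UpperHalfPlane.mdifferentiable_iff]
      have h : DifferentiableOn ℂ (fun z : ℂ => z ^ (1 / 2 : ℂ)) {z | 0 < z.im} :=
        fun z hz => (differentiableAt_id.cpow_const
          (Or.inr (ne_of_gt hz))).differentiableWithinAt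
      exact h.congr fun z hz => by simp [ofComplex_apply_of_im_pos hz],
    fun τ => by
      rw [denom_mapGL, ← Complex.cpow_nat_mul]
      simp [ModularGroup.S]⟩, ⟨ModularGroup.S, rfl⟩⟩

/-! ## The Weil representation -/

section Weil

variable {A : Type*} [AddCommGroup A] [Fintype A] (D : DiscriminantForm A)

/-- `ℂ[A]`, realised as functions: `a : A → ℂ` stands for `∑ a(λ) 𝔢_λ`. -/
abbrev GroupAlg (A : Type*) : Type _ := A → ℂ

/-- `𝔢_λ ↦ e(λ²/2) 𝔢_λ`. -/
def weilT : Module.End ℂ (GroupAlg A) where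
  toFun a := fun x => e (D.q x) * a x
  map_add' a b := by funext x; simp [mul_add]
  map_smul' c a := by funext x; simp [mul_left_comm]

/-- `𝔢_λ ↦ e(-sig(A)/8) / √|A| * ∑_μ e(-(λ, μ)) 𝔢_μ`. -/
def weilS : Module.End ℂ (GroupAlg A) where
  toFun a := fun y => Complex.exp (2 * Real.pi * Complex.I * (-(D.sig.val : ℂ) / 8)) /
    (Real.sqrt (Fintype.card A) : ℂ) * ∑ x : A, e (-D.bilin x y) * a x
  map_add' a b := by funext y; simp [mul_add, Finset.sum_add_distrib]
  map_smul' c a := by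
    funext y
    simp only [Pi.smul_apply, smul_eq_mul, RingHom.id_apply, Finset.mul_sum]
    exact Finset.sum_congr rfl fun x _ => by ring

open scoped Classical in
/-- The Weil representation `ρ_A` on `ℂ[A]`: the representation of the metaplectic
group over `SL₂(ℤ)` whose values on the generators `T`, `S` are given by `weilT`, `weilS`. -/
def weilRep : Mp2Z →* Module.End ℂ (GroupAlg A) :=
  if h : ∃ ρ : Mp2Z →* Module.End ℂ (GroupAlg A), ρ mpT = weilT D ∧ ρ mpS = weilS D
  then h.choose else 1

/-- `𝔢_λ ↦ 𝔢_{r⁻¹ λ}` for `r ∈ U(N)`; in coordinates `a ↦ (λ ↦ a(rλ))`. -/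
def diagOp (r : (ZMod D.level)ˣ) : (Module.End ℂ (GroupAlg A))ˣ :=
  LinearMap.GeneralLinearGroup.ofLinearEquiv (LinearEquiv.funCongrLeft ℂ ℂ (D.unitMul r))

lemma diagOp_single [DecidableEq A] (r : (ZMod D.level)ˣ) (x : A) :
    (diagOp D r : Module.End ℂ (GroupAlg A)) (Pi.single x 1) = Pi.single (D.unitMul r⁻¹ x) 1 := by
  let _ := D.zmodModule
  funext y
  change (Pi.single x 1 : A → ℂ) (r • y) = (Pi.single (r⁻¹ • x) 1 : A → ℂ) y
  simp only [Pi.single_apply, eq_inv_smul_iff]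

/-! ## The extended group and its action -/

/-- Triples `(g, r, U)` with `g = (M, φ)` in the metaplectic group, `r ∈ U(N)` and `U` an
invertible operator on `ℂ[A]`, multiplied componentwise.

The group `𝒬₂(N)` of tuples `(M, φ, r, t)`, `t = ±1`, twisted by the cocycle of a choice of lifts
`ρ̃(M, r)` of the projective Weil representation, is realised inside this group by
`(M, φ, r, t) ↦ ((M, φ), r, t ρ̃(M, r))`; its image does not depend on the lifts and is
`Q2` below. The third component is then the Weil representation of `𝒬₂(N)`. -/
abbrev Ambient : Type _ := MpGL × (ZMod D.level)ˣ × (Module.End ℂ (GroupAlg A))ˣ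

/-- The group `𝒬₂(N)` as a subset of `Ambient`. Some integral multiple `B = nM` with
`n` prime to `N` has determinant prime to `N`, and `det M ≡ r²` modulo `N`. The operator `U` is a
lift of the projective Weil representation of `(M, r)`: writing `M ≡ r G` modulo `N`
with `G ∈ SL₂(ℤ)`, it is `ρ_A(r) ρ_A(γ)` for one of the two elements `γ` over `G`, where `ρ_A(r)`
is the scalar `g(A)/g_r(A)`. -/
def Q2 : Set (Ambient D) :=
  {x | ∃ (n : ℤ) (B : Matrix (Fin 2) (Fin 2) ℤ) (G : SL(2, ℤ)) (γ : Mp2Z),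
    n ≠ 0 ∧ IsCoprime n (D.level : ℤ) ∧ IsCoprime B.det (D.level : ℤ) ∧
    B.map (Int.cast : ℤ → ℝ) = (n : ℝ) • (x.1.mat : Matrix (Fin 2) (Fin 2) ℝ) ∧
    (B.det : ZMod D.level) = (n : ZMod D.level) ^ 2 * (x.2.1 : ZMod D.level) ^ 2 ∧
    B.map (Int.cast : ℤ → ZMod D.level) =
      ((n : ZMod D.level) * (x.2.1 : ZMod D.level)) •
        (G : Matrix (Fin 2) (Fin 2) ℤ).map (Int.cast : ℤ → ZMod D.level) ∧
    (γ : MpGL).mat = Matrix.SpecialLinearGroup.mapGL ℝ G ∧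
    (x.2.2 : Module.End ℂ (GroupAlg A)) = (D.gauss 1 / D.gauss x.2.1) • weilRep D γ}

/-- The section `L` of the projection to the metaplectic group, over the group `Mp2Z`. -/
def sectionL : Mp2Z →* Ambient D :=
  Mp2Z.subtype.prod ((1 : Mp2Z →* (ZMod D.level)ˣ).prod (weilRep D).toHomUnits)

/-- `Δ = L(Mp2Z)`. -/
def Delta : Subgroup (Ambient D) := (sectionL D).range

variable {D}

/-- The weight `k = w/2` action
`f|(M, φ, U) = ∑_λ det(M)^{k/2} φ(τ)^{-2k} f_λ(Mτ) ⊗ U⁻¹ 𝔢_λ`. -/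
def slash (w : ℤ) (f : ℍ → GroupAlg A) (x : Ambient D) : ℍ → GroupAlg A := fun τ =>
  (((x.1.mat.det.val) ^ ((w : ℝ) / 4) : ℝ) : ℂ) •
    (x.1.φ τ ^ (-w)) • ((x.2.2⁻¹ : (Module.End ℂ (GroupAlg A))ˣ) : Module.End ℂ (GroupAlg A))
      (f (x.1.mat • τ))

/-- The left cosets `Δ ξᵢ` contained in the double coset `Δ ξ Δ`. -/
def cosets (ξ : Ambient D) : Set (Quotient (QuotientGroup.rightRel (Delta D))) :=
  Quotient.mk (QuotientGroup.rightRel (Delta D)) '' DoubleCoset.doubleCoset ξ (Delta D) (Delta D)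

/-- The Hecke operator `f|T(ξ) = det(α)^{k/2-1} ∑_i f|ξᵢ` in weight `k = w/2`, where
`Δ ξ Δ` is the disjoint union of the `Δ ξᵢ`. -/
def heckeT (w : ℤ) (f : ℍ → GroupAlg A) (ξ : Ambient D) : ℍ → GroupAlg A :=
  (((ξ.1.mat.det.val) ^ ((w : ℝ) / 4 - 1) : ℝ) : ℂ) •
    ∑ᶠ (c : Quotient (QuotientGroup.rightRel (Delta D))) (_ : c ∈ cosets ξ), slash w f c.out

variable (D)

/-- `f` is a (holomorphic) modular form of weight `k = w/2` and type `ρ_A` for the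
full metaplectic group `Mp2Z`. -/
structure IsModularForm (w : ℤ) (f : ℍ → GroupAlg A) : Prop where
  holo : ∀ x : A, MDiff (fun τ => f τ x)
  transform : ∀ (γ : Mp2Z) (τ : ℍ),
    f ((γ : MpGL).mat • τ) = ((γ : MpGL).φ τ ^ w) • weilRep D γ (f τ)
  bounded : ∀ x : A, IsBoundedAtImInfty (fun τ => f τ x)

/-- `n ∈ ℤ + λ²/2`. -/
def IsExponent (x : A) (n : ℚ) : Prop := (n : QModZ) = D.q x

/-- `f(τ) = ∑_λ ∑_{n ∈ ℤ + λ²/2} c(λ, n) e(nτ) ⊗ 𝔢_λ`. The coefficients are extended by zero to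
all rational `n`. -/
structure IsFourierExpansion (f : ℍ → GroupAlg A) (c : A → ℚ → ℂ) : Prop where
  support : ∀ x n, ¬ IsExponent D x n → c x n = 0
  hasSum : ∀ (τ : ℍ) (x : A),
    HasSum (fun n : ℚ => c x n * Complex.exp (2 * Real.pi * Complex.I * (n * (τ : ℂ)))) (f τ x)

end Weil

/-! ## Quadratic residue symbols and the Hecke element -/

/-- The Kronecker symbol `(a/n)` for `n > 0`. The value at the prime `2` is `0` if `a` is even,
`1` if `a ≡ ±1` and `-1` if `a ≡ ±3` modulo `8`. -/
def kronecker (a : ℤ) (n : ℕ) : ℤ :=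
  ZMod.χ₈ (a : ZMod 8) ^ n.factorization 2 * jacobiSym a (ordCompl[2] n)

/-- `ε_d = 1` if `d ≡ 1` and `ε_d = i` if `d ≡ -1` modulo `4`. -/
def epsilon (d : ℕ) : ℂ := if d % 4 = 1 then 1 else Complex.I

/-- The matrix `(p², 0; 0, 1)`. -/
def matP (p : ℕ) [hp : Fact p.Prime] : GL (Fin 2) ℝ :=
  Matrix.GeneralLinearGroup.mkOfDetNeZero !![(p : ℝ) ^ 2, 0; 0, 1]
    (by simp [Matrix.det_fin_two, hp.out.ne_zero])

/-- `α = ((p², 0; 0, 1), 1)`. -/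
def alphaP (p : ℕ) [hp : Fact p.Prime] : MpGL where
  mat := matP p
  φ := fun _ => 1
  det_pos := by
    have : 0 < p := hp.out.pos
    simp only [matP, Matrix.GeneralLinearGroup.mkOfDetNeZero, Matrix.GeneralLinearGroup.val_det_apply,
      Matrix.GeneralLinearGroup.mk', Matrix.unitOfDetInvertible]
    simp [Matrix.det_fin_two]
    positivity
  holo := mdifferentiable_const
  sq τ := by
    simp [denom, matP, Matrix.GeneralLinearGroup.mkOfDetNeZero]

/-- `ξ = (α, p, 1)`. Its operator on `ℂ[A]` is `ρ̃_A((p², 0; 0, 1), p) : 𝔢_λ ↦ 𝔢_{p⁻¹ λ}`. -/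
def xiP {A : Type*} [AddCommGroup A] [Fintype A] (D : DiscriminantForm A) (p : ℕ) [Fact p.Prime]
    (hpN : p.Coprime D.level) : Ambient D :=
  (alphaP p, ZMod.unitOfCoprime p hpN, diagOp D (ZMod.unitOfCoprime p hpN))

end WeilHecke

end

open WeilHecke

/-!
The Weil representation is made concrete by theta functions. An even lattice `L` with discriminant
form `A` has odd rank `n` (its signature is odd), so `det L` is even; as `p` is prime to the level it
does not divide `det L`, and `p` is odd. Diagonalising `L` over `𝔽_p` and lifting
(`exists_orthogonal`) gives an orthogonal sublattice `⟨2a₁⟩ ⊕ ⋯ ⊕ ⟨2aₙ⟩` with all `aᵢ` prime to `p`,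
and `A = H^⊥/H` for an isotropic subgroup `H` of `B = ∏ ℤ/2aᵢ` (`exists_isSubquotient`). The Weil
representation of `ℤ/2m` is defined by the transformation behaviour of the theta functions `θ_{m,h}`
(`thetaRep`), that of `B` is a tensor product of these and their complex conjugates (`diagRep`), and
`ℂ[A]` is embedded in `ℂ[B]` as an invariant subspace. This proves that the Weil representation
of `A` exists (`weilRep_spec`).

All that is needed about `ρ_A` are its values on `γ` with `αγ` in a given double coset of
`α = diag(p², 1)`, and these are read off from theta functions:
if `αγα⁻¹ = γ'` is integral, then `U = (𝔢_λ ↦ 𝔢_{λ/p})` satisfies `U ρ(γ) = ρ(γ') U`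
(`diagOp_weilRep`); if `αγ = γ' β` with `β = (p, h; 0, p)`, then `U ρ(γ)` and `ρ(γ')` differ by a
product of quadratic Gauss sums modulo `p` (`gaussP_mul_weilRep`). Both follow by summing the
transformation law of `θ_{m,h}(τ, z)` over the translates of `z` by `p`-division points, together
with the uniqueness of Fourier coefficients in `z`.

By the first relation two elements `ξγ`, `ξγ'` lie in the same coset of `Δ` if and only if the bottom
rows of `γ` and `γ'` are proportional modulo `p²`. So the cosets in `ΔξΔ` correspond to the points of
the projective line over `ℤ/p²`, represented by `(0 : 1)`, by `(1 : Nj)` with `j` modulo `p²`, and by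
`(p : N'u)` with `u` a unit modulo `p` (`exists_representatives`). The first coset contributes
`p^{2k-2} c(λ/p, n/p²)`, the second family averages `f` over translations and contributes
`c(pλ, p²n)`. In the third family the product of an odd number of Gauss sums is a constant multiple
of the quadratic character of `u`, and summing the translates of `f` against this character produces
the Legendre symbol of `-n` and one further Gauss sum. Hence an even power `G^{n+1}` of the Gauss sum
occurs, which is determined by `G² = (-1/p) p`; its sign and the Legendre symbol of `∏ aᵢ` are
expressed by `|A|` and `sig(A)` through `|A| |H|² = ∏ 2|aᵢ|`, `sig(A) = ∑ sign aᵢ` and quadratic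
reciprocity (`epsilon_mul_kronecker`).

That `ξ` belongs to `𝒬₂(N)` is seen from a word in `S` and `T` over a matrix congruent to
`diag(p, p⁻¹)` modulo `N`, which acts on `ℂ[A]` as a multiple of `U` by a Gauss sum of `A`
(`weilRep_diagWord`).
-/

/-! ### Generators of the metaplectic group -/

namespace WeilHecke

open Matrix.SpecialLinearGroup (mapGL)

/-- Two holomorphic square roots of `cτ + d` on the connected space `ℍ` agree up to sign. -/
lemma MpGL.φ_eq_or_eq_neg {g h : MpGL} (hm : g.mat = h.mat) : g.φ = h.φ ∨ g.φ = -h.φ := by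
  have key := IsPreconnected.eq_or_eq_neg_of_sq_eq (S := Set.univ) (f := g.φ) (g := h.φ)
    isPreconnected_univ g.holo.continuous.continuousOn h.holo.continuous.continuousOn
    (fun τ _ => by simp [g.sq, h.sq, hm]) (fun {τ} _ => h.ne_zero τ)
  exact key.imp (fun H => funext fun τ => H (Set.mem_univ τ))
    (fun H => funext fun τ => H (Set.mem_univ τ))

lemma Mp2Z.exists_mapGL (γ : Mp2Z) : ∃ G : SL(2, ℤ), (γ : MpGL).mat = mapGL ℝ G := by
  obtain ⟨G, hG⟩ := γ.2
  exact ⟨G, hG.symm⟩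

lemma mpS_mat : (mpS : MpGL).mat = mapGL ℝ ModularGroup.S := rfl

lemma mpT_mat : (mpT : MpGL).mat = mapGL ℝ ModularGroup.T := rfl

lemma mpS_φ (τ : ℍ) : (mpS : MpGL).φ τ = (τ : ℂ) ^ (1 / 2 : ℂ) := rfl

lemma mpT_φ (τ : ℍ) : (mpT : MpGL).φ τ = 1 := rfl

lemma mapGL_S_mul_S : mapGL ℝ ModularGroup.S * mapGL ℝ ModularGroup.S = -1 := by
  have h : ModularGroup.S * ModularGroup.S = -1 := by decide
  rw [← map_mul, h]
  ext i j
  fin_cases i <;> fin_cases j <;> simp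

/-- `S⁴` is the nontrivial element `(1, -1)` of the kernel of the cover. -/
lemma mpS_pow_four : (((mpS ^ 4 : Mp2Z) : MpGL)).mat = 1 ∧
    ∀ τ, (((mpS ^ 4 : Mp2Z) : MpGL)).φ τ = -1 := by
  have h4 : ((mpS ^ 4 : Mp2Z) : MpGL) = ((mpS : MpGL) * mpS) * ((mpS : MpGL) * mpS) := by
    push_cast; simp only [pow_succ, pow_zero, one_mul, mul_assoc]
  have hm : ((mpS : MpGL) * mpS).mat = -1 := by
    rw [MpGL.mul_mat, mpS_mat, mapGL_S_mul_S]
  refine ⟨by rw [h4, MpGL.mul_mat, hm]; simp, fun τ => ?_⟩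
  rw [h4, MpGL.mul_φ, hm, UpperHalfPlane.neg_smul, one_smul, ← pow_two, MpGL.sq, hm]
  simp

lemma mp2Z_eq_or_eq_mul {γ γ' : Mp2Z} (hm : (γ : MpGL).mat = (γ' : MpGL).mat) :
    γ = γ' ∨ γ = γ' * mpS ^ 4 := by
  rcases MpGL.φ_eq_or_eq_neg hm with h | h
  · left; exact Subtype.ext (MpGL.ext hm h)
  · right
    apply Subtype.ext
    apply MpGL.ext
    · rw [Subgroup.coe_mul, MpGL.mul_mat, mpS_pow_four.1, mul_one, hm]
    · funext τ
      rw [Subgroup.coe_mul, MpGL.mul_φ, mpS_pow_four.1, mpS_pow_four.2, one_smul, h]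
      simp

/-- The group over `SL₂(ℤ)` is generated by `S` and `T`: the kernel of the cover is generated by
`S⁴`. -/
lemma mp2Z_closure : Subgroup.closure {mpS, mpT} = (⊤ : Subgroup Mp2Z) := by
  rw [eq_top_iff]
  rintro γ -
  have hS : mpS ∈ Subgroup.closure {mpS, mpT} := Subgroup.subset_closure (by simp)
  have hT : mpT ∈ Subgroup.closure {mpS, mpT} := Subgroup.subset_closure (by simp)
  obtain ⟨G, hG⟩ := Mp2Z.exists_mapGL γ
  have key : ∃ δ ∈ Subgroup.closure {mpS, mpT}, (δ : MpGL).mat = mapGL ℝ G := by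
    have hGc : G ∈ Subgroup.closure {ModularGroup.S, ModularGroup.T} := by
      simp [SpecialLinearGroup.SL2Z_generators]
    clear hG
    induction hGc using Subgroup.closure_induction with
    | mem x hx =>
      rcases hx with rfl | rfl
      · exact ⟨mpS, hS, rfl⟩
      · exact ⟨mpT, hT, rfl⟩
    | one => exact ⟨1, one_mem _, by simp⟩
    | mul x y _ _ hx hy =>
      obtain ⟨a, ha, ha'⟩ := hx
      obtain ⟨b, hb, hb'⟩ := hy
      exact ⟨a * b, mul_mem ha hb, by simp [ha', hb']⟩
    | inv x _ hx =>
      obtain ⟨a, ha, ha'⟩ := hx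
      exact ⟨a⁻¹, inv_mem ha, by simp [ha']⟩
  obtain ⟨δ, hδ, hm⟩ := key
  rcases mp2Z_eq_or_eq_mul (hG.trans hm.symm) with rfl | rfl
  · exact hδ
  · exact mul_mem hδ (pow_mem hS 4)

end WeilHecke

/-! ### The character of `ℚ/ℤ` and uniqueness of Fourier coefficients -/

namespace WeilHecke

lemma e_coe (x : ℚ) : e (x : QModZ) = Complex.exp (2 * Real.pi * Complex.I * x) := rfl

lemma qmodz_coe_eq_coe_iff {x y : ℚ} : (x : QModZ) = (y : QModZ) ↔ ∃ n : ℤ, x = y + n := by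
  rw [QuotientAddGroup.eq, AddSubgroup.mem_zmultiples_iff]
  constructor
  · rintro ⟨k, hk⟩
    exact ⟨-k, by push_cast; simp at hk; linarith⟩
  · rintro ⟨k, hk⟩
    exact ⟨-k, by simp; linarith⟩

lemma qmodz_coe_eq_zero_iff {x : ℚ} : (x : QModZ) = 0 ↔ ∃ n : ℤ, x = n := by
  rw [← QuotientAddGroup.mk_zero, qmodz_coe_eq_coe_iff]
  simp

lemma e_zero : e 0 = 1 := by
  rw [← QuotientAddGroup.mk_zero, e_coe]; simp

lemma e_add (x y : QModZ) : e (x + y) = e x * e y := by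
  induction x using QuotientAddGroup.induction_on with | H x => ?_
  induction y using QuotientAddGroup.induction_on with | H y => ?_
  rw [← QuotientAddGroup.mk_add, e_coe, e_coe, e_coe, ← Complex.exp_add]
  push_cast; ring_nf

lemma e_neg (x : QModZ) : e (-x) = (e x)⁻¹ := by
  exact eq_inv_of_mul_eq_one_left (by rw [← e_add, neg_add_cancel, e_zero])

lemma e_ne_zero (x : QModZ) : e x ≠ 0 := fun h => by
  have := e_add x (-x)
  rw [h, zero_mul, add_neg_cancel, e_zero] at this
  exact one_ne_zero this

lemma e_sum {ι : Type*} (s : Finset ι) (f : ι → QModZ) : e (∑ i ∈ s, f i) = ∏ i ∈ s, e (f i) := by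
  classical
  induction s using Finset.induction_on with
  | empty => simp [e_zero]
  | insert a s ha ih => rw [Finset.sum_insert ha, Finset.prod_insert ha, e_add, ih]

lemma norm_e (x : QModZ) : ‖e x‖ = 1 := by
  induction x using QuotientAddGroup.induction_on with | H x => ?_
  rw [e_coe, show (2 * Real.pi * Complex.I * x : ℂ) = ((2 * Real.pi * x : ℝ) : ℂ) * Complex.I by
    push_cast; ring, Complex.norm_exp_ofReal_mul_I]

lemma e_conj (x : QModZ) : (starRingEnd ℂ) (e x) = e (-x) := by
  rw [e_neg, Complex.inv_def, Complex.normSq_eq_norm_sq, norm_e]; simp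

lemma e_eq_one_iff (x : QModZ) : e x = 1 ↔ x = 0 := by
  refine ⟨fun h => ?_, fun h => h ▸ e_zero⟩
  induction x using QuotientAddGroup.induction_on with | H x => ?_
  rw [e_coe, Complex.exp_eq_one_iff] at h
  obtain ⟨n, hn⟩ := h
  rw [qmodz_coe_eq_zero_iff]
  refine ⟨n, ?_⟩
  have h2 := mul_left_cancel₀ Complex.two_pi_I_ne_zero (hn.trans (mul_comm _ _))
  exact_mod_cast h2

/-- Uniqueness of the coefficients of an absolutely convergent Fourier series. -/
lemma fourier_coeff_eq_zero {c : ℤ → ℂ}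
    (h : ∀ x : ℝ, HasSum (fun s : ℤ => c s * Complex.exp (2 * Real.pi * Complex.I * (s * x))) 0) :
    c = 0 := by
  -- the case `x = 0`: summability in `ℂ` is absolute
  have hc : Summable (fun s => ‖c s‖) := by
    have := (h 0).summable
    simpa using this.norm
  funext n
  let g : ℤ → C(ℝ, ℂ) := fun s =>
    ⟨fun x => c s * Complex.exp (2 * Real.pi * Complex.I * ((s - n : ℤ) * x)), by fun_prop⟩
  have hg : ∀ (s : ℤ) (x : ℝ), ‖g s x‖ = ‖c s‖ := fun s x => by
    simp only [g, ContinuousMap.coe_mk, norm_mul]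
    rw [show (2 * Real.pi * Complex.I * ((s - n : ℤ) * x) : ℂ)
      = ((2 * Real.pi * ((s - n : ℤ) * x) : ℝ) : ℂ) * Complex.I by push_cast; ring,
      Complex.norm_exp_ofReal_mul_I, mul_one]
  -- integrate the series against `e(-nx)` term by term over `[0, 1]`
  have H := intervalIntegral.hasSum_intervalIntegral_of_summable_norm (f := g) (a := 0) (b := 1)
    (by
      refine hc.of_nonneg_of_le (fun _ => norm_nonneg _) fun s => ?_
      rw [ContinuousMap.norm_le _ (norm_nonneg _)]
      exact fun x => (hg s x).le)
  have h0 : ∀ x : ℝ, ∑' s, g s x = 0 := fun x => by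
    have := (h x).mul_right (Complex.exp (-(2 * Real.pi * Complex.I * (n * x))))
    rw [zero_mul] at this
    rw [← this.tsum_eq]
    refine tsum_congr fun s => ?_
    simp only [g, ContinuousMap.coe_mk]
    rw [mul_assoc (c s) (Complex.exp _), ← Complex.exp_add]
    push_cast; ring_nf
  simp only [h0, intervalIntegral.integral_zero] at H
  have hI : ∀ s, ∫ x in (0:ℝ)..1, g s x = if s = n then c n else 0 := fun s => by
    simp only [g, ContinuousMap.coe_mk]
    rw [intervalIntegral.integral_const_mul]
    split_ifs with hs
    · subst hs; simp
    · have hne : (2 * Real.pi * Complex.I * ((s - n : ℤ) : ℂ)) ≠ 0 := by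
        have : ((s - n : ℤ) : ℂ) ≠ 0 := by exact_mod_cast sub_ne_zero.mpr hs
        exact mul_ne_zero Complex.two_pi_I_ne_zero this
      have := integral_exp_mul_complex (a := 0) (b := 1) hne
      simp only [mul_assoc] at this ⊢
      rw [this]
      have h1 : Complex.exp (2 * (Real.pi * (Complex.I * (((s - n : ℤ) : ℂ) * ((1:ℝ) : ℂ))))) = 1 := by
        rw [Complex.exp_eq_one_iff]
        exact ⟨s - n, by push_cast; ring⟩
      rw [h1]; simp
  simp only [hI] at H
  have := H.unique (hasSum_ite_eq n (c n))
  simpa using this.symm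

end WeilHecke

/-! ### Theta functions in one variable -/

noncomputable section

namespace WeilHecke

open Matrix.SpecialLinearGroup (mapGL)

/-- The theta series `∑ₛ c(s) e(s²τ/4m + sz)` with coefficient function `c`. -/
def thetaSum (m : ℕ) (c : ℤ → ℂ) (τ z : ℂ) : ℂ :=
  ∑' s : ℤ, c s * jacobiTheta₂_term s z (τ / (2 * m))

/-- The theta function `∑_h v(h) θ_{m,h}(τ, z)`, where `θ_{m,h}` is the sum over the integers
`s ≡ h` modulo `2m`. -/
def thetaFun (m : ℕ) (v : ZMod (2 * m) → ℂ) (τ z : ℂ) : ℂ := thetaSum m (fun s => v s) τ z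

section theta

variable {m : ℕ} [NeZero m]

lemma im_div_pos (τ : ℍ) : 0 < ((τ : ℂ) / (2 * m)).im := by
  have : (0 : ℝ) < m := by exact_mod_cast Nat.pos_of_ne_zero (NeZero.ne m)
  rw [show ((τ : ℂ) / (2 * m)) = ((1 / (2 * m) : ℝ) : ℂ) * τ by push_cast; ring,
    Complex.im_ofReal_mul]
  exact mul_pos (by positivity) τ.im_pos

lemma summable_thetaSum {c : ℤ → ℂ} {C : ℝ} (hc : ∀ s, ‖c s‖ ≤ C) (τ : ℍ) (z : ℂ) :
    Summable (fun s : ℤ => c s * jacobiTheta₂_term s z ((τ : ℂ) / (2 * m))) := by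
  have h := ((summable_jacobiTheta₂_term_iff z _).2 (im_div_pos (m := m) τ)).norm
  refine Summable.of_norm_bounded (h.mul_left C) fun s => ?_
  rw [norm_mul]
  exact mul_le_mul_of_nonneg_right (hc s) (norm_nonneg _)

lemma exists_norm_le (v : ZMod (2 * m) → ℂ) : ∃ C : ℝ, ∀ h, ‖v h‖ ≤ C :=
  ⟨∑ h, ‖v h‖, fun h => Finset.single_le_sum (f := fun h => ‖v h‖)
    (fun _ _ => norm_nonneg _) (Finset.mem_univ h)⟩

/-- The coefficients of a theta series are determined by its values as a function of `z`. -/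
lemma thetaSum_injective {c c' : ℤ → ℂ} {C C' : ℝ} (hc : ∀ s, ‖c s‖ ≤ C) (hc' : ∀ s, ‖c' s‖ ≤ C')
    (τ : ℍ) (h : ∀ z, thetaSum m c τ z = thetaSum m c' τ z) : c = c' := by
  have key : (fun s : ℤ => (c s - c' s) * jacobiTheta₂_term s 0 ((τ : ℂ) / (2 * m))) = 0 := by
    refine fourier_coeff_eq_zero fun x => ?_
    have h1 := (summable_thetaSum (m := m) hc τ x).hasSum
    have h2 := (summable_thetaSum (m := m) hc' τ x).hasSum
    have h3 := h1.sub h2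
    change HasSum _ (thetaSum m c τ x - thetaSum m c' τ x) at h3
    rw [h, sub_self] at h3
    convert! h3 using 2 with s
    rw [← sub_mul, mul_assoc]
    congr 1
    rw [jacobiTheta₂_term, jacobiTheta₂_term, ← Complex.exp_add]
    ring_nf
  funext s
  have := congrFun key s
  simp only [Pi.zero_apply, mul_eq_zero] at this
  rcases this with h | h
  · exact sub_eq_zero.mp h
  · exact absurd h (Complex.exp_ne_zero _)

lemma thetaFun_injective {v w : ZMod (2 * m) → ℂ} (τ : ℍ)
    (h : ∀ z, thetaFun m v τ z = thetaFun m w τ z) : v = w := by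
  obtain ⟨C, hC⟩ := exists_norm_le v
  obtain ⟨C', hC'⟩ := exists_norm_le w
  have := thetaSum_injective (fun s => hC s) (fun s => hC' s) τ h
  funext k
  have := congrFun this k.val
  simpa using this

lemma sum_mul_thetaFun {ι : Type*} (S : Finset ι) (a : ι → ℂ) (v : ι → ZMod (2 * m) → ℂ)
    (τ : ℍ) (z : ℂ) :
    ∑ i ∈ S, a i * thetaFun m (v i) τ z = thetaFun m (fun h => ∑ i ∈ S, a i * v i h) τ z := by
  have hs : ∀ i ∈ S, Summable (fun s : ℤ => a i * (v i s *
      jacobiTheta₂_term s z ((τ : ℂ) / (2 * m)))) := fun i _ => by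
    obtain ⟨C, hC⟩ := exists_norm_le (v i)
    exact (summable_thetaSum (fun s : ℤ => hC s) τ z).mul_left _
  simp only [thetaFun, thetaSum, ← tsum_mul_left]
  rw [← Summable.tsum_finsetSum hs]
  exact tsum_congr fun s => by rw [Finset.sum_mul]; simp only [mul_assoc]

/-- `θ_v(γτ, z/(cτ+d)) = φ(τ) e(mcz²/(cτ+d)) θ_{vR}(τ, z)` for all row vectors `v`: the matrix `R`
describes the action of `γ` on the span of the theta functions of index `m`. -/
def IsThetaMat (m : ℕ) [NeZero m] (γ : MpGL) (R : Matrix (ZMod (2 * m)) (ZMod (2 * m)) ℂ) : Prop :=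
  ∀ (v : ZMod (2 * m) → ℂ) (τ : ℍ) (z : ℂ),
    thetaFun m v ((γ.mat • τ : ℍ) : ℂ) (z / denom γ.mat τ) =
      γ.φ τ * Complex.exp (2 * Real.pi * Complex.I * (m * γ.mat 1 0 * z ^ 2 / denom γ.mat τ)) *
        thetaFun m (Matrix.vecMul v R) τ z

lemma IsThetaMat.unique {γ : MpGL} {R R' : Matrix (ZMod (2 * m)) (ZMod (2 * m)) ℂ}
    (h : IsThetaMat m γ R) (h' : IsThetaMat m γ R') : R = R' := by
  have : ∀ v, Matrix.vecMul v R = Matrix.vecMul v R' := fun v => by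
    refine thetaFun_injective UpperHalfPlane.I fun z => ?_
    have h1 := h v UpperHalfPlane.I z
    rw [h' v UpperHalfPlane.I z] at h1
    exact (mul_left_cancel₀ (mul_ne_zero (γ.ne_zero _) (Complex.exp_ne_zero _)) h1).symm
  ext i j
  simpa using congrFun (this (Pi.single i 1)) j

lemma IsThetaMat.one : IsThetaMat m 1 1 := fun v τ z => by simp

lemma IsThetaMat.mul {γ γ' : MpGL} (hdet : γ'.mat.det = 1)
    {R R' : Matrix (ZMod (2 * m)) (ZMod (2 * m)) ℂ}
    (h : IsThetaMat m γ R) (h' : IsThetaMat m γ' R') : IsThetaMat m (γ * γ') (R * R') := by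
  intro v τ z
  have hd := MpGL.denom_mul (g := γ.mat) γ'.det_pos τ
  rw [MpGL.mul_mat, hd, mul_smul, mul_comm (denom γ.mat _), ← div_div, h, h', MpGL.mul_φ,
    ← Matrix.vecMul_vecMul]
  have e1 : denom γ'.mat τ ≠ 0 := denom_ne_zero _ _
  have e2 : denom γ.mat ↑(γ'.mat • τ) ≠ 0 := denom_ne_zero _ _
  have hdet' : (γ'.mat 0 0 : ℂ) * γ'.mat 1 1 - γ'.mat 0 1 * γ'.mat 1 0 = 1 := by
    have := congrArg Units.val hdet
    rw [Matrix.GeneralLinearGroup.val_det_apply, Matrix.det_fin_two] at this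
    exact_mod_cast this
  have key : (m * γ.mat 1 0 * (z / denom γ'.mat τ) ^ 2 / denom γ.mat ↑(γ'.mat • τ) : ℂ)
      + m * γ'.mat 1 0 * z ^ 2 / denom γ'.mat τ
      = m * (γ.mat * γ'.mat) 1 0 * z ^ 2 / (denom γ'.mat τ * denom γ.mat ↑(γ'.mat • τ)) := by
    field_simp
    have e3 : denom γ.mat ↑(γ'.mat • τ) * denom γ'.mat τ
        = γ.mat 1 0 * (γ'.mat 0 0 * τ + γ'.mat 0 1) + γ.mat 1 1 * denom γ'.mat τ := by
      rw [← hd, denom, denom]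
      simp [Matrix.mul_apply, Fin.sum_univ_two]
      ring
    have e4 : ((γ.mat * γ'.mat) 1 0 : ℂ) = γ.mat 1 0 * γ'.mat 0 0 + γ.mat 1 1 * γ'.mat 1 0 := by
      simp [Matrix.mul_apply, Fin.sum_univ_two]
    rw [e4]
    have e5 : denom γ'.mat τ = γ'.mat 1 0 * τ + γ'.mat 1 1 := rfl
    linear_combination (m * z ^ 2 * γ'.mat 1 0) * e3 - (m * z ^ 2 * γ.mat 1 0 * γ'.mat 0 0) * e5
      - (m * z ^ 2 * γ.mat 1 0) * hdet'
  rw [← key, mul_add (2 * Real.pi * Complex.I : ℂ), Complex.exp_add]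
  ring

end theta

end WeilHecke

end

namespace WeilHecke

noncomputable section

open Matrix.SpecialLinearGroup (mapGL)

lemma mapGL_apply (G : SL(2, ℤ)) (i j : Fin 2) : (mapGL ℝ G) i j = (G i j : ℝ) := rfl

lemma num_mapGL (G : SL(2, ℤ)) (τ : ℍ) :
    num (mapGL ℝ G) τ = (G 0 0 : ℂ) * τ + (G 0 1 : ℂ) := by
  simp [num]

lemma Mp2Z.det_eq_one (γ : Mp2Z) : (γ : MpGL).mat.det = 1 := by
  obtain ⟨G, hG⟩ := Mp2Z.exists_mapGL γ
  rw [hG]; simp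

section theta

variable {m : ℕ} [NeZero m]

variable (m) in
/-- The quadratic form `h²/4m` on `ℤ/2m`. -/
def thetaQ (h : ZMod (2 * m)) : QModZ := ((h.val ^ 2 / (4 * m) : ℚ) : QModZ)

variable (m) in
/-- The bilinear form `hk/2m` on `ℤ/2m`. -/
def thetaB (h k : ZMod (2 * m)) : QModZ := ((h.val * k.val / (2 * m) : ℚ) : QModZ)

lemma exists_eq_val_add (s : ℤ) : ∃ t : ℤ, s = (s : ZMod (2 * m)).val + 2 * m * t := by
  have h : ((s - (s : ZMod (2 * m)).val : ℤ) : ZMod (2 * m)) = 0 := by simp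
  rw [ZMod.intCast_zmod_eq_zero_iff_dvd] at h
  obtain ⟨t, ht⟩ := h
  exact ⟨t, by push_cast at ht; linarith⟩

lemma thetaQ_intCast (s : ℤ) : thetaQ m (s : ZMod (2 * m)) = ((s ^ 2 / (4 * m) : ℚ) : QModZ) := by
  obtain ⟨t, ht⟩ := exists_eq_val_add (m := m) s
  have hm : (m : ℚ) ≠ 0 := Nat.cast_ne_zero.mpr (NeZero.ne m)
  rw [thetaQ, eq_comm, qmodz_coe_eq_coe_iff]
  refine ⟨t * (s : ZMod (2 * m)).val + m * t ^ 2, ?_⟩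
  have : (s : ℚ) = (s : ZMod (2 * m)).val + 2 * m * t := by exact_mod_cast ht
  rw [this]
  push_cast
  field_simp
  ring

lemma thetaB_intCast (s t : ℤ) :
    thetaB m (s : ZMod (2 * m)) (t : ZMod (2 * m)) = ((s * t / (2 * m) : ℚ) : QModZ) := by
  obtain ⟨k, hk⟩ := exists_eq_val_add (m := m) s
  obtain ⟨l, hl⟩ := exists_eq_val_add (m := m) t
  have hm : (m : ℚ) ≠ 0 := Nat.cast_ne_zero.mpr (NeZero.ne m)
  rw [thetaB, eq_comm, qmodz_coe_eq_coe_iff]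
  refine ⟨k * (t : ZMod (2 * m)).val + l * (s : ZMod (2 * m)).val + 2 * m * k * l, ?_⟩
  have h1 : (s : ℚ) = (s : ZMod (2 * m)).val + 2 * m * k := by exact_mod_cast hk
  have h2 : (t : ℚ) = (t : ZMod (2 * m)).val + 2 * m * l := by exact_mod_cast hl
  conv_lhs => rw [h1, h2]
  push_cast
  field_simp
  ring

variable (m) in
/-- The operator of `T` in the Weil representation of `ℤ/2m`. -/
def thetaMatT : Matrix (ZMod (2 * m)) (ZMod (2 * m)) ℂ := Matrix.diagonal fun h => e (thetaQ m h)

variable (m) in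
/-- The operator of `S` in the Weil representation of `ℤ/2m`. -/
def thetaMatS : Matrix (ZMod (2 * m)) (ZMod (2 * m)) ℂ := fun h k =>
  Complex.exp (2 * Real.pi * Complex.I * (-1 / 8)) / (Real.sqrt (2 * m : ℕ) : ℂ) *
    e (-thetaB m h k)

lemma coe_mpT_smul (τ : ℍ) : (((mpT : MpGL).mat • τ : ℍ) : ℂ) = τ + 1 := by
  rw [mpT_mat, coe_smul_of_det_pos (by simp), num_mapGL, denom_mapGL]
  simp [ModularGroup.T]

lemma coe_mpS_smul (τ : ℍ) : (((mpS : MpGL).mat • τ : ℍ) : ℂ) = -1 / τ := by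
  rw [mpS_mat, coe_smul_of_det_pos (by simp), num_mapGL, denom_mapGL]
  simp [ModularGroup.S]

lemma isThetaMat_T : IsThetaMat m mpT (thetaMatT m) := by
  intro v τ z
  have hd : denom (mpT : MpGL).mat τ = 1 := by
    rw [mpT_mat, denom_mapGL]; simp [ModularGroup.T]
  have hc : (mpT : MpGL).mat 1 0 = 0 := by rw [mpT_mat, mapGL_apply]; simp [ModularGroup.T]
  rw [hd, hc, coe_mpT_smul, mpT_φ]
  simp only [Complex.ofReal_zero, mul_zero, zero_mul, Complex.exp_zero, one_mul, div_one,
    thetaFun, thetaSum]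
  refine tsum_congr fun s => ?_
  rw [thetaMatT, Matrix.vecMul_diagonal, thetaQ_intCast, e_coe, jacobiTheta₂_term,
    jacobiTheta₂_term, mul_assoc (v s), ← Complex.exp_add]
  have hm : (m : ℂ) ≠ 0 := Nat.cast_ne_zero.mpr (NeZero.ne m)
  congr 2
  push_cast
  field_simp
  ring

lemma thetaFun_single (h : ZMod (2 * m)) (τ z : ℂ) :
    thetaFun m (Pi.single h 1) τ z =
      Complex.exp (2 * Real.pi * Complex.I * (h.val ^ 2 * τ / (4 * m) + h.val * z)) *
        jacobiTheta₂ (h.val * τ + 2 * m * z) (2 * m * τ) := by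
  have hm : (m : ℂ) ≠ 0 := Nat.cast_ne_zero.mpr (NeZero.ne m)
  have hinj : Function.Injective fun n : ℤ => 2 * (m : ℤ) * n + h.val := fun a b hab => by
    simpa [NeZero.ne m] using hab
  rw [thetaFun, thetaSum, ← hinj.tsum_eq, jacobiTheta₂, ← tsum_mul_left]
  · refine tsum_congr fun n => ?_
    have : ((2 * (m : ℤ) * n + h.val : ℤ) : ZMod (2 * m)) = h := by
      have h0 : (2 * m : ZMod (2 * m)) = 0 := by exact_mod_cast ZMod.natCast_self (2 * m)
      push_cast
      rw [h0]; simp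
    rw [this, Pi.single_eq_same, one_mul, jacobiTheta₂_term, jacobiTheta₂_term, ← Complex.exp_add]
    congr 1
    push_cast
    field_simp
    ring
  · intro s hs
    have hs' : (s : ZMod (2 * m)) = h := by
      by_contra hne
      exact hs (by simp [Pi.single_eq_of_ne hne])
    obtain ⟨t, ht⟩ := exists_eq_val_add (m := m) s
    exact ⟨t, by rw [hs'] at ht; simp only; linarith⟩

/-- A theta function whose coefficients are a character is a translate of Jacobi's. -/
lemma thetaFun_character (h : ZMod (2 * m)) (τ z : ℂ) :
    thetaFun m (fun k => e (-thetaB m h k)) τ z =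
      jacobiTheta₂ (z - h.val / (2 * m)) (τ / (2 * m)) := by
  rw [thetaFun, thetaSum, jacobiTheta₂]
  refine tsum_congr fun s => ?_
  have h1 := thetaB_intCast (m := m) (h.val : ℤ) s
  rw [Int.cast_natCast, ZMod.natCast_zmod_val] at h1
  rw [h1, ← QuotientAddGroup.mk_neg, e_coe, jacobiTheta₂_term, jacobiTheta₂_term, ← Complex.exp_add]
  congr 1
  push_cast
  ring

/-- Both sides are the principal branch, as the argument of `τ` lies in `(0, π)`. -/
lemma neg_I_mul_cpow (τ : ℍ) : (-Complex.I * τ) ^ (1 / 2 : ℂ) =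
    Complex.exp (2 * Real.pi * Complex.I * (-1 / 8)) * (τ : ℂ) ^ (1 / 2 : ℂ) := by
  have hτ : (τ : ℂ) ≠ 0 := τ.ne_zero
  have hI : -Complex.I ≠ 0 := by simp
  have h0 : 0 ≤ Complex.arg τ := Complex.arg_nonneg_iff.mpr τ.im_pos.le
  have h1 := Complex.arg_le_pi τ
  rw [Complex.cpow_def_of_ne_zero (mul_ne_zero hI hτ), Complex.cpow_def_of_ne_zero hτ,
    Complex.log_mul hI hτ, ← Complex.exp_add, Complex.log_neg_I]
  · congr 1; ring
  · rw [Complex.arg_neg_I]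
    constructor <;> linarith [Real.pi_pos]

lemma neg_I_mul_div_cpow (τ : ℍ) : (-Complex.I * (τ / (2 * m))) ^ (1 / 2 : ℂ) =
    Complex.exp (2 * Real.pi * Complex.I * (-1 / 8)) * (τ : ℂ) ^ (1 / 2 : ℂ) /
      (Real.sqrt (2 * m : ℕ) : ℂ) := by
  have hm : (0 : ℝ) < m := by exact_mod_cast Nat.pos_of_ne_zero (NeZero.ne m)
  have hτ : -Complex.I * (τ : ℂ) ≠ 0 := mul_ne_zero (by simp) τ.ne_zero
  have hr : (0 : ℝ) < (2 * (m : ℝ))⁻¹ := by positivity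
  have hrc : (((2 * (m : ℝ))⁻¹ : ℝ) : ℂ) ≠ 0 := Complex.ofReal_ne_zero.mpr hr.ne'
  rw [← neg_I_mul_cpow, show -Complex.I * ((τ : ℂ) / (2 * m)) =
    (((2 * (m : ℝ))⁻¹ : ℝ) : ℂ) * (-Complex.I * τ) by push_cast; ring,
    Complex.cpow_def_of_ne_zero (mul_ne_zero hrc hτ), Complex.log_ofReal_mul hr hτ, add_mul,
    Complex.exp_add, ← Complex.cpow_def_of_ne_zero hτ, Complex.ofReal_log hr.le,
    ← Complex.cpow_def_of_ne_zero hrc, show (1 / 2 : ℂ) = ((1 / 2 : ℝ) : ℂ) by push_cast; ring,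
    ← Complex.ofReal_cpow hr.le, ← Real.sqrt_eq_rpow, Real.sqrt_inv]
  push_cast
  rw [mul_comm]
  exact (div_eq_mul_inv _ _).symm

/-- The inversion formula, from the functional equation of Jacobi's theta function. -/
lemma isThetaMat_S : IsThetaMat m mpS (thetaMatS m) := by
  have hm : (m : ℂ) ≠ 0 := Nat.cast_ne_zero.mpr (NeZero.ne m)
  have key : ∀ (h : ZMod (2 * m)) (τ : ℍ) (z : ℂ), thetaFun m (Pi.single h 1) (-1 / τ) (z / τ) =
      (τ : ℂ) ^ (1 / 2 : ℂ) * Complex.exp (2 * Real.pi * Complex.I * (m * z ^ 2 / τ)) *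
        thetaFun m (thetaMatS m h) τ z := fun h τ z => by
    have hτ : (τ : ℂ) ≠ 0 := τ.ne_zero
    have h1 : thetaFun m (thetaMatS m h) τ z = Complex.exp (2 * Real.pi * Complex.I * (-1 / 8)) /
        (Real.sqrt (2 * m : ℕ) : ℂ) * thetaFun m (fun k => e (-thetaB m h k)) τ z := by
      simp only [thetaFun, thetaSum, ← tsum_mul_left, thetaMatS, mul_assoc]
    have hq : (Real.sqrt (2 * m : ℕ) : ℂ) ≠ 0 := by
      rw [Complex.ofReal_ne_zero, Real.sqrt_ne_zero']
      exact_mod_cast Nat.pos_of_ne_zero (NeZero.ne (2 * m))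
    have hq2 : (τ : ℂ) ^ (1 / 2 : ℂ) ≠ 0 := by
      rw [Complex.cpow_def_of_ne_zero hτ]; exact Complex.exp_ne_zero _
    rw [thetaFun_single, h1, thetaFun_character, jacobiTheta₂_functional_equation _ (_ / _),
      neg_I_mul_div_cpow]
    have a1 : (h.val * (-1 / τ) + 2 * m * (z / τ) : ℂ) =
        (z - h.val / (2 * m)) / (τ / (2 * m)) := by field_simp; ring
    have a2 : (2 * m * (-1 / τ) : ℂ) = -1 / (τ / (2 * m)) := by field_simp
    have a3 : (2 * Real.pi * Complex.I * (h.val ^ 2 * (-1 / τ) / (4 * m) + h.val * (z / τ)) : ℂ) =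
        2 * Real.pi * Complex.I * (m * z ^ 2 / τ) +
          -Real.pi * Complex.I * (z - h.val / (2 * m)) ^ 2 / (τ / (2 * m)) := by
      field_simp; ring
    rw [a1, a2, a3, Complex.exp_add]
    field_simp
  intro v τ z
  have hd : denom (mpS : MpGL).mat τ = τ := by
    rw [mpS_mat, denom_mapGL]; simp [ModularGroup.S]
  have hc : (mpS : MpGL).mat 1 0 = 1 := by rw [mpS_mat, mapGL_apply]; simp [ModularGroup.S]
  have hv : v = fun k => ∑ h, v h * (Pi.single h 1 : ZMod (2 * m) → ℂ) k := by
    funext k; simp [Pi.single_apply]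
  have h1 := sum_mul_thetaFun Finset.univ v (fun h => Pi.single h 1) ((mpS : MpGL).mat • τ) (z / τ)
  have h2 := sum_mul_thetaFun Finset.univ v (fun h => thetaMatS m h) τ z
  rw [← hv] at h1
  rw [hd, hc, mpS_φ, ← h1, coe_mpS_smul]
  simp only [key, Complex.ofReal_one, mul_one]
  change _ = _ * thetaFun m (fun k => ∑ h, v h * thetaMatS m h k) τ z
  rw [← h2, Finset.mul_sum]
  exact Finset.sum_congr rfl fun h _ => by ring

end theta

end

end WeilHecke

/-! ### The Weil representation of `ℤ/2m` on theta functions -/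

namespace WeilHecke

noncomputable section

open Matrix.SpecialLinearGroup (mapGL)

section theta

variable {m : ℕ} [NeZero m]

lemma IsThetaMat.inv {γ : MpGL} (hdet : γ.mat.det = 1)
    {R R' : Matrix (ZMod (2 * m)) (ZMod (2 * m)) ℂ}
    (h : IsThetaMat m γ R) (hR : R' * R = 1) : IsThetaMat m γ⁻¹ R' := by
  intro v τ z
  have h1 := h (Matrix.vecMul v R') (γ.mat⁻¹ • τ) (z / denom γ.mat⁻¹ τ)
  have hd := MpGL.denom_mul (g := γ.mat) γ.inv_det_pos τ
  rw [mul_inv_cancel, denom_one] at hd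
  have e1 : denom γ.mat⁻¹ τ ≠ 0 := denom_ne_zero _ _
  have e2 : denom γ.mat ↑(γ.mat⁻¹ • τ) ≠ 0 := denom_ne_zero _ _
  have hc : γ.mat⁻¹ 1 0 = -γ.mat 1 0 := by
    have h2 : (γ.mat : Matrix (Fin 2) (Fin 2) ℝ).det = 1 := by
      rw [← Matrix.GeneralLinearGroup.val_det_apply, hdet]; rfl
    rw [Matrix.coe_units_inv, Matrix.inv_def, h2, Matrix.adjugate_fin_two]
    simp
  rw [smul_inv_smul, div_div, mul_comm (denom _ _) (denom _ _), ← hd, div_one,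
    Matrix.vecMul_vecMul, hR, Matrix.vecMul_one] at h1
  rw [MpGL.inv_mat, MpGL.inv_φ, h1, hc]
  have key : (m * γ.mat 1 0 * (z / denom γ.mat⁻¹ τ) ^ 2 / denom γ.mat ↑(γ.mat⁻¹ • τ) : ℂ) =
      -(m * ((-γ.mat 1 0 : ℝ) : ℂ) * z ^ 2 / denom γ.mat⁻¹ τ) := by
    push_cast
    rw [eq_div_of_mul_eq e1 hd.symm]
    field_simp
  rw [key, mul_neg, Complex.exp_neg]
  have e3 := γ.ne_zero (γ.mat⁻¹ • τ)
  field_simp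

lemma mpS_pow_eight : mpS ^ 8 = 1 := by
  have h : mpS ^ 8 = mpS ^ 4 * mpS ^ 4 := by rw [← pow_add]
  rw [h]
  apply Subtype.ext
  rw [Subgroup.coe_mul]
  apply MpGL.ext
  · rw [MpGL.mul_mat, mpS_pow_four.1]; simp
  · funext τ
    rw [MpGL.mul_φ, mpS_pow_four.1, mpS_pow_four.2, mpS_pow_four.2]; simp

lemma IsThetaMat.pow_S (n : ℕ) :
    IsThetaMat m ((mpS ^ n : Mp2Z) : MpGL) (thetaMatS m ^ n) := by
  induction n with
  | zero => simpa using IsThetaMat.one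
  | succ n ih =>
    rw [pow_succ, pow_succ, Subgroup.coe_mul]
    exact ih.mul (Mp2Z.det_eq_one _) isThetaMat_S

/-- The theta functions of index `m` span a space invariant under the metaplectic group. -/
lemma exists_isThetaMat (γ : Mp2Z) :
    ∃ R : (Matrix (ZMod (2 * m)) (ZMod (2 * m)) ℂ)ˣ, IsThetaMat m γ R := by
  have hγ : γ ∈ Subgroup.closure {mpS, mpT} := by rw [mp2Z_closure]; trivial
  induction hγ using Subgroup.closure_induction with
  | mem x hx =>
    rcases hx with rfl | rfl
    -- the matrix of `S` is invertible because `S⁸ = 1`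
    · have h8 : thetaMatS m ^ 8 = 1 := by
        have := IsThetaMat.pow_S (m := m) 8
        rw [mpS_pow_eight] at this
        exact this.unique IsThetaMat.one
      have hu : IsUnit (thetaMatS m) := IsUnit.of_pow_eq_one h8 (by norm_num)
      exact ⟨hu.unit, isThetaMat_S⟩
    · have hu : IsUnit (thetaMatT m) := by
        rw [thetaMatT, Matrix.isUnit_diagonal, Pi.isUnit_iff]
        exact fun h => (e_ne_zero _).isUnit
      exact ⟨hu.unit, isThetaMat_T⟩
  | one => exact ⟨1, IsThetaMat.one⟩
  | mul x y _ _ hx hy =>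
    obtain ⟨R, hR⟩ := hx
    obtain ⟨R', hR'⟩ := hy
    exact ⟨R * R', hR.mul (Mp2Z.det_eq_one _) hR'⟩
  | inv x _ hx =>
    obtain ⟨R, hR⟩ := hx
    exact ⟨R⁻¹, hR.inv (Mp2Z.det_eq_one _) R.inv_mul⟩

variable (m) in
/-- The Weil representation of `ℤ/2m`, as the action of the metaplectic group on theta functions of
index `m`. -/
def thetaRep : Mp2Z →* Matrix (ZMod (2 * m)) (ZMod (2 * m)) ℂ where
  toFun γ := ((exists_isThetaMat (m := m) γ).choose : Matrix (ZMod (2 * m)) (ZMod (2 * m)) ℂ)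
  map_one' := (exists_isThetaMat (m := m) 1).choose_spec.unique IsThetaMat.one
  map_mul' γ γ' := (exists_isThetaMat (m := m) (γ * γ')).choose_spec.unique
    ((exists_isThetaMat (m := m) γ).choose_spec.mul (Mp2Z.det_eq_one _)
      (exists_isThetaMat (m := m) γ').choose_spec)

lemma isThetaMat_thetaRep (γ : Mp2Z) : IsThetaMat m γ (thetaRep m γ) :=
  (exists_isThetaMat (m := m) γ).choose_spec

lemma thetaRep_T : thetaRep m mpT = thetaMatT m := (isThetaMat_thetaRep mpT).unique isThetaMat_T

lemma thetaRep_S : thetaRep m mpS = thetaMatS m := (isThetaMat_thetaRep mpS).unique isThetaMat_S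

/-! ### Division points and the Hecke relations for theta functions -/

/-- The elliptic transformation law. -/
lemma thetaFun_add_mul (w : ZMod (2 * m) → ℂ) (l : ℤ) (τ z : ℂ) :
    thetaFun m w τ (z + l * τ) =
      Complex.exp (-(2 * Real.pi * Complex.I * (m * l ^ 2 * τ + 2 * m * l * z))) *
        thetaFun m w τ z := by
  have hm : (m : ℂ) ≠ 0 := Nat.cast_ne_zero.mpr (NeZero.ne m)
  rw [thetaFun, thetaSum, thetaFun, thetaSum, ← tsum_mul_left]
  refine Eq.trans (tsum_congr fun s => ?_) ((Equiv.addRight (2 * (m : ℤ) * l)).tsum_eq _)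
  have h0 : (2 * m : ZMod (2 * m)) = 0 := by exact_mod_cast ZMod.natCast_self (2 * m)
  have h1 : ((s + 2 * (m : ℤ) * l : ℤ) : ZMod (2 * m)) = s := by
    push_cast; rw [h0]; simp
  rw [Equiv.coe_addRight, h1, mul_left_comm, jacobiTheta₂_term, jacobiTheta₂_term,
    ← Complex.exp_add]
  congr 2
  push_cast
  field_simp
  ring

lemma sum_exp_div {p : ℕ} (hp : 0 < p) (s : ℤ) :
    ∑ i ∈ Finset.range p, Complex.exp (2 * Real.pi * Complex.I * (s * i / p)) =
      if (p : ℤ) ∣ s then (p : ℂ) else 0 := by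
  have hpc : (p : ℂ) ≠ 0 := Nat.cast_ne_zero.mpr hp.ne'
  set ζ := Complex.exp (2 * Real.pi * Complex.I * (s / p)) with hζ
  have h1 : ∀ i : ℕ, Complex.exp (2 * Real.pi * Complex.I * (s * i / p)) = ζ ^ i := fun i => by
    rw [hζ, ← Complex.exp_nat_mul]; congr 1; ring
  have h2 : ζ = 1 ↔ (p : ℤ) ∣ s := by
    rw [hζ, Complex.exp_eq_one_iff]
    constructor
    · rintro ⟨n, hn⟩
      rw [mul_comm] at hn
      have h3 := mul_right_cancel₀ Complex.two_pi_I_ne_zero hn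
      rw [div_eq_iff hpc] at h3
      exact ⟨n, by rw [mul_comm]; exact_mod_cast h3⟩
    · rintro ⟨n, rfl⟩
      exact ⟨n, by push_cast; field_simp⟩
  simp only [h1]
  split_ifs with hs
  · rw [h2.2 hs]; simp
  · have h3 : ζ ^ p = 1 := by
      rw [hζ, ← Complex.exp_nat_mul, Complex.exp_eq_one_iff]
      exact ⟨s, by field_simp⟩
    rw [geom_sum_eq (fun h => hs (h2.1 h)), h3]; simp

lemma norm_exp_two_pi_I_mul {x : ℂ} (hx : x.im = 0) :
    ‖Complex.exp (2 * Real.pi * Complex.I * x)‖ = 1 := by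
  rw [Complex.norm_exp]
  simp [hx]

lemma sum_thetaSum {ι : Type*} (S : Finset ι) {c : ι → ℤ → ℂ} {C : ℝ}
    (hc : ∀ i s, ‖c i s‖ ≤ C) (τ : ℍ) (z : ℂ) :
    ∑ i ∈ S, thetaSum m (c i) τ z = thetaSum m (fun s => ∑ i ∈ S, c i s) τ z := by
  simp only [thetaSum]
  rw [← Summable.tsum_finsetSum fun i _ => summable_thetaSum (hc i) τ z]
  exact tsum_congr fun s => by rw [Finset.sum_mul]

omit [NeZero m] in
lemma thetaFun_add_const (w : ZMod (2 * m) → ℂ) (u : ℂ) (τ z : ℂ) :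
    thetaFun m w τ (z + u) =
      thetaSum m (fun s => w s * Complex.exp (2 * Real.pi * Complex.I * (s * u))) τ z := by
  rw [thetaFun, thetaSum, thetaSum]
  refine tsum_congr fun s => ?_
  rw [jacobiTheta₂_term, jacobiTheta₂_term, mul_assoc (w s), ← Complex.exp_add]
  congr 2; ring

/-- Summing the transformation law over the translates of `z/(cτ+d)` by `p`-division points, for
`c = pc'`. On the right the translation becomes the elliptic one by `ic'τ + id/p`. -/
lemma IsThetaMat.sum_division {γ : MpGL} {R : Matrix (ZMod (2 * m)) (ZMod (2 * m)) ℂ}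
    (h : IsThetaMat m γ R) {p : ℕ} (hp : 0 < p) {c d : ℤ} (hc : γ.mat 1 0 = p * c)
    (hd : γ.mat 1 1 = d) (v : ZMod (2 * m) → ℂ) (τ : ℍ) (z : ℂ) :
    p * thetaSum m (fun s => if (p : ℤ) ∣ s then v s else 0) ((γ.mat • τ : ℍ) : ℂ)
        (z / denom γ.mat τ) =
      γ.φ τ * Complex.exp (2 * Real.pi * Complex.I * (m * γ.mat 1 0 * z ^ 2 / denom γ.mat τ)) *
        thetaSum m (fun s => Matrix.vecMul v R s * ∑ i ∈ Finset.range p,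
          Complex.exp (2 * Real.pi * Complex.I * ((-m * c * d * i ^ 2 + s * i * d) / p))) τ z := by
  have hpc : (p : ℂ) ≠ 0 := Nat.cast_ne_zero.mpr hp.ne'
  have hD : denom γ.mat τ ≠ 0 := denom_ne_zero _ _
  have hDe : denom γ.mat τ = p * c * τ + d := by rw [denom, hc, hd]; push_cast; ring
  obtain ⟨C, hC⟩ := exists_norm_le v
  obtain ⟨C', hC'⟩ := exists_norm_le (Matrix.vecMul v R)
  -- on the left the sum over the division points selects the indices divisible by `p`
  have hL : p * thetaSum m (fun s => if (p : ℤ) ∣ s then v s else 0) ((γ.mat • τ : ℍ) : ℂ)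
      (z / denom γ.mat τ) = ∑ i ∈ Finset.range p,
        thetaFun m v ((γ.mat • τ : ℍ) : ℂ) (z / denom γ.mat τ + (i / p : ℂ)) := by
    simp only [thetaFun_add_const]
    rw [sum_thetaSum (C := C) (c := fun (i : ℕ) s =>
      v s * Complex.exp (2 * Real.pi * Complex.I * (s * (i / p : ℂ))))]
    · rw [thetaSum, thetaSum, ← tsum_mul_left]
      refine tsum_congr fun s => ?_
      rw [← Finset.mul_sum, ← mul_assoc]
      congr 1
      simp only [← mul_div_assoc]
      simp only [mul_div_assoc]
      have := sum_exp_div hp s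
      simp only [mul_div_assoc] at this
      rw [this]
      split_ifs <;> ring
    · intro i s
      rw [norm_mul, norm_exp_two_pi_I_mul, mul_one]
      · exact hC _
      · rw [show (s * (i / p) : ℂ) = ((s * (i / p) : ℝ) : ℂ) by push_cast; ring, Complex.ofReal_im]
  -- on the right the factors depending on `z` cancel
  have hR : ∀ i : ℕ, thetaFun m v ((γ.mat • τ : ℍ) : ℂ) (z / denom γ.mat τ + (i / p : ℂ)) =
      γ.φ τ * Complex.exp (2 * Real.pi * Complex.I * (m * γ.mat 1 0 * z ^ 2 / denom γ.mat τ)) *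
        thetaSum m (fun s => Matrix.vecMul v R s *
          Complex.exp (2 * Real.pi * Complex.I * ((-m * c * d * i ^ 2 + s * i * d) / p))) τ z := by
    intro i
    rw [show z / denom γ.mat τ + (i / p : ℂ) = (z + i / p * denom γ.mat τ) / denom γ.mat τ by
      field_simp, h]
    have h1 : z + i / p * denom γ.mat τ = (z + i * d / p) + ((i * c : ℤ) : ℂ) * τ := by
      rw [hDe]; push_cast; field_simp; ring
    have h2 : ∀ t : ℂ, 2 * Real.pi * Complex.I * (m * γ.mat 1 0 * t ^ 2 / denom γ.mat τ) =
        2 * Real.pi * Complex.I * (m * p * c * t ^ 2 / denom γ.mat τ) := fun t => by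
      rw [hc]; push_cast; ring
    rw [h1, thetaFun_add_mul, ← h1, h2, h2, thetaFun_add_const]
    simp only [thetaSum, ← tsum_mul_left]
    refine tsum_congr fun s => ?_
    have h3 : (m * p * c * (z + i / p * denom γ.mat τ) ^ 2 / denom γ.mat τ : ℂ) =
        m * p * c * z ^ 2 / denom γ.mat τ + 2 * m * c * i * z
          + m * c * i ^ 2 / p * (p * c * τ + d) := by
      rw [← hDe]; field_simp; ring
    rw [h3]
    have h4 : Complex.exp (2 * Real.pi * Complex.I * (m * p * c * z ^ 2 / denom γ.mat τ +
        2 * m * c * i * z + m * c * i ^ 2 / p * (p * c * τ + d))) *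
        (Complex.exp (-(2 * Real.pi * Complex.I * (m * ((i * c : ℤ) : ℂ) ^ 2 * τ +
          2 * m * ((i * c : ℤ) : ℂ) * (z + i * d / p)))) *
          Complex.exp (2 * Real.pi * Complex.I * (s * (i * d / p)))) =
        Complex.exp (2 * Real.pi * Complex.I * (m * p * c * z ^ 2 / denom γ.mat τ)) *
          Complex.exp (2 * Real.pi * Complex.I * ((-m * c * d * i ^ 2 + s * i * d) / p)) := by
      rw [← Complex.exp_add, ← Complex.exp_add, ← Complex.exp_add]
      congr 1
      push_cast
      field_simp
      ring
    linear_combination (γ.φ τ * Matrix.vecMul v R s * jacobiTheta₂_term s z (τ / (2 * m))) * h4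
  rw [hL, Finset.sum_congr rfl fun i _ => hR i, ← Finset.mul_sum, sum_thetaSum (C := C')
    (c := fun (i : ℕ) s => Matrix.vecMul v R s *
      Complex.exp (2 * Real.pi * Complex.I * ((-m * c * d * i ^ 2 + s * i * d) / p)))]
  · simp only [Finset.mul_sum]
  · intro i s
    rw [norm_mul, norm_exp_two_pi_I_mul, mul_one]
    · exact hC' _
    · rw [show ((-m * c * d * i ^ 2 + s * i * d) / p : ℂ) =
        (((-m * c * d * i ^ 2 + s * i * d) / p : ℝ) : ℂ) by push_cast; ring, Complex.ofReal_im]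

end theta

end

end WeilHecke

namespace WeilHecke

noncomputable section

section hecke

/-- The quadratic Gauss sum `∑ e(ux²/p)` over `ℤ/p`. -/
def gaussP (p : ℕ) [NeZero p] (u : ZMod p) : ℂ := ∑ x : ZMod p, ZMod.stdAddChar (u * x ^ 2)

lemma exp_div_eq_stdAddChar (p : ℕ) [NeZero p] (j : ℤ) :
    Complex.exp (2 * Real.pi * Complex.I * (j / p)) = ZMod.stdAddChar (j : ZMod p) := by
  rw [ZMod.stdAddChar_coe]; congr 1; ring

lemma sum_range_eq_sum_zmod (p : ℕ) [NeZero p] (f : ZMod p → ℂ) :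
    ∑ i ∈ Finset.range p, f (i : ZMod p) = ∑ x, f x := by
  refine Finset.sum_bij' (fun i _ => (i : ZMod p)) (fun x _ => x.val) (by simp)
    (fun x _ => by simpa using ZMod.val_lt x) (fun i hi => ?_) (fun x _ => by simp) (by simp)
  exact ZMod.val_cast_of_lt (Finset.mem_range.mp hi)

variable {m : ℕ} [NeZero m] {p : ℕ} [hp : Fact p.Prime]

lemma matP_det_pos : 0 < (matP p).det.val := (alphaP p).det_pos

lemma matP_apply (i j : Fin 2) : (matP p) i j = (!![(p : ℝ) ^ 2, 0; 0, 1] : Matrix _ _ ℝ) i j := rfl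

lemma alphaP_mat : (alphaP p).mat = matP p := rfl

lemma alphaP_φ (τ : ℍ) : (alphaP p).φ τ = 1 := rfl

lemma coe_matP_smul (τ : ℍ) : ((matP p • τ : ℍ) : ℂ) = p ^ 2 * τ := by
  rw [coe_smul_of_det_pos matP_det_pos, num, denom, matP_apply, matP_apply, matP_apply, matP_apply]
  simp

omit [NeZero m] in
/-- Replacing `(τ, z)` by `(p²τ, pz)` dilates the index set by `p`. -/
lemma thetaFun_scale (u : (ZMod (2 * m))ˣ) (hu : (u : ZMod (2 * m)) = p)
    (v : ZMod (2 * m) → ℂ) (τ z : ℂ) :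
    thetaFun m v (p ^ 2 * τ) (p * z) =
      thetaSum m (fun s => if (p : ℤ) ∣ s then v (u⁻¹ * (s : ZMod (2 * m))) else 0) τ z := by
  have hinj : Function.Injective fun n : ℤ => (p : ℤ) * n := fun a b hab => by
    simpa [hp.out.ne_zero] using hab
  have hpz : ∀ n : ℤ, (p : ℤ) ∣ p * n := fun n => dvd_mul_right _ _
  rw [thetaFun, thetaSum, thetaSum]
  refine Eq.trans (tsum_congr fun n => ?_) (hinj.tsum_eq ?_)
  · rw [if_pos (hpz n), jacobiTheta₂_term, jacobiTheta₂_term]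
    push_cast
    rw [← hu, Units.inv_mul_cancel_left]
    congr 2
    ring
  · intro s hs
    have hs' : (p : ℤ) ∣ s := by
      by_contra hne
      exact hs (by simp only [if_neg hne, zero_mul])
    obtain ⟨t, ht⟩ := hs'
    exact ⟨t, ht.symm⟩

omit [NeZero m] in
lemma mul_thetaSum (x : ℂ) (c : ℤ → ℂ) (τ z : ℂ) :
    x * thetaSum m c τ z = thetaSum m (fun s => x * c s) τ z := by
  simp only [thetaSum, ← tsum_mul_left, mul_assoc]

lemma isCoprime_entry (γ : Mp2Z) {c d : ℤ} (hc : (γ : MpGL).mat 1 0 = c)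
    (hd : (γ : MpGL).mat 1 1 = d) : IsCoprime c d := by
  obtain ⟨G, hG⟩ := Mp2Z.exists_mapGL γ
  rw [hG, mapGL_apply] at hc hd
  have h1 : G 1 0 = c := by exact_mod_cast hc
  have h2 : G 1 1 = d := by exact_mod_cast hd
  have := G.det_coe
  rw [Matrix.det_fin_two] at this
  exact ⟨-G 0 1, G 0 0, by rw [← h1, ← h2]; linarith⟩

lemma exists_int_entry (γ : Mp2Z) (i j : Fin 2) : ∃ c : ℤ, (γ : MpGL).mat i j = c := by
  obtain ⟨G, hG⟩ := Mp2Z.exists_mapGL γ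
  exact ⟨G i j, by rw [hG, mapGL_apply]⟩

/-- Conjugation by `diag(p², 1)` corresponds to multiplication by `p` on `ℤ/2m`. -/
theorem thetaRep_conj (u : (ZMod (2 * m))ˣ) (hu : (u : ZMod (2 * m)) = p) {γ γ' : Mp2Z}
    (hγ : (γ' : MpGL) * alphaP p = alphaP p * γ) (h k : ZMod (2 * m)) :
    thetaRep m γ' h k = thetaRep m γ (p * h) (p * k) := by
  have hpc : (p : ℂ) ≠ 0 := Nat.cast_ne_zero.mpr hp.out.ne_zero
  have hmat : (γ' : MpGL).mat * matP p = matP p * (γ : MpGL).mat := congrArg MpGL.mat hγ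
  have hφ : ∀ τ, (γ' : MpGL).φ (matP p • τ) = (γ : MpGL).φ τ := fun τ => by
    have := congrFun (congrArg MpGL.φ hγ) τ
    simpa [alphaP_mat, alphaP_φ] using this
  obtain ⟨c', hc'⟩ := exists_int_entry γ' 1 0
  obtain ⟨d, hd'⟩ := exists_int_entry γ' 1 1
  have hc : (γ : MpGL).mat 1 0 = p * ((p * c' : ℤ) : ℝ) := by
    have := congrArg (fun M : GL (Fin 2) ℝ => M 1 0) hmat
    simp only [Units.val_mul, Matrix.mul_apply, Fin.sum_univ_two, matP_apply] at this
    simp [hc'] at this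
    push_cast
    linarith
  have hd : (γ : MpGL).mat 1 1 = d := by
    have := congrArg (fun M : GL (Fin 2) ℝ => M 1 1) hmat
    simp only [Units.val_mul, Matrix.mul_apply, Fin.sum_univ_two, matP_apply] at this
    simp [hd'] at this
    exact this.symm
  have hpd : IsCoprime (p : ℤ) d := by
    have := isCoprime_entry γ (c := p * (p * c')) (by rw [hc]; push_cast; ring) hd
    exact this.of_mul_left_left
  have hsum : ∀ s : ℤ, ∑ i ∈ Finset.range p, Complex.exp (2 * Real.pi * Complex.I *
      ((-m * ((p * c' : ℤ) : ℂ) * d * i ^ 2 + s * i * d) / p)) =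
        if (p : ℤ) ∣ s then (p : ℂ) else 0 := fun s => by
    have h1 := sum_exp_div hp.out.pos (s * d)
    have h2 : (p : ℤ) ∣ s * d ↔ (p : ℤ) ∣ s := ⟨fun h => hpd.dvd_of_dvd_mul_right h,
      fun h => h.mul_right _⟩
    simp only [h2] at h1
    rw [← h1]
    refine Finset.sum_congr rfl fun i _ => ?_
    rw [show (2 * Real.pi * Complex.I * ((-m * ((p * c' : ℤ) : ℂ) * d * i ^ 2 + s * i * d) / p) : ℂ)
      = 2 * Real.pi * Complex.I * (((s * d : ℤ) : ℂ) * i / p) +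
        ((-m * c' * d * i ^ 2 : ℤ) : ℂ) * (2 * Real.pi * Complex.I) by
        push_cast; field_simp; ring, Complex.exp_add, Complex.exp_int_mul_two_pi_mul_I, mul_one]
  -- `z/(cτ+d)` at `τ` corresponds to `pz/(c'p²τ+d)` at `p²τ`; compare the coefficients in `z`
  have hdn : ∀ τ : ℍ, denom (γ' : MpGL).mat ↑(matP p • τ) = denom (γ : MpGL).mat τ := fun τ => by
    rw [denom, denom, hc, hd, hc', hd', coe_matP_smul]; push_cast; ring
  set v : ZMod (2 * m) → ℂ := Pi.single h 1 with hv
  set v' : ZMod (2 * m) → ℂ := Pi.single (p * h) 1 with hv'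
  have hvv' : ∀ x, v (u⁻¹ * x) = v' x := fun x => by
    rw [hv, hv', Pi.single_apply, Pi.single_apply, ← hu]
    simp only [Units.inv_mul_eq_iff_eq_mul]
  set w : ZMod (2 * m) → ℂ := Matrix.vecMul v (thetaRep m γ') with hw
  set w' : ZMod (2 * m) → ℂ := Matrix.vecMul v' (thetaRep m γ) with hw'
  have key : (fun s : ℤ => if (p : ℤ) ∣ s then w (u⁻¹ * (s : ZMod (2 * m))) else 0) =
      fun s : ℤ => if (p : ℤ) ∣ s then w' s else 0 := by
    obtain ⟨C, hC⟩ := exists_norm_le w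
    obtain ⟨C', hC'⟩ := exists_norm_le w'
    have hC0 : 0 ≤ C := (norm_nonneg _).trans (hC 0)
    have hC0' : 0 ≤ C' := (norm_nonneg _).trans (hC' 0)
    refine thetaSum_injective (m := m) (C := C) (C' := C') ?_ ?_ UpperHalfPlane.I fun z => ?_
    · intro s; split_ifs <;> simp [hC, hC0]
    · intro s; split_ifs <;> simp [hC', hC0']
    set τ : ℍ := UpperHalfPlane.I
    have h1 := (isThetaMat_thetaRep (m := m) γ).sum_division hp.out.pos hc hd v' τ z
    have h2 := isThetaMat_thetaRep (m := m) γ' v (matP p • τ) (p * z)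
    rw [← mul_smul, hmat, mul_smul, hdn, hφ, coe_matP_smul, coe_matP_smul, mul_div_assoc,
      thetaFun_scale u hu, thetaFun_scale u hu] at h2
    simp only [hvv', hsum] at h1 h2
    rw [h2] at h1
    have h3 : (m * (γ' : MpGL).mat 1 0 * (p * z) ^ 2 / denom (γ : MpGL).mat τ : ℂ) =
        m * (γ : MpGL).mat 1 0 * z ^ 2 / denom (γ : MpGL).mat τ := by
      rw [hc, hc']; push_cast; ring
    rw [h3, mul_left_comm] at h1
    have h4 := mul_left_cancel₀ (mul_ne_zero ((γ : MpGL).ne_zero τ) (Complex.exp_ne_zero _)) h1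
    have h5 : (fun s : ℤ => w' s * if (p : ℤ) ∣ s then (p : ℂ) else 0) =
        fun s : ℤ => p * if (p : ℤ) ∣ s then w' s else 0 := by
      funext s; split_ifs <;> ring
    rw [h5, ← mul_thetaSum] at h4
    exact mul_left_cancel₀ hpc h4
  -- every class modulo `2m` contains multiples of `p`
  have hfin := congrFun key (p * k.val)
  simp only [dvd_mul_right, if_true] at hfin
  push_cast at hfin
  rw [ZMod.natCast_zmod_val, ← hu, ← mul_assoc, Units.inv_mul, one_mul, hw, hw', hv, hv',
    Matrix.single_one_vecMul, Matrix.single_one_vecMul] at hfin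
  rw [← hu]
  simpa [← hu] using hfin

/-- The double coset relation `diag(p², 1) γ = γ' (p, h; 0, p)` for theta functions: the division
points contribute a quadratic Gauss sum modulo `p`. -/
theorem gaussP_mul_thetaRep (u : (ZMod (2 * m))ˣ) (hu : (u : ZMod (2 * m)) = p) {γ γ' : Mp2Z}
    {β : MpGL} {φ₀ : ℂ} (hβφ : ∀ τ, β.φ τ = φ₀) {b₁ : ℤ}
    (hβ : (β.mat : Matrix (Fin 2) (Fin 2) ℝ) = !![(p : ℝ), 4 * m * b₁; 0, p])
    (hγ : alphaP p * γ = γ' * β) (hc : (γ : MpGL).mat 1 0 = p)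
    (hd : (γ : MpGL).mat 1 1 = 4 * m * b₁) (h k : ZMod (2 * m)) :
    φ₀ * gaussP p (-b₁) * thetaRep m γ (p * h) k = p * thetaRep m γ' h k := by
  have hpc : (p : ℂ) ≠ 0 := Nat.cast_ne_zero.mpr hp.out.ne_zero
  have hpr : (p : ℝ) ≠ 0 := Nat.cast_ne_zero.mpr hp.out.ne_zero
  have hmc : (m : ℂ) ≠ 0 := Nat.cast_ne_zero.mpr (NeZero.ne m)
  have hmat : matP p * (γ : MpGL).mat = (γ' : MpGL).mat * β.mat := congrArg MpGL.mat hγ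
  have hφ : ∀ τ, (γ : MpGL).φ τ = (γ' : MpGL).φ (β.mat • τ) * φ₀ := fun τ => by
    have := congrFun (congrArg MpGL.φ hγ) τ
    simpa [alphaP_φ, hβφ] using this
  -- `γ'` has bottom row `(1, 0)`
  have hc' : (γ' : MpGL).mat 1 0 = 1 := by
    have := congrArg (fun M : GL (Fin 2) ℝ => M 1 0) hmat
    simp only [Units.val_mul, Matrix.mul_apply, Fin.sum_univ_two, matP_apply, hβ] at this
    simp [hc] at this
    exact (mul_eq_right₀ hpr).mp this.symm
  have hd' : (γ' : MpGL).mat 1 1 = 0 := by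
    have := congrArg (fun M : GL (Fin 2) ℝ => M 1 1) hmat
    simp only [Units.val_mul, Matrix.mul_apply, Fin.sum_univ_two, matP_apply, hβ] at this
    simp [hd, hc'] at this
    rcases this with h | h
    · exact h
    · exact absurd h hp.out.ne_zero
  have hcop : (2 * m).Coprime p := by
    have h1 : IsUnit ((p : ℕ) : ZMod (2 * m)) := hu ▸ u.isUnit
    exact ((ZMod.isUnit_iff_coprime p (2 * m)).mp h1).symm
  have hsum : ∀ s : ℤ, ∑ i ∈ Finset.range p, Complex.exp (2 * Real.pi * Complex.I *
      ((-m * ((1 : ℤ) : ℂ) * ((4 * m * b₁ : ℤ) : ℂ) * i ^ 2 + s * i * ((4 * m * b₁ : ℤ) : ℂ)) / p)) =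
        Complex.exp (2 * Real.pi * Complex.I * (b₁ * s ^ 2 / p)) * gaussP p (-b₁) := fun s => by
    -- complete the square: `-4m²b₁i² + 4mb₁si = b₁s² - b₁(2mi - s)²`
    have h1 : ∀ i : ℕ, Complex.exp (2 * Real.pi * Complex.I * ((-m * ((1 : ℤ) : ℂ) *
        ((4 * m * b₁ : ℤ) : ℂ) * i ^ 2 + s * i * ((4 * m * b₁ : ℤ) : ℂ)) / p)) =
        Complex.exp (2 * Real.pi * Complex.I * (b₁ * s ^ 2 / p)) *
          ZMod.stdAddChar (-(b₁ : ZMod p) * (((2 * m : ℕ) : ZMod p) * (i : ZMod p) - (s : ZMod p)) ^ 2) := by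
      intro i
      have h2 : (-(b₁ : ZMod p) * (((2 * m : ℕ) : ZMod p) * (i : ZMod p) - (s : ZMod p)) ^ 2) =
          ((-b₁ * ((2 * m : ℕ) * i - s) ^ 2 : ℤ) : ZMod p) := by push_cast; ring
      rw [h2, ← exp_div_eq_stdAddChar, ← Complex.exp_add]
      congr 1
      push_cast
      ring
    simp only [h1]
    rw [← Finset.mul_sum, sum_range_eq_sum_zmod p fun x =>
      ZMod.stdAddChar (-(b₁ : ZMod p) * (((2 * m : ℕ) : ZMod p) * x - (s : ZMod p)) ^ 2), gaussP]
    congr 1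
    exact Equiv.sum_comp ((Units.mulLeft (ZMod.unitOfCoprime (2 * m) hcop)).trans
      (Equiv.subRight (s : ZMod p))) fun x => ZMod.stdAddChar (-(b₁ : ZMod p) * x ^ 2)
  have hτβ : ∀ τ : ℍ, ((β.mat • τ : ℍ) : ℂ) = τ + 4 * m * b₁ / p := fun τ => by
    rw [coe_smul_of_det_pos β.det_pos, num, denom, hβ]
    simp
    field_simp
  have hshift : ∀ (w : ZMod (2 * m) → ℂ) (τ : ℍ) (z : ℂ), thetaFun m w ((β.mat • τ : ℍ) : ℂ) z =
      thetaSum m (fun s => w s * Complex.exp (2 * Real.pi * Complex.I * (b₁ * s ^ 2 / p))) τ z := by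
    intro w τ z
    rw [thetaFun, thetaSum, thetaSum, hτβ]
    refine tsum_congr fun s => ?_
    rw [jacobiTheta₂_term, jacobiTheta₂_term, mul_assoc (w s), ← Complex.exp_add]
    congr 2
    field_simp
    ring
  set v : ZMod (2 * m) → ℂ := Pi.single h 1 with hv
  set v' : ZMod (2 * m) → ℂ := Pi.single (p * h) 1 with hv'
  have hvv' : ∀ x, v (u⁻¹ * x) = v' x := fun x => by
    rw [hv, hv', Pi.single_apply, Pi.single_apply, ← hu]
    simp only [Units.inv_mul_eq_iff_eq_mul]
  set w : ZMod (2 * m) → ℂ := Matrix.vecMul v (thetaRep m γ') with hw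
  set w' : ZMod (2 * m) → ℂ := Matrix.vecMul v' (thetaRep m γ) with hw'
  have key : (fun s : ℤ => p * (w s * Complex.exp (2 * Real.pi * Complex.I * (b₁ * s ^ 2 / p)))) =
      fun s : ℤ => φ₀ * (w' s * (Complex.exp (2 * Real.pi * Complex.I * (b₁ * s ^ 2 / p)) *
        gaussP p (-b₁))) := by
    obtain ⟨C, hC⟩ := exists_norm_le w
    obtain ⟨C', hC'⟩ := exists_norm_le w'
    have hexp : ∀ s : ℤ, ‖Complex.exp (2 * Real.pi * Complex.I * (b₁ * s ^ 2 / p))‖ = 1 := fun s => by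
      apply norm_exp_two_pi_I_mul
      rw [show (b₁ * s ^ 2 / p : ℂ) = ((b₁ * s ^ 2 / p : ℝ) : ℂ) by push_cast; ring,
        Complex.ofReal_im]
    refine thetaSum_injective (m := m) (C := p * C) (C' := ‖φ₀‖ * (C' * ‖gaussP p (-b₁)‖)) ?_ ?_
      UpperHalfPlane.I fun z => ?_
    · intro s
      rw [norm_mul, norm_mul, hexp, mul_one, Complex.norm_natCast]
      exact mul_le_mul_of_nonneg_left (hC _) (Nat.cast_nonneg _)
    · intro s
      rw [norm_mul, norm_mul, norm_mul, hexp, one_mul]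
      gcongr
      exact hC' _
    set τ : ℍ := UpperHalfPlane.I
    have h1 := (isThetaMat_thetaRep (m := m) γ).sum_division hp.out.pos (c := 1)
      (d := 4 * m * b₁) (by rw [hc]; simp) (by rw [hd]; push_cast; ring) v' τ z
    have h2 := isThetaMat_thetaRep (m := m) γ' v (β.mat • τ) z
    have hD : denom (γ : MpGL).mat τ = p * ((β.mat • τ : ℍ) : ℂ) := by
      rw [denom, hc, hd, hτβ]; push_cast; field_simp
    have hD' : denom (γ' : MpGL).mat ↑(β.mat • τ) = ((β.mat • τ : ℍ) : ℂ) := by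
      rw [denom, hc', hd']; push_cast; ring
    have hne : ((β.mat • τ : ℍ) : ℂ) ≠ 0 := (β.mat • τ).ne_zero
    rw [← mul_smul, ← hmat, mul_smul, hD', hc', coe_matP_smul,
      show z / ((β.mat • τ : ℍ) : ℂ) = p * (z / denom (γ : MpGL).mat τ) by rw [hD]; field_simp,
      thetaFun_scale u hu, hshift] at h2
    simp only [hvv', hsum] at h1 h2
    rw [h2, hφ, hc] at h1
    have h3 : (m * ((p : ℝ) : ℂ) * z ^ 2 / denom (γ : MpGL).mat τ : ℂ) =
        m * ((1 : ℝ) : ℂ) * z ^ 2 / ((β.mat • τ : ℍ) : ℂ) := by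
      rw [hD]; push_cast; field_simp
    rw [h3, ← hw, ← hw'] at h1
    rw [← mul_thetaSum, ← mul_thetaSum]
    refine mul_left_cancel₀ (mul_ne_zero ((γ' : MpGL).ne_zero (β.mat • τ)) (Complex.exp_ne_zero
      (2 * Real.pi * Complex.I * (m * ((1 : ℝ) : ℂ) * z ^ 2 / ((β.mat • τ : ℍ) : ℂ))))) ?_
    linear_combination h1
  have hfin := congrFun key k.val
  beta_reduce at hfin
  have he := Complex.exp_ne_zero (2 * Real.pi * Complex.I * (b₁ * ((k.val : ℤ) : ℂ) ^ 2 / p))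
  have hfin' : p * w k = φ₀ * gaussP p (-b₁) * w' k := by
    refine mul_right_cancel₀ he ?_
    rw [Int.cast_natCast, ZMod.natCast_zmod_val] at hfin
    linear_combination hfin
  rw [hw, hw', hv, hv', Matrix.single_one_vecMul, Matrix.single_one_vecMul] at hfin'
  exact hfin'.symm

end hecke

end

end WeilHecke

/-! ### Diagonal forms of arbitrary signature -/

namespace WeilHecke

noncomputable section

instance neZero_natAbs (a : ℤ) [NeZero a] : NeZero a.natAbs :=
  ⟨Int.natAbs_ne_zero.mpr (NeZero.ne a)⟩

section rankOne

variable (a : ℤ) [NeZero a]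

/-- The quadratic form `h²/4a` on `ℤ/2a`, for `a` of either sign. -/
def rankOneQ (h : ZMod (2 * a.natAbs)) : QModZ := ((h.val ^ 2 / (4 * a) : ℚ) : QModZ)

/-- The bilinear form `hk/2a` on `ℤ/2a`. -/
def rankOneB (h k : ZMod (2 * a.natAbs)) : QModZ := ((h.val * k.val / (2 * a) : ℚ) : QModZ)

/-- The Weil representation of `ℤ/2a` with quadratic form `h²/4a`: for negative `a` it is the
complex conjugate of the one for `|a|`. -/
def rankOneRep : Mp2Z →* Matrix (ZMod (2 * a.natAbs)) (ZMod (2 * a.natAbs)) ℂ :=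
  if 0 < a then thetaRep a.natAbs else
    ((starRingEnd ℂ).mapMatrix.toMonoidHom).comp (thetaRep a.natAbs)

variable {a}

lemma rankOneRep_of_pos (ha : 0 < a) (γ : Mp2Z) (h k : ZMod (2 * a.natAbs)) :
    rankOneRep a γ h k = thetaRep a.natAbs γ h k := by
  rw [rankOneRep, if_pos ha]

lemma rankOneRep_of_neg (ha : a < 0) (γ : Mp2Z) (h k : ZMod (2 * a.natAbs)) :
    rankOneRep a γ h k = starRingEnd ℂ (thetaRep a.natAbs γ h k) := by
  rw [rankOneRep, if_neg ha.not_gt]; rfl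

omit [NeZero a] in
lemma natAbs_cast_of_pos (ha : 0 < a) {R : Type*} [Ring R] : ((a.natAbs : ℕ) : R) = (a : R) := by
  have : ((a.natAbs : ℕ) : ℤ) = a := Int.natAbs_of_nonneg ha.le
  rw [← Int.cast_natCast, this]

omit [NeZero a] in
lemma natAbs_cast_of_neg (ha : a < 0) {R : Type*} [Ring R] : ((a.natAbs : ℕ) : R) = -(a : R) := by
  have : ((a.natAbs : ℕ) : ℤ) = -a := by omega
  rw [← Int.cast_natCast, this, Int.cast_neg]

lemma pos_or_neg_of_neZero : 0 < a ∨ a < 0 := (NeZero.ne a).lt_or_gt.symm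

lemma rankOneRep_T : rankOneRep a mpT = Matrix.diagonal fun h => e (rankOneQ a h) := by
  ext h k
  rcases pos_or_neg_of_neZero (a := a) with ha | ha
  · rw [rankOneRep_of_pos ha, thetaRep_T, thetaMatT, Matrix.diagonal_apply, Matrix.diagonal_apply,
      thetaQ, rankOneQ, natAbs_cast_of_pos ha]
  · rw [rankOneRep_of_neg ha, thetaRep_T, thetaMatT, Matrix.diagonal_apply, Matrix.diagonal_apply,
      thetaQ, rankOneQ, natAbs_cast_of_neg ha, apply_ite (starRingEnd ℂ), map_zero, e_conj,
      ← QuotientAddGroup.mk_neg]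
    congr 4
    rw [mul_neg, div_neg, neg_neg]

lemma rankOneRep_S (h k : ZMod (2 * a.natAbs)) : rankOneRep a mpS h k =
    Complex.exp (2 * Real.pi * Complex.I * (-(a.sign : ℂ) / 8)) /
      (Real.sqrt (2 * a.natAbs : ℕ) : ℂ) * e (-rankOneB a h k) := by
  rcases pos_or_neg_of_neZero (a := a) with ha | ha
  · rw [rankOneRep_of_pos ha, thetaRep_S, thetaMatS, thetaB, rankOneB, natAbs_cast_of_pos ha,
      Int.sign_eq_one_of_pos ha]
    simp
  · rw [rankOneRep_of_neg ha, thetaRep_S, thetaMatS, thetaB, rankOneB, natAbs_cast_of_neg ha,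
      Int.sign_eq_neg_one_of_neg ha, map_mul, map_div₀, e_conj, Complex.conj_ofReal,
      ← Complex.exp_conj, ← QuotientAddGroup.mk_neg, ← QuotientAddGroup.mk_neg,
      ← QuotientAddGroup.mk_neg]
    congr 3
    · simp [Complex.conj_ofNat]
      ring
    · congr 1
      rw [mul_neg, div_neg, neg_neg]

lemma gaussP_conj (p : ℕ) [NeZero p] (u : ZMod p) : starRingEnd ℂ (gaussP p u) = gaussP p (-u) := by
  rw [gaussP, gaussP, map_sum]
  refine Finset.sum_congr rfl fun x _ => ?_
  rw [← AddChar.map_neg_eq_conj, neg_mul]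

variable {p : ℕ} [hp : Fact p.Prime]

omit [NeZero a] in
lemma exists_unit_of_coprime (hpa : ¬ (p : ℤ) ∣ 2 * a) :
    ∃ u : (ZMod (2 * a.natAbs))ˣ, (u : ZMod (2 * a.natAbs)) = p := by
  have h : p.Coprime (2 * a.natAbs) := by
    rw [Nat.Prime.coprime_iff_not_dvd hp.out]
    intro h
    apply hpa
    have := Int.natCast_dvd_natCast.mpr h
    rw [← Int.dvd_natAbs]
    simpa [Int.natAbs_mul] using this
  exact ⟨ZMod.unitOfCoprime p h, rfl⟩

lemma rankOneRep_conj (hpa : ¬ (p : ℤ) ∣ 2 * a) {γ γ' : Mp2Z}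
    (hγ : (γ' : MpGL) * alphaP p = alphaP p * γ) (h k : ZMod (2 * a.natAbs)) :
    rankOneRep a γ' h k = rankOneRep a γ (p * h) (p * k) := by
  obtain ⟨u, hu⟩ := exists_unit_of_coprime hpa
  rcases pos_or_neg_of_neZero (a := a) with ha | ha
  · rw [rankOneRep_of_pos ha, rankOneRep_of_pos ha, thetaRep_conj u hu hγ]
  · rw [rankOneRep_of_neg ha, rankOneRep_of_neg ha, thetaRep_conj u hu hγ]

lemma gaussP_mul_rankOneRep (hpa : ¬ (p : ℤ) ∣ 2 * a) {γ γ' : Mp2Z} {β : MpGL} {φ₀ : ℝ}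
    (hβφ : ∀ τ, β.φ τ = φ₀) {b b₁ : ℤ} (hb : b = 4 * a * b₁)
    (hβ : (β.mat : Matrix (Fin 2) (Fin 2) ℝ) = !![(p : ℝ), b; 0, p])
    (hγ : alphaP p * γ = γ' * β) (hc : (γ : MpGL).mat 1 0 = p)
    (hd : (γ : MpGL).mat 1 1 = b) (h k : ZMod (2 * a.natAbs)) :
    φ₀ * gaussP p (-b₁) * rankOneRep a γ (p * h) k = p * rankOneRep a γ' h k := by
  obtain ⟨u, hu⟩ := exists_unit_of_coprime hpa
  subst hb
  rcases pos_or_neg_of_neZero (a := a) with ha | ha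
  · rw [rankOneRep_of_pos ha, rankOneRep_of_pos ha]
    have h1 : (((4 * a * b₁ : ℤ)) : ℝ) = 4 * (a.natAbs : ℕ) * b₁ := by
      rw [natAbs_cast_of_pos ha]; push_cast; ring
    exact gaussP_mul_thetaRep u hu hβφ (by rw [hβ, h1]) hγ hc (by rw [hd, h1]) h k
  · rw [rankOneRep_of_neg ha, rankOneRep_of_neg ha]
    have h1 : (((4 * a * b₁ : ℤ)) : ℝ) = 4 * (a.natAbs : ℕ) * ((-b₁ : ℤ) : ℝ) := by
      rw [natAbs_cast_of_neg ha]; push_cast; ring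
    have h2 := gaussP_mul_thetaRep u hu hβφ (b₁ := -b₁) (by rw [hβ, h1]) hγ hc (by rw [hd, h1]) h k
    have h3 := congrArg (starRingEnd ℂ) h2
    rw [map_mul, map_mul, map_mul, Complex.conj_ofReal, gaussP_conj, Complex.conj_natCast] at h3
    simpa using h3

end rankOne

section diagonal

variable {n : ℕ} (a : Fin n → ℤ) [∀ i, NeZero (a i)]

/-- The discriminant group `∏ ℤ/2aᵢ` of the lattice with Gram matrix `diag(2a₁, …, 2aₙ)`. -/
abbrev DiagGroup : Type := ∀ i, ZMod (2 * (a i).natAbs)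

/-- The quadratic form of `DiagGroup a`. -/
def diagQ (r : DiagGroup a) : QModZ := ∑ i, rankOneQ (a i) (r i)

/-- The bilinear form of `DiagGroup a`. -/
def diagB (r s : DiagGroup a) : QModZ := ∑ i, rankOneB (a i) (r i) (s i)

/-- The Weil representation of `DiagGroup a`, as a tensor product. -/
def diagRep : Mp2Z →* Matrix (DiagGroup a) (DiagGroup a) ℂ where
  toFun γ := Matrix.of fun r s => ∏ i, rankOneRep (a i) γ (r i) (s i)
  map_one' := by
    ext r s
    simp only [map_one, Matrix.one_apply, Matrix.of_apply]
    rw [Finset.prod_ite_zero]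
    simp [funext_iff]
  map_mul' γ γ' := by
    ext r s
    simp only [map_mul, Matrix.mul_apply, Matrix.of_apply]
    rw [Finset.prod_univ_sum]
    simp [Finset.prod_mul_distrib]

lemma diagRep_apply (γ : Mp2Z) (r s : DiagGroup a) :
    diagRep a γ r s = ∏ i, rankOneRep (a i) γ (r i) (s i) := rfl

lemma diagRep_T : diagRep a mpT = Matrix.diagonal fun r => e (diagQ a r) := by
  ext r s
  simp only [diagRep_apply, rankOneRep_T, Matrix.diagonal_apply, diagQ, e_sum]
  rw [Finset.prod_ite_zero]
  simp [funext_iff]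

lemma diagRep_S (r s : DiagGroup a) : diagRep a mpS r s =
    Complex.exp (2 * Real.pi * Complex.I * (-((∑ i, (a i).sign : ℤ) : ℂ) / 8)) /
      (Real.sqrt (Fintype.card (DiagGroup a)) : ℂ) * e (-diagB a r s) := by
  simp only [diagRep_apply, rankOneRep_S, diagB]
  rw [Finset.prod_mul_distrib, Finset.prod_div_distrib, ← Finset.sum_neg_distrib, e_sum,
    ← Complex.exp_sum, Fintype.card_pi]
  congr 2
  · congr 1
    rw [← Finset.mul_sum]
    congr 1
    push_cast
    rw [← Finset.sum_div, Finset.sum_neg_distrib]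
  · simp only [ZMod.card]
    rw [← Complex.ofReal_prod, Nat.cast_prod, Real.sqrt_prod _ fun i _ => Nat.cast_nonneg _]

variable {a} {p : ℕ} [hp : Fact p.Prime]

lemma diagRep_conj (hpa : ∀ i, ¬ (p : ℤ) ∣ 2 * a i) {γ γ' : Mp2Z}
    (hγ : (γ' : MpGL) * alphaP p = alphaP p * γ) (r s : DiagGroup a) :
    diagRep a γ' r s = diagRep a γ (p • r) (p • s) := by
  simp only [diagRep_apply]
  refine Finset.prod_congr rfl fun i _ => ?_
  rw [Pi.smul_apply, Pi.smul_apply, nsmul_eq_mul, nsmul_eq_mul]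
  exact rankOneRep_conj (hpa i) hγ _ _

lemma gaussP_mul_diagRep (hpa : ∀ i, ¬ (p : ℤ) ∣ 2 * a i) {γ γ' : Mp2Z} {β : MpGL} {φ₀ : ℝ}
    (hβφ : ∀ τ, β.φ τ = φ₀) {b : ℤ} {b₁ : Fin n → ℤ} (hb : ∀ i, b = 4 * a i * b₁ i)
    (hβ : (β.mat : Matrix (Fin 2) (Fin 2) ℝ) = !![(p : ℝ), b; 0, p])
    (hγ : alphaP p * γ = γ' * β) (hc : (γ : MpGL).mat 1 0 = p)
    (hd : (γ : MpGL).mat 1 1 = b) (r s : DiagGroup a) :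
    (∏ i, (φ₀ * gaussP p (-b₁ i))) * diagRep a γ (p • r) s = p ^ n * diagRep a γ' r s := by
  have h : ∀ i, φ₀ * gaussP p (-b₁ i) * rankOneRep (a i) γ ((p • r) i) (s i) =
      p * rankOneRep (a i) γ' (r i) (s i) := fun i => by
    rw [Pi.smul_apply, nsmul_eq_mul]
    exact gaussP_mul_rankOneRep (hpa i) hβφ (hb i) hβ hγ hc hd (r i) (s i)
  rw [diagRep_apply, diagRep_apply, ← Finset.prod_mul_distrib, Finset.prod_congr rfl fun i _ => h i,
    Finset.prod_mul_distrib]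
  simp

end diagonal

end

end WeilHecke

/-! ### Isotropic subquotients -/

namespace WeilHecke

noncomputable section

namespace DiscriminantForm

variable {A : Type*} [AddCommGroup A] (D : DiscriminantForm A)

lemma bilin_add_left (x x' y : A) : D.bilin (x + x') y = D.bilin x y + D.bilin x' y :=
  QuadraticMap.polar_add_left D.q x x' y

lemma bilin_comm (x y : A) : D.bilin x y = D.bilin y x := QuadraticMap.polar_comm D.q x y

lemma bilin_add_right (x y y' : A) : D.bilin x (y + y') = D.bilin x y + D.bilin x y' :=
  QuadraticMap.polar_add_right D.q x y y'

lemma bilin_zero_left (y : A) : D.bilin 0 y = 0 := QuadraticMap.polar_zero_left D.q y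

lemma q_add (x y : A) : D.q (x + y) = D.q x + D.q y + D.bilin x y := by
  rw [bilin, QuadraticMap.polar]; abel

end DiscriminantForm

/-- The discriminant form `D` on `A` is the subquotient `H^⊥/H` of the group `B` with quadratic form
`qB` and bilinear form `bB`: the images in `B` of `M` and of the kernel of `M → A` are `H^⊥` and
the isotropic subgroup `H`. -/
structure IsSubquotient {A B M : Type*} [AddCommGroup A] [AddCommGroup B] [AddCommGroup M]
    (D : DiscriminantForm A) (qB : B → QModZ) (bB : B → B → QModZ) (r : M →+ B) (ψ : M →+ A) :
    Prop where
  add_left : ∀ x x' y, bB (x + x') y = bB x y + bB x' y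
  comm : ∀ x y, bB x y = bB y x
  nondeg : ∀ x, (∀ y, bB x y = 0) → x = 0
  surj : Function.Surjective ψ
  ker_le : ∀ y, r y = 0 → ψ y = 0
  map_q : ∀ y, qB (r y) = D.q (ψ y)
  map_b : ∀ y y', bB (r y) (r y') = D.bilin (ψ y) (ψ y')
  perp : ∀ b, (∀ y, ψ y = 0 → bB (r y) b = 0) → ∃ y, r y = b

section subquotient

variable {A B M : Type*} [AddCommGroup A] [AddCommGroup B] [AddCommGroup M]

open scoped Classical in
/-- The embedding `ℂ[H^⊥/H] → ℂ[B]`, `𝔢_{λ+H} ↦ ∑_{b ∈ λ+H} 𝔢_b`. -/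
def inflate (r : M →+ B) (ψ : M →+ A) : (A → ℂ) →ₗ[ℂ] (B → ℂ) where
  toFun f := fun b => if h : ∃ y, r y = b then f (ψ h.choose) else 0
  map_add' f g := by funext b; by_cases h : ∃ y, r y = b <;> simp [h]
  map_smul' c f := by funext b; by_cases h : ∃ y, r y = b <;> simp [h]

variable {D : DiscriminantForm A} {qB : B → QModZ} {bB : B → B → QModZ} {r : M →+ B} {ψ : M →+ A}

lemma inflate_of_not (f : A → ℂ) {b : B} (h : ¬ ∃ y, r y = b) : inflate r ψ f b = 0 := by
  simp [inflate, h]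

namespace IsSubquotient

variable (S : IsSubquotient D qB bB r ψ)

include S

lemma zero_left (y : B) : bB 0 y = 0 := by
  have := S.add_left 0 0 y
  rw [add_zero] at this
  exact left_eq_add.mp this

lemma congr_ψ {y y' : M} (h : r y = r y') : ψ y = ψ y' := by
  rw [← sub_eq_zero, ← map_sub]
  exact S.ker_le _ (by rw [map_sub, h, sub_self])

lemma inflate_apply (f : A → ℂ) (y : M) : inflate r ψ f (r y) = f (ψ y) := by
  have h : ∃ y', r y' = r y := ⟨y, rfl⟩
  simp only [inflate, LinearMap.coe_mk, AddHom.coe_mk, dif_pos h]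
  rw [S.congr_ψ h.choose_spec]

lemma inflate_injective : Function.Injective (inflate r ψ) := by
  intro f g h
  funext x
  obtain ⟨y, rfl⟩ := S.surj x
  rw [← S.inflate_apply f, ← S.inflate_apply g, h]

/-- The character `b ↦ e(-(b, b'))` on a subgroup. -/
def addChar (K : AddSubgroup B) (b' : B) : AddChar K ℂ where
  toFun k := e (-bB k b')
  map_zero_eq_one' := by rw [ZeroMemClass.coe_zero, S.zero_left, neg_zero, e_zero]
  map_add_eq_mul' x y := by rw [AddSubgroup.coe_add, S.add_left, neg_add, e_add]

open scoped Classical in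
lemma sum_subgroup [Fintype B] (K : AddSubgroup B) (b' : B) :
    ∑ k : K, e (-bB k b') = if ∀ k ∈ K, bB k b' = 0 then (Fintype.card K : ℂ) else 0 := by
  have h := AddChar.sum_eq_ite (S.addChar K b')
  have h0 : S.addChar K b' = 0 ↔ ∀ k ∈ K, bB k b' = 0 := by
    rw [DFunLike.ext_iff]
    refine ⟨fun H k hk => ?_, fun H k => ?_⟩
    · have := H ⟨k, hk⟩
      change e (-bB k b') = 1 at this
      rwa [e_eq_one_iff, neg_eq_zero] at this
    · change e (-bB k b') = 1
      rw [H k k.2, neg_zero, e_zero]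
  simp only [h0] at h
  exact h

/-- A sum over the cosets of the isotropic subgroup `H` in `H^⊥`. -/
lemma sum_inflate [Fintype A] [Fintype B] (f : A → ℂ) (g : B → ℂ) {s : A → M}
    (hs : ∀ x, ψ (s x) = x) (K : AddSubgroup B) [Fintype K] (hK : K = ψ.ker.map r) :
    ∑ b, g b * inflate r ψ f b = ∑ x : A, ∑ k : K, g (r (s x) + k) * f x := by
  rw [← Fintype.sum_prod_type']
  symm
  refine Finset.sum_of_injOn (fun xk : A × K => r (s xk.1) + xk.2) ?_ (by simp) ?_ ?_
  · rintro ⟨x, k, hk⟩ - ⟨x', k', hk'⟩ - h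
    rw [hK] at hk hk'
    obtain ⟨y, hy, rfl⟩ := hk
    obtain ⟨y', hy', rfl⟩ := hk'
    have hy0 : ψ y = 0 := hy
    have hy0' : ψ y' = 0 := hy'
    simp only [← map_add] at h
    have h2 := S.congr_ψ h
    rw [map_add, map_add, hy0, hy0', add_zero, add_zero, hs, hs] at h2
    subst h2
    rw [map_add, map_add, add_right_inj] at h
    simp [h]
  · intro b _ hb
    rw [inflate_of_not, mul_zero]
    rintro ⟨y, rfl⟩
    apply hb
    refine ⟨⟨ψ y, ⟨r (y - s (ψ y)), ?_⟩⟩, by simp, ?_⟩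
    · rw [hK]
      exact ⟨_, by simp [AddMonoidHom.mem_ker, hs], rfl⟩
    · simp only; rw [← map_add, add_sub_cancel]
  · rintro ⟨x, k, hk⟩ -
    rw [hK] at hk
    obtain ⟨y, hy, rfl⟩ := hk
    have hy0 : ψ y = 0 := hy
    simp only
    rw [← map_add, S.inflate_apply, map_add ψ, hs, hy0, add_zero]

open scoped Classical in
/-- The Fourier transform on `B` restricts to `|H|` times the Fourier transform on `H^⊥/H`. -/
lemma sum_e_mul_inflate [Fintype A] [Fintype B] (f : A → ℂ) (b' : B) :
    ∑ b, e (-bB b b') * inflate r ψ f b =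
      Nat.card (ψ.ker.map r) * inflate r ψ (fun x' => ∑ x, e (-D.bilin x x') * f x) b' := by
  obtain ⟨s, hs⟩ := S.surj.hasRightInverse
  rw [S.sum_inflate f (fun b => e (-bB b b')) hs _ rfl]
  have h1 : ∀ x, ∑ k : ψ.ker.map r, e (-bB (r (s x) + k) b') * f x =
      e (-bB (r (s x)) b') * f x * ∑ k : ψ.ker.map r, e (-bB k b') := fun x => by
    rw [Finset.mul_sum]
    refine Finset.sum_congr rfl fun k _ => ?_
    rw [S.add_left, neg_add, e_add]; ring
  simp only [h1]
  rw [← Finset.sum_mul, S.sum_subgroup]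
  split_ifs with h
  · obtain ⟨y, rfl⟩ := S.perp b' fun y hy => h _ ⟨y, hy, rfl⟩
    rw [S.inflate_apply, mul_comm, Nat.card_eq_fintype_card]
    simp only [S.map_b, hs _]
  · rw [mul_zero, inflate_of_not, mul_zero]
    rintro ⟨y, rfl⟩
    apply h
    rintro k ⟨y', hy', rfl⟩
    rw [S.map_b, show ψ y' = 0 from hy', D.bilin_zero_left]

open scoped Classical in
/-- `|B| = |H|² |H^⊥/H|`. -/
lemma card_eq [Fintype A] [Fintype B] :
    Fintype.card B = Nat.card (ψ.ker.map r) ^ 2 * Fintype.card A := by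
  obtain ⟨s, hs⟩ := S.surj.hasRightInverse
  set K := ψ.ker.map r with hK
  -- count the pairs in `K × B` weighted by `e(-(k, b))` in two ways
  have h1 : ∑ b : B, ∑ k : K, e (-bB k b) = Fintype.card B := by
    rw [Finset.sum_comm]
    have h2 : ∀ k : K, ∑ b : B, e (-bB k b) = if k = 0 then (Fintype.card B : ℂ) else 0 := by
      intro k
      have h3 := S.sum_subgroup ⊤ k
      have h4 : ∑ b : B, e (-bB k b) = ∑ b : (⊤ : AddSubgroup B), e (-bB b k) := by
        rw [← Equiv.sum_comp AddSubgroup.topEquiv.toEquiv]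
        exact Finset.sum_congr rfl fun b _ => by rw [S.comm]; rfl
      rw [h4, h3]
      have h5 : (∀ b ∈ (⊤ : AddSubgroup B), bB b k = 0) ↔ k = 0 := by
        refine ⟨fun H => Subtype.ext (S.nondeg _ fun y => by rw [S.comm]; exact H y trivial), ?_⟩
        rintro rfl b -
        rw [S.comm]; exact S.zero_left b
      simp only [h5]
      congr 2
      exact Fintype.card_congr AddSubgroup.topEquiv.toEquiv
    simp [h2]
  have h2 : ∑ b : B, ∑ k : K, e (-bB k b) = Fintype.card K * (Fintype.card A * Fintype.card K) := by
    have h3 : ∀ b : B, ∑ k : K, e (-bB k b) = Fintype.card K * inflate r ψ (fun _ => 1) b := by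
      intro b
      rw [S.sum_subgroup]
      split_ifs with h
      · obtain ⟨y, rfl⟩ := S.perp b fun y hy => h _ ⟨y, hy, rfl⟩
        rw [S.inflate_apply, mul_one]
      · rw [inflate_of_not, mul_zero]
        rintro ⟨y, rfl⟩
        apply h
        rintro k ⟨y', hy', rfl⟩
        rw [S.map_b, show ψ y' = 0 from hy', D.bilin_zero_left]
    simp only [h3]
    rw [← Finset.mul_sum]
    have h4 := S.sum_inflate (fun _ => 1) (fun _ => 1) hs K hK
    simp only [one_mul, mul_one] at h4
    rw [h4]
    simp
  rw [h1] at h2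
  rw [Nat.card_eq_fintype_card]
  have h3 : Fintype.card B = Fintype.card K * (Fintype.card A * Fintype.card K) := by exact_mod_cast h2
  rw [h3]; ring

end IsSubquotient

end subquotient

end

end WeilHecke

/-! ### Orthogonal sublattices of index prime to `p` -/

namespace WeilHecke

noncomputable section

open Matrix

section gram

variable {n : ℕ} (G : Matrix (Fin n) (Fin n) ℤ)

lemma cast_toBilin' (R : Type*) [CommRing R] (x y : Fin n → ℤ) :
    ((Matrix.toBilin' G x y : ℤ) : R) =
      Matrix.toBilin' (G.map (Int.cast : ℤ → R)) (fun i => (x i : R)) (fun i => (y i : R)) := by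
  rw [Matrix.toBilin'_apply', Matrix.toBilin'_apply']
  simp [dotProduct, mulVec]

variable {G}

lemma toBilin'_comm {R : Type*} [CommRing R] {H : Matrix (Fin n) (Fin n) R} (hH : H.IsSymm)
    (x y : Fin n → R) : Matrix.toBilin' H x y = Matrix.toBilin' H y x := by
  rw [Matrix.toBilin'_apply', Matrix.toBilin'_apply', dotProduct_mulVec, ← mulVec_transpose, hH,
    dotProduct_comm]

lemma even_toBilin'_self (hsymm : G.IsSymm) (heven : ∀ i, Even (G i i)) (x : Fin n → ℤ) :
    Even (Matrix.toBilin' G x x) := by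
  have hx : x = ∑ i, x i • (Pi.single i 1 : Fin n → ℤ) := by
    funext j; simp [Finset.sum_apply, Pi.single_apply]
  rw [hx]
  refine Finset.sum_induction _ (fun y => Even (Matrix.toBilin' G y y)) ?_ (by simp) ?_
  · intro y z hy hz
    simp only [map_add, LinearMap.add_apply]
    rw [toBilin'_comm hsymm z y]
    obtain ⟨a, ha⟩ := hy
    obtain ⟨b, hb⟩ := hz
    exact ⟨a + b + Matrix.toBilin' G y z, by rw [ha, hb]; ring⟩
  · intro i _
    simp only [map_smul, LinearMap.smul_apply, Matrix.toBilin'_single, smul_eq_mul]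
    exact ((heven i).mul_left _).mul_left _

/-- A symmetric matrix of odd size with even diagonal is congruent modulo `2` to a skew-symmetric
one, so its determinant is even. -/
lemma even_det_of_odd (hsymm : G.IsSymm) (heven : ∀ i, Even (G i i)) (hn : Odd n) :
    Even G.det := by
  let K : Matrix (Fin n) (Fin n) ℤ := Matrix.of fun i j =>
    if i < j then G i j else if j < i then -G i j else 0
  have hK : Kᵀ = -K := by
    ext i j
    simp only [K, transpose_apply, of_apply, Matrix.neg_apply]
    have := hsymm.apply i j
    rcases lt_trichotomy i j with h | rfl | h
    · simp [h, h.not_gt, this]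
    · simp
    · simp [h, h.not_gt, this]
  have hdet : K.det = 0 := by
    have h1 := congrArg Matrix.det hK
    rw [det_transpose, det_neg, Fintype.card_fin, hn.neg_one_pow] at h1
    linarith
  have hmod : G.map (Int.cast : ℤ → ZMod 2) = K.map (Int.cast : ℤ → ZMod 2) := by
    ext i j
    simp only [K, map_apply, of_apply]
    rcases lt_trichotomy i j with h | rfl | h
    · simp [h]
    · simpa using (ZMod.intCast_eq_zero_iff_even).mpr (heven i)
    · simp [h, h.not_gt]
  have h2 : ((G.det : ℤ) : ZMod 2) = 0 := by
    have := (Int.castRingHom (ZMod 2)).map_det G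
    have h3 := (Int.castRingHom (ZMod 2)).map_det K
    rw [hdet, map_zero] at h3
    change ((G.det : ℤ) : ZMod 2) = (G.map (Int.cast : ℤ → ZMod 2)).det at this
    rw [this, hmod]
    exact h3.symm
  exact (ZMod.intCast_eq_zero_iff_even).mp h2

lemma isSymm_map {R : Type*} [CommRing R] (hsymm : G.IsSymm) :
    (G.map (Int.cast : ℤ → R)).IsSymm := by
  rw [Matrix.IsSymm, ← transpose_map, hsymm]

variable {p : ℕ} [hp : Fact p.Prime]

/-- An integral lift of an orthogonal basis over `𝔽_p`. -/
lemma exists_lift_orthogonal (hp2 : p ≠ 2) (hsymm : G.IsSymm) (hdet : ¬ (p : ℤ) ∣ G.det) :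
    ∃ u : Fin n → Fin n → ℤ, (∀ i j, i ≠ j → ((Matrix.toBilin' G (u i) (u j) : ℤ) : ZMod p) = 0) ∧
      ∀ i, ((Matrix.toBilin' G (u i) (u i) : ℤ) : ZMod p) ≠ 0 := by
  have h2 : (2 : ZMod p) ≠ 0 := by
    intro h
    have h' : ((2 : ℕ) : ZMod p) = 0 := by exact_mod_cast h
    rw [ZMod.natCast_eq_zero_iff] at h'
    exact hp2 ((Nat.prime_dvd_prime_iff_eq hp.out Nat.prime_two).mp h')
  have : Invertible (2 : ZMod p) := invertibleOfNonzero h2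
  set B := Matrix.toBilin' (G.map (Int.cast : ℤ → ZMod p)) with hB
  have hsym : LinearMap.IsSymm B := ⟨fun x y => toBilin'_comm (isSymm_map hsymm) x y⟩
  obtain ⟨v, hv⟩ := LinearMap.BilinForm.exists_orthogonal_basis hsym
  have hnd : B.Nondegenerate := by
    apply LinearMap.BilinForm.nondegenerate_toBilin'_of_det_ne_zero'
    have h3 := (Int.castRingHom (ZMod p)).map_det G
    change ((G.det : ℤ) : ZMod p) = (G.map (Int.cast : ℤ → ZMod p)).det at h3
    rw [← h3]
    intro h
    exact hdet ((ZMod.intCast_zmod_eq_zero_iff_dvd _ _).mp h)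
  have hself := hv.not_isOrtho_basis_self_of_separatingLeft hnd.1
  have hfin : Module.finrank (ZMod p) (Fin n → ZMod p) = n := by simp
  let w : Fin n → Fin n → ZMod p := fun i => v (Fin.cast hfin.symm i)
  have hw : ∀ i j, i ≠ j → B (w i) (w j) = 0 := fun i j hij => hv fun h => hij (by simpa using h)
  have hw' : ∀ i, B (w i) (w i) ≠ 0 := fun i => hself _
  have hcast : ∀ i, (fun j => (((w i j).val : ℤ) : ZMod p)) = w i := fun i => by
    funext j; simp
  refine ⟨fun i j => ((w i j).val : ℤ), fun i j hij => ?_, fun i => ?_⟩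
  · rw [cast_toBilin', hcast, hcast]; exact hw i j hij
  · rw [cast_toBilin', hcast]; exact hw' i

/-- Gram–Schmidt without denominators: orthogonality modulo `p` is lifted to orthogonality over
`ℤ`. -/
lemma exists_orthogonal (hp2 : p ≠ 2) (hsymm : G.IsSymm) (hdet : ¬ (p : ℤ) ∣ G.det) :
    ∃ v : Fin n → Fin n → ℤ, (∀ i j, i ≠ j → Matrix.toBilin' G (v i) (v j) = 0) ∧
      ∀ i, ¬ (p : ℤ) ∣ Matrix.toBilin' G (v i) (v i) := by
  set B := Matrix.toBilin' G with hB
  have hcomm : ∀ x y, B x y = B y x := toBilin'_comm hsymm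
  have step : ∀ k : ℕ, k ≤ n → ∃ v : Fin n → Fin n → ℤ,
      (∀ i j, i ≠ j → ((B (v i) (v j) : ℤ) : ZMod p) = 0) ∧
      (∀ i, ((B (v i) (v i) : ℤ) : ZMod p) ≠ 0) ∧
      ∀ i j : Fin n, i.val < k → i ≠ j → B (v i) (v j) = 0 := by
    intro k
    induction k with
    | zero =>
      intro _
      obtain ⟨u, hu, hu'⟩ := exists_lift_orthogonal hp2 hsymm hdet
      exact ⟨u, hu, hu', fun i j h => absurd h (Nat.not_lt_zero _)⟩
    | succ k ih =>
      intro hk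
      obtain ⟨v, h1, h2, h3⟩ := ih (Nat.le_of_succ_le hk)
      set κ : Fin n := ⟨k, hk⟩ with hκ
      set d := B (v κ) (v κ) with hd
      -- clear the later vectors against `v κ`, multiplying them by `d`, a unit modulo `p`
      let v' : Fin n → Fin n → ℤ := fun j =>
        if κ < j then d • v j - B (v κ) (v j) • v κ else v j
      have e1 : ∀ j, κ < j → v' j = d • v j - B (v κ) (v j) • v κ := fun j h => if_pos h
      have e2 : ∀ j, ¬ κ < j → v' j = v j := fun j h => if_neg h
      have hκj : ∀ j, κ < j → B (v κ) (v' j) = 0 := fun j h => by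
        rw [e1 j h, map_sub, map_smul, map_smul, smul_eq_mul, smul_eq_mul, ← hd]; ring
      have hmod : ∀ i j, ∃ c c' : ZMod p, c ≠ 0 ∧ c' ≠ 0 ∧ ((B (v' i) (v' j) : ℤ) : ZMod p) =
          c * c' * ((B (v i) (v j) : ℤ) : ZMod p) := by
        have hstep : ∀ j, ∃ c : ZMod p, c ≠ 0 ∧ ∀ x, ((B x (v' j) : ℤ) : ZMod p) =
            c * ((B x (v j) : ℤ) : ZMod p) := fun j => by
          by_cases h : κ < j
          · refine ⟨d, h2 κ, fun x => ?_⟩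
            rw [e1 j h, map_sub, map_smul, map_smul, smul_eq_mul, smul_eq_mul]
            push_cast
            rw [h1 κ j h.ne]; ring
          · exact ⟨1, one_ne_zero, fun x => by rw [e2 j h, one_mul]⟩
        intro i j
        obtain ⟨c, hc, hc'⟩ := hstep j
        obtain ⟨c', hc1, hc1'⟩ := hstep i
        refine ⟨c, c', hc, hc1, ?_⟩
        rw [hc', hcomm, hc1', hcomm (v j), mul_assoc]
      refine ⟨v', fun i j hij => ?_, fun i => ?_, fun i j hi hij => ?_⟩
      · obtain ⟨c, c', -, -, h⟩ := hmod i j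
        rw [h, h1 i j hij, mul_zero]
      · obtain ⟨c, c', hc, hc', h⟩ := hmod i i
        rw [h]
        exact mul_ne_zero (mul_ne_zero hc hc') (h2 i)
      · have hi' : ¬ κ < i := by
          rw [Fin.lt_def]; simp only [hκ]; omega
        rw [e2 i hi']
        rcases Nat.lt_succ_iff_lt_or_eq.mp hi with hlt | heq
        · by_cases hj : κ < j
          · have hiκ : i ≠ κ := fun h => by rw [h, hκ] at hlt; exact lt_irrefl _ hlt
            rw [e1 j hj, map_sub, map_smul, map_smul, h3 i j hlt hij, h3 i κ hlt hiκ]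
            simp
          · rw [e2 j hj, h3 i j hlt hij]
        · have hiκ : i = κ := Fin.ext heq
          by_cases hj : κ < j
          · rw [hiκ]; exact hκj j hj
          · rw [e2 j hj, hcomm]
            have hjk : j.val < k := by
              have h5 : j.val ≠ k := fun h => hij (Fin.ext (heq.trans h.symm))
              rw [Fin.lt_def] at hj
              simp only [hκ] at hj
              omega
            exact h3 j i hjk hij.symm
  obtain ⟨v, -, h2, h3⟩ := step n le_rfl
  exact ⟨v, fun i j hij => h3 i j i.isLt hij, fun i h =>
    h2 i ((ZMod.intCast_zmod_eq_zero_iff_dvd _ _).mpr h)⟩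

end gram

section lattice

variable {A : Type*} [AddCommGroup A] [Finite A] {D : DiscriminantForm A} {n : ℕ}
  {G : Matrix (Fin n) (Fin n) ℤ}

/-- The level annihilates `L'/L`, so `N G⁻¹` is integral and `det G` divides a power of `N`. -/
lemma not_dvd_det (hG : D.IsDiscriminantFormOf G) {p : ℕ} [hp : Fact p.Prime]
    (hpN : p.Coprime D.level) : ¬ (p : ℤ) ∣ G.det := by
  obtain ⟨-, -, hdet, ψ, -, hker, -⟩ := hG
  set GQ := G.map (Int.cast : ℤ → ℚ) with hGQ
  have hdetQ : GQ.det = (G.det : ℚ) := ((Int.castRingHom ℚ).map_det G).symm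
  have hunit : IsUnit GQ.det := by
    rw [hdetQ]; exact isUnit_iff_ne_zero.mpr (by exact_mod_cast hdet)
  -- the columns of `G⁻¹` form a basis of the dual lattice
  have hmem : ∀ j, GQ⁻¹.col j ∈ dualLattice G := fun j x => by
    refine ⟨x j, ?_⟩
    rw [← hGQ, ← Matrix.mulVec_single_one, mulVec_mulVec, mul_nonsing_inv _ hunit, one_mulVec]
    simp
  have hint : ∀ j, ∃ x : Fin n → ℤ, ∀ i, (D.level : ℚ) * GQ⁻¹ i j = x i := fun j => by
    have h0 : ψ (D.level • ⟨_, hmem j⟩) = 0 := by rw [map_nsmul, D.level_smul]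
    obtain ⟨x, hx⟩ := (hker _).mp h0
    refine ⟨x, fun i => ?_⟩
    have := congrFun hx i
    simpa using this
  choose K hK using hint
  have hmul : G * (Matrix.of fun i j => K j i) = (D.level : ℤ) • (1 : Matrix (Fin n) (Fin n) ℤ) := by
    have h1 : (Matrix.of fun i j => K j i).map (Int.cast : ℤ → ℚ) = (D.level : ℚ) • GQ⁻¹ := by
      ext i j; simp [hK j i]
    have h2 : (G * (Matrix.of fun i j => K j i)).map (Int.cast : ℤ → ℚ) =
        ((D.level : ℤ) • (1 : Matrix (Fin n) (Fin n) ℤ)).map (Int.cast : ℤ → ℚ) := by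
      rw [Matrix.map_mul_intCast, h1, ← hGQ, Matrix.mul_smul, mul_nonsing_inv _ hunit]
      ext i j
      simp only [map_apply, Matrix.smul_apply, Matrix.one_apply]
      by_cases h : i = j <;> simp [h]
    exact Matrix.map_injective Int.cast_injective h2
  intro hdvd
  have h1 := congrArg Matrix.det hmul
  rw [det_mul, det_smul, det_one, mul_one, Fintype.card_fin] at h1
  have h2 : (p : ℤ) ∣ (D.level : ℤ) ^ n := h1 ▸ hdvd.mul_right _
  have h3 := Int.Prime.dvd_pow' hp.out h2
  rw [Int.natCast_dvd_natCast] at h3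
  exact (Nat.Prime.coprime_iff_not_dvd hp.out).mp hpN h3

end lattice

end

end WeilHecke

/-! ### A discriminant form as a subquotient of a diagonal one -/

namespace WeilHecke

noncomputable section

open Matrix

section rankOne

variable {a : ℤ} [NeZero a]

lemma exists_eq_val_add_two_mul (s : ℤ) :
    ∃ t : ℤ, s = (s : ZMod (2 * a.natAbs)).val + 2 * a * t := by
  obtain ⟨t, ht⟩ := exists_eq_val_add (m := a.natAbs) s
  rcases pos_or_neg_of_neZero (a := a) with ha | ha
  · exact ⟨t, by rwa [natAbs_cast_of_pos ha] at ht⟩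
  · refine ⟨-t, ?_⟩
    rw [natAbs_cast_of_neg ha] at ht
    simp only [Int.cast_id] at ht
    linarith

lemma rankOneQ_intCast (s : ℤ) :
    rankOneQ a (s : ZMod (2 * a.natAbs)) = ((s ^ 2 / (4 * a) : ℚ) : QModZ) := by
  obtain ⟨t, ht⟩ := exists_eq_val_add_two_mul (a := a) s
  have ha : (a : ℚ) ≠ 0 := Int.cast_ne_zero.mpr (NeZero.ne a)
  rw [rankOneQ, eq_comm, qmodz_coe_eq_coe_iff]
  refine ⟨t * (s : ZMod (2 * a.natAbs)).val + a * t ^ 2, ?_⟩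
  have : (s : ℚ) = (s : ZMod (2 * a.natAbs)).val + 2 * a * t := by exact_mod_cast ht
  rw [this]
  push_cast
  field_simp
  ring

lemma rankOneB_intCast (s t : ℤ) :
    rankOneB a (s : ZMod (2 * a.natAbs)) (t : ZMod (2 * a.natAbs)) =
      ((s * t / (2 * a) : ℚ) : QModZ) := by
  obtain ⟨k, hk⟩ := exists_eq_val_add_two_mul (a := a) s
  obtain ⟨l, hl⟩ := exists_eq_val_add_two_mul (a := a) t
  have ha : (a : ℚ) ≠ 0 := Int.cast_ne_zero.mpr (NeZero.ne a)
  rw [rankOneB, eq_comm, qmodz_coe_eq_coe_iff]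
  refine ⟨(s : ZMod (2 * a.natAbs)).val * l + k * (t : ZMod (2 * a.natAbs)).val + 2 * a * k * l, ?_⟩
  have h1 : (s : ℚ) = (s : ZMod (2 * a.natAbs)).val + 2 * a * k := by exact_mod_cast hk
  have h2 : (t : ℚ) = (t : ZMod (2 * a.natAbs)).val + 2 * a * l := by exact_mod_cast hl
  rw [h1, h2]
  push_cast
  field_simp
  ring

end rankOne

section diagonal

variable {n : ℕ} {a : Fin n → ℤ} [∀ i, NeZero (a i)]

/-- The class in `DiagGroup a` of a vector of integers. -/
def diagMk (a : Fin n → ℤ) (m : Fin n → ℤ) : DiagGroup a := fun i => (m i : ZMod (2 * (a i).natAbs))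

lemma exists_diagMk (b : DiagGroup a) : ∃ m, diagMk a m = b :=
  ⟨fun i => (b i).val, by funext i; simp [diagMk]⟩

lemma sum_coe_qmodz {ι : Type*} (s : Finset ι) (f : ι → ℚ) :
    ∑ i ∈ s, (f i : QModZ) = ((∑ i ∈ s, f i : ℚ) : QModZ) :=
  (map_sum (QuotientAddGroup.mk' (AddSubgroup.zmultiples (1 : ℚ))) f s).symm

lemma diagQ_diagMk (m : Fin n → ℤ) :
    diagQ a (diagMk a m) = ((∑ i, (m i : ℚ) ^ 2 / (4 * a i) : ℚ) : QModZ) := by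
  rw [diagQ, ← sum_coe_qmodz]
  exact Finset.sum_congr rfl fun i _ => rankOneQ_intCast _

lemma diagB_diagMk (m m' : Fin n → ℤ) : diagB a (diagMk a m) (diagMk a m') =
    ((∑ i, (m i : ℚ) * m' i / (2 * a i) : ℚ) : QModZ) := by
  rw [diagB, ← sum_coe_qmodz]
  exact Finset.sum_congr rfl fun i _ => rankOneB_intCast _ _

omit [∀ i, NeZero (a i)] in
lemma diagMk_add (m m' : Fin n → ℤ) : diagMk a (m + m') = diagMk a m + diagMk a m' := by
  funext i; simp [diagMk]

lemma diagB_add_left (x x' y : DiagGroup a) : diagB a (x + x') y = diagB a x y + diagB a x' y := by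
  obtain ⟨m, rfl⟩ := exists_diagMk x
  obtain ⟨m', rfl⟩ := exists_diagMk x'
  obtain ⟨l, rfl⟩ := exists_diagMk y
  rw [← diagMk_add, diagB_diagMk, diagB_diagMk, diagB_diagMk, ← QuotientAddGroup.mk_add,
    ← Finset.sum_add_distrib]
  congr 2
  funext i
  simp only [Pi.add_apply, Int.cast_add]
  ring

omit [∀ i, NeZero (a i)] in
lemma diagB_comm (x y : DiagGroup a) : diagB a x y = diagB a y x := by
  simp only [diagB, rankOneB, mul_comm]

lemma diagB_nondeg (x : DiagGroup a) (h : ∀ y, diagB a x y = 0) : x = 0 := by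
  obtain ⟨m, rfl⟩ := exists_diagMk x
  funext i
  have h1 := h (diagMk a (Pi.single i 1))
  rw [diagB_diagMk, qmodz_coe_eq_zero_iff] at h1
  obtain ⟨t, ht⟩ := h1
  have ha : (a i : ℚ) ≠ 0 := Int.cast_ne_zero.mpr (NeZero.ne (a i))
  rw [Finset.sum_eq_single i (fun j _ hj => by simp [Pi.single_eq_of_ne hj]) (by simp)] at ht
  simp only [Pi.single_eq_same, Int.cast_one, mul_one] at ht
  rw [div_eq_iff (mul_ne_zero two_ne_zero ha)] at ht
  have h2 : m i = t * (2 * a i) := by exact_mod_cast ht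
  change ((m i : ℤ) : ZMod (2 * (a i).natAbs)) = 0
  rw [ZMod.intCast_zmod_eq_zero_iff_dvd, h2, Nat.cast_mul, Int.natCast_natAbs]
  exact Dvd.dvd.mul_left (mul_dvd_mul_left 2 ((abs_dvd _ _).mpr dvd_rfl)) t

end diagonal

section lattice

variable {A : Type*} [AddCommGroup A] {D : DiscriminantForm A} {n : ℕ}
  {G V : Matrix (Fin n) (Fin n) ℤ} {a : Fin n → ℤ} [ha : ∀ i, NeZero (a i)]

/-- The coordinates `(vᵢ, y)` of a vector with respect to the rows `vᵢ` of `V`. -/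
def coord (G V : Matrix (Fin n) (Fin n) ℤ) (y : Fin n → ℚ) : Fin n → ℚ :=
  (V.map (Int.cast : ℤ → ℚ) * G.map (Int.cast : ℤ → ℚ)) *ᵥ y

/-- The vector `∑ᵢ (cᵢ/2aᵢ) vᵢ`. -/
def ofCoord (V : Matrix (Fin n) (Fin n) ℤ) (a : Fin n → ℤ) (c : Fin n → ℚ) : Fin n → ℚ :=
  ((V.map (Int.cast : ℤ → ℚ))ᵀ * Matrix.diagonal fun i => (2 * (a i : ℚ))⁻¹) *ᵥ c

include ha

lemma coord_mul_ofCoord (hV : V * G * Vᵀ = Matrix.diagonal fun i => 2 * a i) :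
    (V.map (Int.cast : ℤ → ℚ) * G.map (Int.cast : ℤ → ℚ)) *
      ((V.map (Int.cast : ℤ → ℚ))ᵀ * Matrix.diagonal fun i => (2 * (a i : ℚ))⁻¹) = 1 := by
  have h1 := congrArg (fun M => M.map (Int.cast : ℤ → ℚ)) hV
  simp only [Matrix.map_mul_intCast] at h1
  rw [← Matrix.mul_assoc, ← transpose_map, h1]
  ext i j
  simp only [diagonal_map, Int.cast_zero, diagonal_mul_diagonal, one_apply, diagonal_apply]
  have h2 : (a i : ℚ) ≠ 0 := Int.cast_ne_zero.mpr (NeZero.ne (a i))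
  split_ifs
  · push_cast; field_simp
  · rfl

lemma coord_ofCoord (hV : V * G * Vᵀ = Matrix.diagonal fun i => 2 * a i) (c : Fin n → ℚ) :
    coord G V (ofCoord V a c) = c := by
  rw [coord, ofCoord, mulVec_mulVec, coord_mul_ofCoord hV, one_mulVec]

lemma ofCoord_coord (hV : V * G * Vᵀ = Matrix.diagonal fun i => 2 * a i) (y : Fin n → ℚ) :
    ofCoord V a (coord G V y) = y := by
  rw [coord, ofCoord, mulVec_mulVec, mul_eq_one_comm.mp (coord_mul_ofCoord hV), one_mulVec]

lemma dotProduct_eq_sum_coord (hV : V * G * Vᵀ = Matrix.diagonal fun i => 2 * a i)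
    (y y' : Fin n → ℚ) : y ⬝ᵥ (G.map (Int.cast : ℤ → ℚ)).mulVec y' =
      ∑ i, coord G V y i * coord G V y' i / (2 * a i) := by
  conv_lhs => rw [← ofCoord_coord hV y]
  rw [ofCoord, ← mulVec_mulVec, mulVec_transpose, ← dotProduct_mulVec, mulVec_mulVec]
  change _ ⬝ᵥ coord G V y' = _
  simp only [dotProduct, mulVec_diagonal]
  refine Finset.sum_congr rfl fun i _ => ?_
  rw [div_eq_mul_inv]; ring

omit ha in
lemma exists_coord_eq (y : dualLattice G) (i : Fin n) : ∃ m : ℤ, coord G V y i = m := by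
  obtain ⟨m, hm⟩ := y.2 (V i)
  refine ⟨m, ?_⟩
  rw [← hm, coord, ← mulVec_mulVec]
  rfl

omit ha in
lemma coord_add (y y' : Fin n → ℚ) : coord G V (y + y') = coord G V y + coord G V y' := by
  rw [coord, mulVec_add]; rfl

/-- The homomorphism `L' → ∏ ℤ/2aᵢ`, `y ↦ ((vᵢ, y))ᵢ`. -/
def dualCoord (G V : Matrix (Fin n) (Fin n) ℤ) (a : Fin n → ℤ) :
    dualLattice G →+ DiagGroup a :=
  AddMonoidHom.mk' (fun y => diagMk a fun i => (exists_coord_eq (V := V) y i).choose) fun y y' => by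
    rw [← diagMk_add]
    congr 1
    funext i
    rw [Pi.add_apply]
    have h := (exists_coord_eq (V := V) (y + y') i).choose_spec
    have h1 : coord G V (y + y' : dualLattice G) i = coord G V y i + coord G V y' i := by
      rw [AddSubgroup.coe_add, coord_add, Pi.add_apply]
    have h2 := (h.symm.trans h1).trans (congrArg₂ (· + ·)
      (exists_coord_eq (V := V) y i).choose_spec (exists_coord_eq (V := V) y' i).choose_spec)
    exact_mod_cast h2

omit ha in
lemma exists_dualCoord (y : dualLattice G) : ∃ m : Fin n → ℤ,
    dualCoord G V a y = diagMk a m ∧ ∀ i, coord G V y i = m i :=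
  ⟨_, rfl, fun i => (exists_coord_eq (V := V) y i).choose_spec⟩

omit ha in
lemma intCast_mem_dualLattice (x : Fin n → ℤ) : (fun i => (x i : ℚ)) ∈ dualLattice G := fun y =>
  ⟨y ⬝ᵥ G *ᵥ x, by simp [dotProduct, mulVec]⟩

/-- Let `vᵢ` be orthogonal vectors of the even lattice `L` with `(vᵢ, vᵢ) = 2aᵢ`. They span a
sublattice `L₀` of finite index, and `L'/L` is the subquotient of `L₀'/L₀ = ∏ ℤ/2aᵢ` attached to the
isotropic subgroup `L/L₀`. -/
lemma isSubquotient_dualCoord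
    (hV : V * G * Vᵀ = Matrix.diagonal fun i => 2 * a i) {ψ : dualLattice G →+ A}
    (hψ : Function.Surjective ψ)
    (hker : ∀ y, ψ y = 0 ↔ ∃ x : Fin n → ℤ, (y : Fin n → ℚ) = fun i => (x i : ℚ))
    (hq : ∀ y, D.q (ψ y) =
      (((y : Fin n → ℚ) ⬝ᵥ (G.map (Int.cast : ℤ → ℚ)).mulVec (y : Fin n → ℚ) / 2 : ℚ) : QModZ)) :
    IsSubquotient D (diagQ a) (diagB a) (dualCoord G V a) ψ where
  add_left := diagB_add_left
  comm := diagB_comm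
  nondeg := diagB_nondeg
  surj := hψ
  ker_le y hy := by
    obtain ⟨m, hm, hm'⟩ := exists_dualCoord (V := V) (a := a) y
    rw [hm] at hy
    have h1 : ∀ i, ∃ t : ℤ, m i = 2 * a i * t := fun i => by
      have := congrFun hy i
      change ((m i : ℤ) : ZMod (2 * (a i).natAbs)) = 0 at this
      rw [ZMod.intCast_zmod_eq_zero_iff_dvd, Nat.cast_mul, Int.natCast_natAbs] at this
      exact dvd_trans (mul_dvd_mul_left 2 ((dvd_abs _ _).mpr dvd_rfl)) this
    choose t ht using h1
    rw [hker]
    refine ⟨Vᵀ *ᵥ t, ?_⟩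
    rw [← ofCoord_coord hV (y : Fin n → ℚ), ofCoord, ← mulVec_mulVec]
    funext j
    simp only [mulVec, dotProduct, transpose_apply, map_apply]
    push_cast
    refine Finset.sum_congr rfl fun i _ => ?_
    change _ * (diagonal _ *ᵥ _) i = _
    rw [mulVec_diagonal, hm', ht i]
    have h2 : (a i : ℚ) ≠ 0 := Int.cast_ne_zero.mpr (NeZero.ne (a i))
    push_cast
    field_simp
  map_q y := by
    obtain ⟨m, hm, hm'⟩ := exists_dualCoord (V := V) (a := a) y
    rw [hm, diagQ_diagMk, hq, dotProduct_eq_sum_coord hV, Finset.sum_div]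
    congr 2
    funext i
    rw [hm']
    have h2 : (a i : ℚ) ≠ 0 := Int.cast_ne_zero.mpr (NeZero.ne (a i))
    field_simp
    norm_num
  map_b y y' := by
    obtain ⟨m, hm, hm1⟩ := exists_dualCoord (V := V) (a := a) y
    obtain ⟨m', hm', hm1'⟩ := exists_dualCoord (V := V) (a := a) y'
    rw [hm, hm', diagB_diagMk, DiscriminantForm.bilin, QuadraticMap.polar, ← map_add, hq, hq, hq,
      ← QuotientAddGroup.mk_sub, ← QuotientAddGroup.mk_sub]
    congr 1
    rw [AddSubgroup.coe_add]
    simp only [dotProduct_eq_sum_coord hV, coord_add, Pi.add_apply, hm1, hm1']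
    simp only [Finset.sum_div, ← Finset.sum_sub_distrib]
    refine Finset.sum_congr rfl fun i _ => ?_
    have h2 : (a i : ℚ) ≠ 0 := Int.cast_ne_zero.mpr (NeZero.ne (a i))
    field_simp
    ring
  perp b hb := by
    obtain ⟨m, rfl⟩ := exists_diagMk b
    have hmem : ofCoord V a (fun i => (m i : ℚ)) ∈ dualLattice G := fun x => by
      have h1 := hb ⟨_, intCast_mem_dualLattice x⟩ ((hker _).mpr ⟨x, rfl⟩)
      obtain ⟨l, hl, hl'⟩ := exists_dualCoord (V := V) (a := a) ⟨_, intCast_mem_dualLattice x⟩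
      rw [hl, diagB_diagMk, qmodz_coe_eq_zero_iff] at h1
      obtain ⟨t, ht⟩ := h1
      refine ⟨t, ?_⟩
      rw [dotProduct_eq_sum_coord hV, coord_ofCoord hV, ← ht]
      exact Finset.sum_congr rfl fun i _ => by rw [← hl']
    refine ⟨⟨_, hmem⟩, ?_⟩
    obtain ⟨l, hl, hl'⟩ := exists_dualCoord (V := V) (a := a) ⟨_, hmem⟩
    rw [hl]
    congr 1
    funext i
    have := hl' i
    rw [coord_ofCoord hV] at this
    exact_mod_cast this.symm

lemma toQuadraticForm'_equivalent (hV : V * G * Vᵀ = Matrix.diagonal fun i => 2 * a i) :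
    QuadraticMap.Equivalent (G.map (Int.cast : ℤ → ℚ)).toQuadraticForm'
      (QuadraticMap.weightedSumSquares ℚ fun i => (2 * a i : ℚ)⁻¹) := by
  refine ⟨⟨Matrix.toLin'OfInv (mul_eq_one_comm.mp (coord_mul_ofCoord hV))
    (coord_mul_ofCoord hV), fun y => ?_⟩⟩
  change QuadraticMap.weightedSumSquares ℚ _ (coord G V y) = Matrix.toLinearMap₂' ℚ _ y y
  rw [Matrix.toLinearMap₂'_apply', dotProduct_eq_sum_coord hV,
    QuadraticMap.weightedSumSquares_apply]
  exact Finset.sum_congr rfl fun i _ => by rw [smul_eq_mul, div_eq_mul_inv, mul_comm]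

/-- The signature of the lattice is the one of its orthogonal sublattice. -/
lemma sigPos_sub_sigNeg (hV : V * G * Vᵀ = Matrix.diagonal fun i => 2 * a i) :
    (sigPos (G.map (Int.cast : ℤ → ℚ)).toQuadraticForm' : ℤ) -
      sigNeg (G.map (Int.cast : ℤ → ℚ)).toQuadraticForm' = ∑ i, (a i).sign := by
  rw [QuadraticForm.sigPos_of_equiv_weightedSumSquares (toQuadraticForm'_equivalent hV),
    QuadraticForm.sigNeg_of_equiv_weightedSumSquares (toQuadraticForm'_equivalent hV),
    Set.ncard_eq_toFinset_card', Set.ncard_eq_toFinset_card']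
  simp only [Set.toFinset_ofPred, Finset.card_filter]
  simp only [inv_pos, inv_lt_zero]
  push_cast
  rw [← Finset.sum_sub_distrib]
  refine Finset.sum_congr rfl fun i _ => ?_
  rcases pos_or_neg_of_neZero (a := a i) with h | h
  · have h' : (0 : ℚ) < a i := by exact_mod_cast h
    rw [Int.sign_eq_one_of_pos h, if_pos (by linarith), if_neg (by linarith)]; rfl
  · have h' : (a i : ℚ) < 0 := by exact_mod_cast h
    rw [Int.sign_eq_neg_one_of_neg h, if_neg (by linarith), if_pos (by linarith)]; rfl

end lattice

section existence

variable {A : Type*} [AddCommGroup A] [Finite A] {D : DiscriminantForm A}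

lemma exists_diagonal {n : ℕ} {G : Matrix (Fin n) (Fin n) ℤ} (hsymm : G.IsSymm)
    (heven : ∀ i, Even (G i i)) {p : ℕ} [hp : Fact p.Prime] (hp2 : p ≠ 2)
    (hdet : ¬ (p : ℤ) ∣ G.det) : ∃ (V : Matrix (Fin n) (Fin n) ℤ) (a : Fin n → ℤ),
      (V * G * Vᵀ = Matrix.diagonal fun i => 2 * a i) ∧ ∀ i, ¬ (p : ℤ) ∣ 2 * a i := by
  obtain ⟨v, hv, hv'⟩ := exists_orthogonal hp2 hsymm hdet
  have h : ∀ i, ∃ a, Matrix.toBilin' G (v i) (v i) = 2 * a := fun i =>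
    (even_toBilin'_self hsymm heven (v i)).two_dvd
  choose a ha using h
  refine ⟨Matrix.of v, a, ?_, fun i => by rw [← ha]; exact hv' i⟩
  ext i j
  have h1 : (Matrix.of v * G * (Matrix.of v)ᵀ) i j = Matrix.toBilin' G (v i) (v j) := by
    rw [Matrix.toBilin'_apply', Matrix.mul_assoc]
    rfl
  rw [h1, diagonal_apply]
  split_ifs with hij
  · rw [← hij, ha]
  · exact hv i j hij

lemma neZero_of_not_dvd {p : ℕ} {a : ℤ} (h : ¬ (p : ℤ) ∣ 2 * a) : NeZero a :=
  ⟨fun h0 => h (by rw [h0, mul_zero]; exact dvd_zero _)⟩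

/-- The rank is congruent to the signature modulo `2`. -/
lemma odd_rank {n : ℕ} {G : Matrix (Fin n) (Fin n) ℤ} (hsymm : G.IsSymm)
    (heven : ∀ i, Even (G i i)) (hdet : G.det ≠ 0)
    (h : Odd ((sigPos (G.map (Int.cast : ℤ → ℚ)).toQuadraticForm' : ZMod 8) -
      (sigNeg (G.map (Int.cast : ℤ → ℚ)).toQuadraticForm' : ZMod 8))) : Odd n := by
  -- an auxiliary prime, over which the form can be diagonalised
  obtain ⟨q, hq, hqp⟩ := Nat.exists_infinite_primes (G.det.natAbs + 3)
  have : Fact q.Prime := ⟨hqp⟩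
  have hqd : ¬ (q : ℤ) ∣ G.det := fun hd => by
    have := Nat.le_of_dvd (Int.natAbs_pos.mpr hdet) (Int.natCast_dvd.mp hd)
    omega
  obtain ⟨V, a, hV, ha⟩ := exists_diagonal hsymm heven (by omega) hqd
  have : ∀ i, NeZero (a i) := fun i => neZero_of_not_dvd (ha i)
  have h1 := sigPos_sub_sigNeg hV
  have h2 : Odd (((∑ i, (a i).sign : ℤ)) : ZMod 8) := by
    rw [← h1]; push_cast; exact h
  have h3 : Odd (∑ i, (a i).sign) := by
    have h4 := h2.map (ZMod.castHom (by norm_num : 2 ∣ 8) (ZMod 2))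
    rw [map_intCast] at h4
    rw [← Int.not_even_iff_odd, ← ZMod.intCast_eq_zero_iff_even]
    obtain ⟨k, hk⟩ := h4
    intro h0
    rw [hk, show (2 : ZMod 2) = 0 from rfl] at h0
    simp at h0
  have h4 : Even (∑ i, ((a i).sign - 1)) := Finset.even_sum _ fun i _ => by
    rcases pos_or_neg_of_neZero (a := a i) with h | h
    · rw [Int.sign_eq_one_of_pos h]; decide
    · rw [Int.sign_eq_neg_one_of_neg h]; decide
  rw [Finset.sum_sub_distrib] at h4
  simp only [Finset.sum_const, Finset.card_univ, Fintype.card_fin, nsmul_eq_mul, mul_one] at h4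
  rw [Int.even_sub] at h4
  rw [← Int.odd_coe_nat, ← Int.not_even_iff_odd]
  rw [← Int.not_even_iff_odd] at h3
  tauto

/-- A discriminant form of odd signature and level prime to `p` is a subquotient of
`∏ ℤ/2aᵢ` with all `aᵢ` prime to `p`, the number of factors being odd. -/
lemma exists_isSubquotient (hodd : Odd D.sig) {p : ℕ} [hp : Fact p.Prime]
    (hpN : p.Coprime D.level) :
    p ≠ 2 ∧ ∃ (n : ℕ) (a : Fin n → ℤ) (_ : ∀ i, NeZero (a i)) (M : Type) (_ : AddCommGroup M)
      (r : M →+ DiagGroup a) (ψ : M →+ A), Odd n ∧ (∀ i, ¬ (p : ℤ) ∣ 2 * a i) ∧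
      IsSubquotient D (diagQ a) (diagB a) r ψ ∧ D.sig = ((∑ i, (a i).sign : ℤ) : ZMod 8) := by
  have hsig : D.IsSignature D.sig := by
    -- without a lattice `sig` would take the default value `0`, which is even
    have h : ∃ s, D.IsSignature s := by
      by_contra h
      rw [DiscriminantForm.sig, dif_neg h] at hodd
      exact absurd hodd (show ¬ Odd (0 : ZMod 8) by unfold Odd; decide)
    rw [DiscriminantForm.sig, dif_pos h]
    exact h.choose_spec
  obtain ⟨n, G, hG, hs⟩ := hsig
  have hdvd := not_dvd_det hG hpN
  obtain ⟨hsymm, heven, hdet, ψ, hψ, hker, hq⟩ := hG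
  have hn : Odd n := odd_rank hsymm heven hdet (hs ▸ hodd)
  have hp2 : p ≠ 2 := by
    rintro rfl
    exact hdvd (even_det_of_odd hsymm heven hn).two_dvd
  obtain ⟨V, a, hV, ha⟩ := exists_diagonal hsymm heven hp2 hdvd
  have : ∀ i, NeZero (a i) := fun i => neZero_of_not_dvd (ha i)
  refine ⟨hp2, n, a, this, dualLattice G, inferInstance, dualCoord G V a, ψ, hn, ha,
    isSubquotient_dualCoord hV hψ hker hq, ?_⟩
  rw [hs, ← sigPos_sub_sigNeg hV]
  push_cast
  rfl

end existence

end

end WeilHecke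

/-! ### The Weil representation -/

namespace WeilHecke

noncomputable section

open Matrix

section rep

variable {A M : Type*} [AddCommGroup A] [Fintype A] [AddCommGroup M] {D : DiscriminantForm A}
  {n : ℕ} {a : Fin n → ℤ} [∀ i, NeZero (a i)] {r : M →+ DiagGroup a} {ψ : M →+ A}

omit [Fintype A] in
lemma diagRep_T_mulVec_inflate (S : IsSubquotient D (diagQ a) (diagB a) r ψ) (f : GroupAlg A) :
    diagRep a mpT *ᵥ inflate r ψ f = inflate r ψ (weilT D f) := by
  classical
  funext b
  rw [diagRep_T, mulVec_diagonal]
  by_cases h : ∃ y, r y = b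
  · obtain ⟨y, rfl⟩ := h
    rw [S.inflate_apply, S.inflate_apply, S.map_q]
    rfl
  · rw [inflate_of_not _ h, inflate_of_not _ h, mul_zero]

omit [Fintype A] in
lemma exp_sig_eq {s : ℤ} (hs : D.sig = (s : ZMod 8)) :
    Complex.exp (2 * Real.pi * Complex.I * (-(s : ℂ) / 8)) =
      Complex.exp (2 * Real.pi * Complex.I * (-(D.sig.val : ℂ) / 8)) := by
  have h : ((s - D.sig.val : ℤ) : ZMod 8) = 0 := by
    push_cast
    rw [ZMod.natCast_zmod_val, hs, sub_self]
  rw [ZMod.intCast_zmod_eq_zero_iff_dvd] at h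
  obtain ⟨t, ht⟩ := h
  have h1 : (s : ℂ) = D.sig.val + 8 * t := by
    have : s = D.sig.val + 8 * t := by push_cast at ht; linarith
    exact_mod_cast this
  rw [Complex.exp_eq_exp_iff_exists_int]
  refine ⟨-t, ?_⟩
  rw [h1]
  push_cast
  ring

lemma diagRep_S_mulVec_inflate (S : IsSubquotient D (diagQ a) (diagB a) r ψ)
    (hs : D.sig = ((∑ i, (a i).sign : ℤ) : ZMod 8)) (f : GroupAlg A) :
    diagRep a mpS *ᵥ inflate r ψ f = inflate r ψ (weilS D f) := by
  classical
  funext b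
  have h1 := S.sum_e_mul_inflate f b
  have h2 := S.card_eq
  set c := Nat.card (ψ.ker.map r) with hc
  have hc0 : (c : ℂ) ≠ 0 := Nat.cast_ne_zero.mpr Nat.card_pos.ne'
  have h3 : Real.sqrt (Fintype.card (DiagGroup a)) = c * Real.sqrt (Fintype.card A) := by
    rw [h2, Nat.cast_mul, Nat.cast_pow, Real.sqrt_mul (by positivity),
      Real.sqrt_sq (Nat.cast_nonneg c)]
  have h4 : weilS D f = (Complex.exp (2 * Real.pi * Complex.I * (-(D.sig.val : ℂ) / 8)) /
    (Real.sqrt (Fintype.card A) : ℂ)) • fun y => ∑ x : A, e (-D.bilin x y) * f x := rfl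
  rw [h4, map_smul, Pi.smul_apply, smul_eq_mul, mulVec, dotProduct]
  have h5 : ∀ b', diagRep a mpS b b' = Complex.exp (2 * Real.pi * Complex.I *
      (-(D.sig.val : ℂ) / 8)) / (Real.sqrt (Fintype.card (DiagGroup a)) : ℂ) *
        e (-diagB a b b') := fun b' => by rw [diagRep_S, exp_sig_eq hs]
  simp only [h5, mul_assoc (_ / _ : ℂ)]
  rw [← Finset.mul_sum]
  simp only [diagB_comm b]
  rw [h1, h3]
  push_cast
  field_simp

lemma diagRep_mulVec_inv (γ : Mp2Z) (x : DiagGroup a → ℂ) :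
    diagRep a γ⁻¹ *ᵥ (diagRep a γ *ᵥ x) = x := by
  rw [mulVec_mulVec, ← map_mul, inv_mul_cancel, map_one, one_mulVec]

/-- The image of `ℂ[A]` in `ℂ[B]` is stable under the Weil representation of `B`. -/
lemma exists_inflate_eq (S : IsSubquotient D (diagQ a) (diagB a) r ψ)
    (hs : D.sig = ((∑ i, (a i).sign : ℤ) : ZMod 8)) (γ : Mp2Z) :
    ∃ L : Module.End ℂ (GroupAlg A), ∀ f, diagRep a γ *ᵥ inflate r ψ f = inflate r ψ (L f) := by
  have hmem : γ ∈ Subgroup.closure {mpS, mpT} := by rw [mp2Z_closure]; trivial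
  induction hmem using Subgroup.closure_induction with
  | mem x hx =>
    rcases hx with rfl | rfl
    · exact ⟨weilS D, diagRep_S_mulVec_inflate S hs⟩
    · exact ⟨weilT D, diagRep_T_mulVec_inflate S⟩
  | one => exact ⟨1, fun f => by rw [map_one, one_mulVec]; rfl⟩
  | mul x y _ _ hx hy =>
    obtain ⟨L, hL⟩ := hx
    obtain ⟨L', hL'⟩ := hy
    exact ⟨L * L', fun f => by rw [map_mul, ← mulVec_mulVec, hL', hL]; rfl⟩
  | inv x _ hx =>
    obtain ⟨L, hL⟩ := hx
    have hinj : Function.Injective L := fun f g hfg => S.inflate_injective <| by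
      rw [← diagRep_mulVec_inv x (inflate r ψ f), ← diagRep_mulVec_inv x (inflate r ψ g), hL, hL,
        hfg]
    have hbij : Function.Bijective L := ⟨hinj, LinearMap.injective_iff_surjective.mp hinj⟩
    refine ⟨(LinearEquiv.ofBijective L hbij).symm, fun f => ?_⟩
    obtain ⟨g, rfl⟩ := hbij.2 f
    rw [← hL, diagRep_mulVec_inv]
    congr 1
    exact ((LinearEquiv.ofBijective L hbij).symm_apply_apply g).symm

/-- The restriction of the Weil representation of `∏ ℤ/2aᵢ` to `ℂ[A]`. -/
lemma exists_weilRep (S : IsSubquotient D (diagQ a) (diagB a) r ψ)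
    (hs : D.sig = ((∑ i, (a i).sign : ℤ) : ZMod 8)) :
    ∃ ρ : Mp2Z →* Module.End ℂ (GroupAlg A), ρ mpT = weilT D ∧ ρ mpS = weilS D ∧
      ∀ γ f, diagRep a γ *ᵥ inflate r ψ f = inflate r ψ (ρ γ f) := by
  choose L hL using exists_inflate_eq S hs
  refine ⟨⟨⟨L, ?_⟩, ?_⟩, ?_, ?_, hL⟩
  · refine LinearMap.ext fun f => S.inflate_injective ?_
    rw [← hL, map_one, one_mulVec]; rfl
  · refine fun x y => LinearMap.ext fun f => S.inflate_injective ?_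
    rw [← hL, map_mul, ← mulVec_mulVec, hL, hL]; rfl
  · refine LinearMap.ext fun f => S.inflate_injective ?_
    rw [← diagRep_T_mulVec_inflate S]; exact (hL _ _).symm
  · refine LinearMap.ext fun f => S.inflate_injective ?_
    rw [← diagRep_S_mulVec_inflate S hs]; exact (hL _ _).symm

lemma weilRep_spec (S : IsSubquotient D (diagQ a) (diagB a) r ψ)
    (hs : D.sig = ((∑ i, (a i).sign : ℤ) : ZMod 8)) :
    weilRep D mpT = weilT D ∧ weilRep D mpS = weilS D := by
  have h : ∃ ρ : Mp2Z →* Module.End ℂ (GroupAlg A), ρ mpT = weilT D ∧ ρ mpS = weilS D := by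
    obtain ⟨ρ, h1, h2, -⟩ := exists_weilRep S hs
    exact ⟨ρ, h1, h2⟩
  rw [weilRep, dif_pos h]
  exact h.choose_spec

/-- The inflation map intertwines the Weil representations of `A` and of `∏ ℤ/2aᵢ`. -/
lemma diagRep_mulVec_inflate (S : IsSubquotient D (diagQ a) (diagB a) r ψ)
    (hs : D.sig = ((∑ i, (a i).sign : ℤ) : ZMod 8)) (γ : Mp2Z) (f : GroupAlg A) :
    diagRep a γ *ᵥ inflate r ψ f = inflate r ψ (weilRep D γ f) := by
  obtain ⟨ρ, h1, h2, h3⟩ := exists_weilRep S hs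
  obtain ⟨h4, h5⟩ := weilRep_spec S hs
  have h : weilRep D = ρ := by
    apply MonoidHom.eq_of_eqOn_dense mp2Z_closure
    rintro x (rfl | rfl)
    · rw [h5, h2]
    · rw [h4, h1]
  rw [h, h3]

lemma weilRep_apply (S : IsSubquotient D (diagQ a) (diagB a) r ψ)
    (hs : D.sig = ((∑ i, (a i).sign : ℤ) : ZMod 8)) (γ : Mp2Z) (f : GroupAlg A) (y : M) :
    weilRep D γ f (ψ y) = ∑ s, diagRep a γ (r y) s * inflate r ψ f s := by
  rw [← S.inflate_apply (weilRep D γ f), ← diagRep_mulVec_inflate S hs]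
  rfl

end rep

section diagOp

variable {A M : Type*} [AddCommGroup A] [Fintype A] [AddCommGroup M] {D : DiscriminantForm A}
  {n : ℕ} {a : Fin n → ℤ} [∀ i, NeZero (a i)] {r : M →+ DiagGroup a} {ψ : M →+ A}
  {p : ℕ} [hp : Fact p.Prime] (hpN : p.Coprime D.level)

omit hp in
lemma unitMul_apply (x : A) : D.unitMul (ZMod.unitOfCoprime p hpN) x = p • x := by
  let _ := D.zmodModule
  change ((p : ℕ) : ZMod D.level) • x = _
  rw [Nat.cast_smul_eq_nsmul]

omit hp in
lemma diagOp_apply (f : GroupAlg A) (x : A) :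
    (diagOp D (ZMod.unitOfCoprime p hpN) : Module.End ℂ (GroupAlg A)) f x = f (p • x) := by
  rw [← unitMul_apply hpN]; rfl

omit [∀ i, NeZero (a i)] in
lemma coprime_card_diagGroup (hpa : ∀ i, ¬ (p : ℤ) ∣ 2 * a i) :
    p.Coprime (Nat.card (DiagGroup a)) := by
  rw [Nat.card_pi, Nat.Prime.coprime_iff_not_dvd hp.out, hp.out.prime.dvd_finsetProd_iff]
  rintro ⟨i, -, hi⟩
  rw [Nat.card_zmod] at hi
  apply hpa i
  rw [← Int.dvd_natAbs, Int.natAbs_mul]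
  exact_mod_cast hi

omit [∀ i, NeZero (a i)] in
lemma inflate_diagOp (hpa : ∀ i, ¬ (p : ℤ) ∣ 2 * a i)
    (S : IsSubquotient D (diagQ a) (diagB a) r ψ) (f : GroupAlg A) (s : DiagGroup a) :
    inflate r ψ ((diagOp D (ZMod.unitOfCoprime p hpN) : Module.End ℂ (GroupAlg A)) f) s =
      inflate r ψ f (p • s) := by
  by_cases h : ∃ y, r y = s
  · obtain ⟨y, rfl⟩ := h
    rw [← map_nsmul, S.inflate_apply, S.inflate_apply, diagOp_apply, map_nsmul]
  · have h' : ¬ ∃ y, r y = p • s := by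
      rintro ⟨y, hy⟩
      obtain ⟨u, v, huv⟩ := Nat.isCoprime_iff_coprime.mpr (coprime_card_diagGroup hpa)
      refine h ⟨u • y, ?_⟩
      rw [map_zsmul, hy]
      conv_rhs => rw [← one_zsmul s, ← huv, add_zsmul, mul_zsmul, mul_zsmul, natCast_zsmul,
        natCast_zsmul, card_nsmul_eq_zero', zsmul_zero, add_zero]
    rw [inflate_of_not _ h, inflate_of_not _ h']

/-- If `α = ((p², 0; 0, 1), 1)` conjugates `γ` to `γ'`, then `U : 𝔢_λ ↦ 𝔢_{λ/p}` intertwines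
`ρ(γ)` and `ρ(γ')`. -/
lemma diagOp_weilRep (hpa : ∀ i, ¬ (p : ℤ) ∣ 2 * a i)
    (S : IsSubquotient D (diagQ a) (diagB a) r ψ)
    (hs : D.sig = ((∑ i, (a i).sign : ℤ) : ZMod 8)) {γ γ' : Mp2Z}
    (hγ : (γ' : MpGL) * alphaP p = alphaP p * γ) :
    (diagOp D (ZMod.unitOfCoprime p hpN) : Module.End ℂ (GroupAlg A)) * weilRep D γ =
      weilRep D γ' * (diagOp D (ZMod.unitOfCoprime p hpN) : Module.End ℂ (GroupAlg A)) := by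
  refine LinearMap.ext fun f => funext fun x => ?_
  obtain ⟨y, rfl⟩ := S.surj x
  rw [Module.End.mul_apply, Module.End.mul_apply, diagOp_apply, ← map_nsmul, weilRep_apply S hs,
    weilRep_apply S hs]
  symm
  refine Fintype.sum_equiv (nsmulCoprime (coprime_card_diagGroup hpa).symm) _ _ fun s => ?_
  rw [inflate_diagOp hpN hpa S, diagRep_conj hpa hγ, map_nsmul]
  rfl

/-- The relation between `U ρ(γ)` and `ρ(γ')` for `αγ = γ'β` with `β = (p, b; 0, p)`. -/
lemma gaussP_mul_weilRep (hpa : ∀ i, ¬ (p : ℤ) ∣ 2 * a i)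
    (S : IsSubquotient D (diagQ a) (diagB a) r ψ)
    (hs : D.sig = ((∑ i, (a i).sign : ℤ) : ZMod 8)) {γ γ' : Mp2Z} {β : MpGL} {φ₀ : ℝ}
    (hβφ : ∀ τ, β.φ τ = φ₀) {b : ℤ} {b₁ : Fin n → ℤ} (hb : ∀ i, b = 4 * a i * b₁ i)
    (hβ : (β.mat : Matrix (Fin 2) (Fin 2) ℝ) = !![(p : ℝ), b; 0, p])
    (hγ : alphaP p * γ = γ' * β) (hc : (γ : MpGL).mat 1 0 = p)
    (hd : (γ : MpGL).mat 1 1 = b) :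
    (∏ i, (φ₀ * gaussP p (-b₁ i))) •
      ((diagOp D (ZMod.unitOfCoprime p hpN) : Module.End ℂ (GroupAlg A)) * weilRep D γ) =
        ((p : ℂ) ^ n) • weilRep D γ' := by
  refine LinearMap.ext fun f => funext fun x => ?_
  obtain ⟨y, rfl⟩ := S.surj x
  rw [LinearMap.smul_apply, Module.End.mul_apply, Pi.smul_apply, diagOp_apply, ← map_nsmul,
    weilRep_apply S hs, LinearMap.smul_apply, Pi.smul_apply, weilRep_apply S hs, smul_eq_mul,
    smul_eq_mul, Finset.mul_sum, Finset.mul_sum]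
  refine Finset.sum_congr rfl fun s _ => ?_
  rw [← mul_assoc, ← mul_assoc, map_nsmul, gaussP_mul_diagRep hpa hβφ hb hβ hγ hc hd]

end diagOp

end

end WeilHecke

/-! ### The operator of the Hecke element -/

namespace WeilHecke

noncomputable section

open Matrix

section gauss

variable {A : Type*} [AddCommGroup A] [Fintype A] (D : DiscriminantForm A)

lemma level_mem : D.level ∈ {N : ℕ | 0 < N ∧ ∀ x, N • D.q x = 0} := by
  refine Nat.sInf_mem ⟨Nat.card A * Nat.card A, Nat.mul_pos Nat.card_pos Nat.card_pos, fun x => ?_⟩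
  have h := QuadraticMap.map_smul D.q (Nat.card A : ℤ) x
  rw [natCast_zsmul, card_nsmul_eq_zero', QuadraticMap.map_zero] at h
  rw [h]
  norm_cast

lemma level_nsmul_q (x : A) : D.level • D.q x = 0 := (level_mem D).2 x

lemma level_pos : 0 < D.level := (level_mem D).1

variable {D}

omit [Fintype A] in
lemma nsmul_congr_of_level {Γ : Type*} [AddCommGroup Γ] {x : Γ} (hx : D.level • x = 0) {a b : ℕ}
    (h : (a : ZMod D.level) = b) : a • x = b • x := by
  rw [nsmul_eq_nsmul_iff_modEq]
  exact ((ZMod.natCast_eq_natCast_iff _ _ _).mp h).of_dvd (addOrderOf_dvd_of_nsmul_eq_zero hx)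

/-- The character `x ↦ e((x, y))`. -/
def bilinChar (D : DiscriminantForm A) (y : A) : AddChar A ℂ where
  toFun x := e (D.bilin x y)
  map_zero_eq_one' := by rw [D.bilin_zero_left, e_zero]
  map_add_eq_mul' x x' := by rw [D.bilin_add_left, e_add]

lemma sum_e_bilin [DecidableEq A] (y : A) :
    ∑ x, e (D.bilin x y) = if y = 0 then (Fintype.card A : ℂ) else 0 := by
  have h := AddChar.sum_eq_ite (bilinChar D y)
  have h0 : bilinChar D y = 0 ↔ y = 0 := by
    rw [DFunLike.ext_iff]
    refine ⟨fun H => D.nondegenerate y fun x => ?_, ?_⟩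
    · have := H x
      change e (D.bilin x y) = 1 at this
      rw [e_eq_one_iff, D.bilin_comm] at this
      exact this
    · rintro rfl x
      change e (D.bilin x 0) = 1
      rw [D.bilin_comm, D.bilin_zero_left, e_zero]
  simp only [h0] at h
  exact h

variable (D) in
/-- The constant `e(-sig(A)/8)/√|A|`. -/
def weilConst : ℂ := Complex.exp (2 * Real.pi * Complex.I * (-(D.sig.val : ℂ) / 8)) /
  (Real.sqrt (Fintype.card A) : ℂ)

lemma weilS_apply (f : GroupAlg A) (y : A) :
    weilS D f y = weilConst D * ∑ x, e (-D.bilin x y) * f x := rfl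

lemma weilConst_ne_zero : weilConst D ≠ 0 :=
  div_ne_zero (Complex.exp_ne_zero _) (by
    rw [Complex.ofReal_ne_zero, Real.sqrt_ne_zero']
    exact_mod_cast Fintype.card_pos)

/-- Fourier inversion. -/
lemma weilRep_S_inv (hS : weilRep D mpS = weilS D) (f : GroupAlg A) (y : A) :
    weilRep D mpS⁻¹ f y =
      (weilConst D * Fintype.card A)⁻¹ * ∑ x, e (D.bilin x y) * f x := by
  classical
  have h0 : (Fintype.card A : ℂ) ≠ 0 := Nat.cast_ne_zero.mpr Fintype.card_ne_zero
  set g : GroupAlg A := fun y => (weilConst D * Fintype.card A)⁻¹ * ∑ x, e (D.bilin x y) * f x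
    with hg
  have h1 : weilRep D mpS g = f := by
    funext z
    rw [hS, weilS_apply]
    simp only [hg, Finset.mul_sum]
    rw [Finset.sum_comm]
    have h2 : ∀ x : A, ∑ y : A, weilConst D * (e (-D.bilin y z) *
        ((weilConst D * Fintype.card A)⁻¹ * (e (D.bilin x y) * f x))) =
          (Fintype.card A : ℂ)⁻¹ * f x * if x - z = 0 then (Fintype.card A : ℂ) else 0 := fun x => by
      rw [← sum_e_bilin (D := D), Finset.mul_sum]
      refine Finset.sum_congr rfl fun y _ => ?_
      have h3 : D.bilin y (x - z) = D.bilin x y + -D.bilin y z := by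
        rw [eq_add_neg_iff_add_eq, ← D.bilin_add_right, sub_add_cancel, D.bilin_comm]
      rw [h3, e_add]
      have := weilConst_ne_zero (D := D)
      field_simp
    rw [Finset.sum_congr rfl fun x _ => h2 x, Finset.sum_eq_single z]
    · rw [sub_self, if_pos rfl]; field_simp
    · intro x _ hx
      rw [if_neg (sub_ne_zero.mpr hx), mul_zero]
    · simp
  have h2 : weilRep D mpS⁻¹ f = g := by
    rw [← h1, ← Module.End.mul_apply, ← map_mul, inv_mul_cancel, map_one]; rfl
  rw [h2]

lemma weilRep_T_pow (hT : weilRep D mpT = weilT D) (m : ℕ) (f : GroupAlg A) (y : A) :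
    weilRep D (mpT ^ m) f y = e (m • D.q y) * f y := by
  induction m generalizing f with
  | zero => rw [pow_zero, map_one, zero_smul, e_zero, one_mul]; rfl
  | succ m ih =>
    rw [pow_succ, map_mul, Module.End.mul_apply, ih, hT, succ_nsmul, e_add, mul_assoc]
    rfl

omit [Fintype A] in
lemma q_nsmul (m : ℕ) (x : A) : D.q (m • x) = (m * m) • D.q x := by
  have h := QuadraticMap.map_smul D.q (m : ℤ) x
  rw [natCast_zsmul] at h
  rw [h, ← natCast_zsmul]
  push_cast
  rfl

omit [Fintype A] in
lemma bilin_nsmul_right (m : ℕ) (x y : A) : D.bilin x (m • y) = m • D.bilin x y := by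
  induction m with
  | zero => rw [zero_smul, zero_smul, D.bilin_comm, D.bilin_zero_left]
  | succ m ih => rw [succ_nsmul, succ_nsmul, D.bilin_add_right, ih]

omit [Fintype A] in
lemma bilin_neg_right (x y : A) : D.bilin x (-y) = -D.bilin x y := by
  rw [eq_neg_iff_add_eq_zero, ← D.bilin_add_right, neg_add_cancel, D.bilin_comm, D.bilin_zero_left]

/-- Completing the square in a Gauss sum. -/
lemma sum_e_q_add_bilin {p r : ℕ} (hpr : ((p * r : ℕ) : ZMod D.level) = 1) (u : A) :
    ∑ y, e (p • D.q y + D.bilin y u) = (∑ y, e (p • D.q y)) * e (-(r • D.q u)) := by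
  rw [← Equiv.sum_comp (Equiv.addRight (r • u)) fun y => e (p • D.q y), Finset.sum_mul]
  refine Finset.sum_congr rfl fun y _ => ?_
  rw [← e_add]
  congr 1
  have h1 : (p * r : ℕ) • D.q u = 1 • D.q u :=
    nsmul_congr_of_level (level_nsmul_q D u) (by rw [hpr, Nat.cast_one])
  have h2 : (p * r : ℕ) • D.bilin y u = 1 • D.bilin y u :=
    nsmul_congr_of_level (D := D) (by rw [← bilin_nsmul_right, D.level_smul, D.bilin_comm,
      D.bilin_zero_left]) (by rw [hpr, Nat.cast_one])
  rw [one_smul] at h1 h2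
  rw [Equiv.coe_addRight, D.q_add, smul_add, smul_add, bilin_nsmul_right, q_nsmul, ← mul_smul p r,
    h2, ← mul_smul p, ← mul_assoc, mul_comm (p * r) r, mul_smul r, h1]
  abel

/-- A word in `S` and `T` over a matrix congruent to `diag(p, p⁻¹)` modulo `N`. -/
def diagWord (p r : ℕ) : Mp2Z := mpT ^ p * (mpS * (mpT ^ r * (mpS⁻¹ * (mpT ^ p * mpS))))

/-- Expanding the word, all exponential factors cancel and orthogonality of characters leaves the
term `f(pλ)`. -/
lemma weilRep_diagWord (hT : weilRep D mpT = weilT D) (hS : weilRep D mpS = weilS D) {p r : ℕ}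
    (hpr : ((p * r : ℕ) : ZMod D.level) = 1) (f : GroupAlg A) (w : A) :
    weilRep D (diagWord p r) f w = weilConst D * (∑ y, e (p • D.q y)) * f (p • w) := by
  classical
  have hC := weilConst_ne_zero (D := D)
  have h0 : (Fintype.card A : ℂ) ≠ 0 := Nat.cast_ne_zero.mpr Fintype.card_ne_zero
  have hpr1 : ∀ u : A, (p * r) • u = u := fun u => by
    have := nsmul_congr_of_level (D := D) (x := u) (D.level_smul u) (b := 1)
      (by rw [hpr, Nat.cast_one])
    rwa [one_smul] at this
  obtain ⟨g, hg⟩ : ∃ g, g = ∑ y, e (p • D.q y) := ⟨_, rfl⟩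
  rw [← hg]
  -- the first three letters: a convolution with a Gauss sum
  have h1 : ∀ z, weilRep D (mpS⁻¹ * (mpT ^ p * mpS)) f z =
      (Fintype.card A : ℂ)⁻¹ * g * ∑ x, e (-(r • D.q (z - x))) * f x := fun z => by
    rw [map_mul, map_mul, Module.End.mul_apply, Module.End.mul_apply, weilRep_S_inv hS]
    simp only [weilRep_T_pow hT, hS, weilS_apply, Finset.mul_sum]
    rw [Finset.sum_comm]
    refine Finset.sum_congr rfl fun x _ => ?_
    have h2 := sum_e_q_add_bilin hpr (z - x)
    rw [← hg] at h2
    rw [mul_assoc _ g, ← mul_assoc g, ← h2, Finset.sum_mul, Finset.mul_sum]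
    refine Finset.sum_congr rfl fun y _ => ?_
    have h3 : p • D.q y + D.bilin y (z - x) = D.bilin y z + p • D.q y + -D.bilin x y := by
      rw [sub_eq_add_neg, D.bilin_add_right, bilin_neg_right, D.bilin_comm y x]
      abel
    rw [h3, e_add, e_add]
    field_simp
  -- applying `T^r` removes the quadratic factor in `z`
  have h2 : ∀ z, weilRep D (mpT ^ r * (mpS⁻¹ * (mpT ^ p * mpS))) f z =
      (Fintype.card A : ℂ)⁻¹ * g * ∑ x, e (D.bilin z (r • x)) * (e (-(r • D.q x)) * f x) :=
      fun z => by
    rw [map_mul, Module.End.mul_apply, weilRep_T_pow hT, h1, mul_left_comm, Finset.mul_sum]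
    congr 1
    refine Finset.sum_congr rfl fun x _ => ?_
    rw [← mul_assoc, ← mul_assoc, ← e_add, ← e_add]
    congr 2
    have h3 : D.q (z - x) = D.q z + D.q x + -D.bilin z x := by
      have := D.q_add z (-x)
      rw [← sub_eq_add_neg, bilin_neg_right, QuadraticMap.map_neg] at this
      exact this
    rw [h3, smul_add, smul_add, smul_neg, bilin_nsmul_right]
    abel
  rw [diagWord, map_mul, Module.End.mul_apply, weilRep_T_pow hT, map_mul, Module.End.mul_apply, hS,
    weilS_apply]
  simp only [h2, Finset.mul_sum]
  rw [Finset.sum_comm]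
  have h3 : ∀ x : A, ∑ z : A, e (p • D.q w) * (weilConst D * (e (-D.bilin z w) *
      ((Fintype.card A : ℂ)⁻¹ * g * (e (D.bilin z (r • x)) * (e (-(r • D.q x)) * f x))))) =
      weilConst D * (Fintype.card A : ℂ)⁻¹ * g * e (p • D.q w) * e (-(r • D.q x)) * f x *
        if r • x - w = 0 then (Fintype.card A : ℂ) else 0 := fun x => by
    rw [← sum_e_bilin (D := D), Finset.mul_sum]
    refine Finset.sum_congr rfl fun z _ => ?_
    rw [sub_eq_add_neg, D.bilin_add_right, bilin_neg_right, e_add]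
    ring
  rw [Finset.sum_congr rfl fun x _ => h3 x, Finset.sum_eq_single (p • w)]
  · rw [← mul_smul, mul_comm r p, hpr1, sub_self, if_pos rfl, q_nsmul, ← mul_smul r, ← mul_assoc,
      mul_comm (r * p) p, mul_smul p, mul_comm r p]
    have h4 : (p * r) • D.q w = D.q w := by
      have := nsmul_congr_of_level (level_nsmul_q D w) (b := 1) (by rw [hpr, Nat.cast_one])
      rwa [one_smul] at this
    rw [h4, e_neg]
    have := e_ne_zero (p • D.q w)
    field_simp
  · intro x _ hx
    rw [if_neg, mul_zero]
    intro h
    apply hx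
    rw [sub_eq_zero] at h
    rw [← h, ← mul_smul, hpr1]
  · simp

end gauss

end

end WeilHecke

namespace WeilHecke

noncomputable section

open Matrix

/-- The matrix of `diagWord`. -/
def diagWordSL (p r : ℕ) : SL(2, ℤ) :=
  ModularGroup.T ^ p * (ModularGroup.S * (ModularGroup.T ^ r *
    (ModularGroup.S⁻¹ * (ModularGroup.T ^ p * ModularGroup.S))))

lemma coe_T_pow (m : ℕ) : ((ModularGroup.T ^ m : SL(2, ℤ)) : Matrix (Fin 2) (Fin 2) ℤ) =
    !![1, (m : ℤ); 0, 1] := by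
  have := ModularGroup.coe_T_zpow m
  rwa [zpow_natCast] at this

lemma coe_diagWordSL (p r : ℕ) : (diagWordSL p r : Matrix (Fin 2) (Fin 2) ℤ) =
    !![(p : ℤ) * (1 - p * r) + p, -(1 - p * r); 1 - p * r, r] := by
  have hmul : ∀ X Y : SL(2, ℤ), (X * Y).1 = X.1 * Y.1 := fun _ _ => rfl
  have hS : (ModularGroup.S).1 = !![0, -1; 1, 0] := rfl
  have hinv : (ModularGroup.S⁻¹).1 = adjugate (ModularGroup.S).1 := rfl
  rw [hS, adjugate_fin_two_of, neg_neg] at hinv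
  rw [diagWordSL, hmul, hmul, hmul, hmul, hmul, coe_T_pow, coe_T_pow, hS, hinv]
  ext i j
  fin_cases i <;> fin_cases j <;> simp [Matrix.mul_apply, Fin.sum_univ_two] <;> ring

lemma diagWordSL_one : diagWordSL 1 1 = 1 := by
  ext i j
  rw [coe_diagWordSL]
  fin_cases i <;> fin_cases j <;> simp

lemma diagWord_mat (p r : ℕ) :
    (diagWord p r : MpGL).mat = SpecialLinearGroup.mapGL ℝ (diagWordSL p r) := by
  have h : ∀ γ : Mp2Z, (γ : MpGL).mat = MpGL.proj γ := fun _ => rfl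
  have hT : MpGL.proj mpT = SpecialLinearGroup.mapGL ℝ ModularGroup.T := rfl
  have hS : MpGL.proj mpS = SpecialLinearGroup.mapGL ℝ ModularGroup.S := rfl
  rw [h, diagWord, diagWordSL]
  simp only [Subgroup.coe_mul, Subgroup.coe_inv, SubmonoidClass.coe_pow, map_mul, map_inv, map_pow,
    hT, hS]

section hecke

variable {A : Type*} [AddCommGroup A] [Fintype A] {D : DiscriminantForm A}

lemma gauss_eq {r : (ZMod D.level)ˣ} {p : ℕ} (h : (r : ZMod D.level) = p) :
    D.gauss r = ∑ y : A, e (p • D.q y) := by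
  have : NeZero D.level := ⟨(level_pos D).ne'⟩
  refine Finset.sum_congr rfl fun y _ => ?_
  rw [nsmul_congr_of_level (level_nsmul_q D y) (b := p)]
  rw [ZMod.natCast_zmod_val, h]

variable {p : ℕ} [hp : Fact p.Prime] (hpN : p.Coprime D.level)

include hpN in
omit hp in
lemma exists_inv_level : ∃ r : ℕ, ((p * r : ℕ) : ZMod D.level) = 1 := by
  have : NeZero D.level := ⟨(level_pos D).ne'⟩
  refine ⟨((ZMod.unitOfCoprime p hpN)⁻¹ : (ZMod D.level)ˣ).val.val, ?_⟩
  rw [Nat.cast_mul, ZMod.natCast_zmod_val]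
  exact (ZMod.unitOfCoprime p hpN).mul_inv

omit hp in
lemma weilRep_diagWord_eq (hT : weilRep D mpT = weilT D) (hS : weilRep D mpS = weilS D) {r : ℕ}
    (hpr : ((p * r : ℕ) : ZMod D.level) = 1) : weilRep D (diagWord p r) =
      (weilConst D * D.gauss (ZMod.unitOfCoprime p hpN)) •
        (diagOp D (ZMod.unitOfCoprime p hpN) : Module.End ℂ (GroupAlg A)) := by
  refine LinearMap.ext fun f => funext fun w => ?_
  rw [weilRep_diagWord hT hS hpr, gauss_eq (ZMod.coe_unitOfCoprime p hpN), LinearMap.smul_apply,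
    Pi.smul_apply, diagOp_apply, smul_eq_mul]

lemma weilRep_ne_zero (γ : Mp2Z) : weilRep D γ ≠ 0 := fun h => by
  have h1 : weilRep D (γ * γ⁻¹) = 0 := by rw [map_mul, h, zero_mul]
  rw [mul_inv_cancel, map_one] at h1
  exact one_ne_zero h1

lemma matP_coe : (matP p : Matrix (Fin 2) (Fin 2) ℝ) = !![(p : ℝ) ^ 2, 0; 0, 1] := rfl

/-- The operator `U` is `g(A)/g_p(A) ρ(γ)` with `γ` over `diagWordSL p r`. The word for `p = r = 1`
lies in the kernel of the cover and corrects the constant `e(-sig(A)/8) g(A)/√|A|`. -/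
lemma xiP_mem_Q2 (hT : weilRep D mpT = weilT D) (hS : weilRep D mpS = weilS D) :
    xiP D p hpN ∈ Q2 D := by
  obtain ⟨r, hpr⟩ := exists_inv_level hpN
  set u := ZMod.unitOfCoprime p hpN with hu
  have h1 := weilRep_diagWord_eq hpN hT hS hpr
  have h2 : weilRep D (diagWord 1 1) = (weilConst D * D.gauss 1) • 1 := by
    refine LinearMap.ext fun f => funext fun w => ?_
    rw [weilRep_diagWord hT hS (by simp), gauss_eq (p := 1) (by simp), one_smul]
    rfl
  have hp0 : weilConst D * D.gauss u ≠ 0 := fun h => weilRep_ne_zero (diagWord p r) (by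
    rw [h1, h, zero_smul])
  have h10 : weilConst D * D.gauss 1 ≠ 0 := fun h => weilRep_ne_zero (D := D) (diagWord 1 1) (by
    rw [h2, h, zero_smul])
  have h3 : weilRep D (diagWord 1 1)⁻¹ = (weilConst D * D.gauss 1)⁻¹ • 1 := by
    have h4 : weilRep D ((diagWord 1 1)⁻¹ * diagWord 1 1) = 1 := by rw [inv_mul_cancel, map_one]
    rw [map_mul, h2, mul_smul_comm, mul_one] at h4
    rw [← h4, smul_smul, inv_mul_cancel₀ h10, one_smul]
  have hpr' : (p : ZMod D.level) * r = 1 := by rw [← Nat.cast_mul, hpr]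
  refine ⟨1, !![(p : ℤ) ^ 2, 0; 0, 1], diagWordSL p r, diagWord p r * (diagWord 1 1)⁻¹, one_ne_zero,
    isCoprime_one_left, ?_, ?_, ?_, ?_, ?_, ?_⟩
  · rw [det_fin_two_of, mul_one, mul_zero, sub_zero]
    exact (Nat.isCoprime_iff_coprime.mpr hpN).pow_left
  · rw [Int.cast_one, one_smul]
    change _ = (matP p : Matrix (Fin 2) (Fin 2) ℝ)
    rw [matP_coe]
    ext i j
    fin_cases i <;> fin_cases j <;> simp
  · rw [det_fin_two_of]
    simp [xiP]
  · rw [coe_diagWordSL]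
    ext i j
    have h5 : (p : ZMod D.level) * p * (p * r) = p * p := by rw [hpr', mul_one]
    fin_cases i <;> fin_cases j <;> simp [xiP, hpr', sq]
  · rw [Subgroup.coe_mul, Subgroup.coe_inv, MpGL.mul_mat, MpGL.inv_mat, diagWord_mat, diagWord_mat,
      diagWordSL_one, map_one, inv_one, mul_one]
  · rw [map_mul, h3, h1, smul_mul_assoc, mul_smul_comm, mul_one, smul_smul, smul_smul]
    have h9 : (xiP D p hpN).2.1 = u := rfl
    have h11 : (xiP D p hpN).2.2 = diagOp D u := rfl
    rw [h9, h11, ← hu]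
    have h6 := right_ne_zero_of_mul hp0
    have h7 := right_ne_zero_of_mul h10
    have h8 := weilConst_ne_zero (D := D)
    rw [show D.gauss 1 / D.gauss u * (weilConst D * D.gauss u) * (weilConst D * D.gauss 1)⁻¹ = 1 by
      field_simp, one_smul]

end hecke

end

end WeilHecke

/-! ### The double coset of the Hecke element -/

namespace WeilHecke

noncomputable section

open Matrix
open Matrix.SpecialLinearGroup (mapGL)

lemma exists_mp2Z (G : SL(2, ℤ)) : ∃ γ : Mp2Z, (γ : MpGL).mat = mapGL ℝ G := by
  have hGc : G ∈ Subgroup.closure {ModularGroup.S, ModularGroup.T} := by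
    simp [SpecialLinearGroup.SL2Z_generators]
  induction hGc using Subgroup.closure_induction with
  | mem x hx =>
    rcases hx with rfl | rfl
    · exact ⟨mpS, rfl⟩
    · exact ⟨mpT, rfl⟩
  | one => exact ⟨1, by simp⟩
  | mul x y _ _ hx hy =>
    obtain ⟨a, ha⟩ := hx
    obtain ⟨b, hb⟩ := hy
    exact ⟨a * b, by simp [ha, hb]⟩
  | inv x _ hx =>
    obtain ⟨a, ha⟩ := hx
    exact ⟨a⁻¹, by simp [ha]⟩

variable {p : ℕ} [hp : Fact p.Prime]

/-- The conjugate of `γ` by `α = ((p², 0; 0, 1), 1)` is integral if and only if `p²` divides the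
lower left entry of `γ`. -/
lemma exists_conj_iff {γ : Mp2Z} {G : SL(2, ℤ)} (hG : (γ : MpGL).mat = mapGL ℝ G) :
    (∃ g : Mp2Z, (g : MpGL) * alphaP p = alphaP p * γ) ↔ (p : ℤ) ^ 2 ∣ G 1 0 := by
  constructor
  · rintro ⟨g, hg⟩
    obtain ⟨c, hc⟩ := exists_int_entry g 1 0
    have h1 := congrArg (fun x : MpGL => x.mat 1 0) hg
    simp only [MpGL.mul_mat, alphaP_mat, Units.val_mul, Matrix.mul_apply, Fin.sum_univ_two,
      matP_apply, hG, mapGL_apply] at h1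
    simp [hc] at h1
    refine ⟨c, ?_⟩
    have h2 : c * (p : ℤ) ^ 2 = G 1 0 := by exact_mod_cast h1
    rw [← h2, mul_comm]
  · rintro ⟨c, hc⟩
    have hdet := G.det_coe
    rw [det_fin_two] at hdet
    let H : SL(2, ℤ) := ⟨!![G 0 0, (p : ℤ) ^ 2 * G 0 1; c, G 1 1], by
      rw [det_fin_two_of]
      have h1 : G 0 0 * G 1 1 - G 0 1 * G 1 0 = 1 := hdet
      rw [hc] at h1
      linarith⟩
    have hH : mapGL ℝ H * matP p = matP p * mapGL ℝ G := by
      ext i j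
      have hc' : ((G 1 0 : ℤ) : ℝ) = (p : ℝ) ^ 2 * c := by rw [hc]; push_cast; ring
      rw [Units.val_mul, Units.val_mul, Matrix.mul_apply, Matrix.mul_apply]
      simp only [Fin.sum_univ_two, mapGL_apply, matP_apply]
      fin_cases i <;> fin_cases j <;> simp [H, hc'] <;> ring
    refine ⟨⟨alphaP p * γ * (alphaP p)⁻¹, H, ?_⟩, by simp⟩
    change mapGL ℝ H = matP p * (γ : MpGL).mat * (matP p)⁻¹
    rw [hG, ← hH, mul_inv_cancel_right]

section cosets

variable {A : Type*} [AddCommGroup A] [Fintype A] {D : DiscriminantForm A}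
  (hpN : p.Coprime D.level)

/-- Conjugation by `α` intertwines `ρ` with its conjugate by the operator of the Hecke element. -/
def IntertwinesConj (D : DiscriminantForm A) (hpN : p.Coprime D.level) : Prop :=
  ∀ γ γ' : Mp2Z, (γ' : MpGL) * alphaP p = alphaP p * γ →
    (diagOp D (ZMod.unitOfCoprime p hpN) : Module.End ℂ (GroupAlg A)) * weilRep D γ =
      weilRep D γ' * (diagOp D (ZMod.unitOfCoprime p hpN) : Module.End ℂ (GroupAlg A))

variable {hpN}

/-- Cosets of the Hecke element are distinguished by the bottom row modulo `p²`. -/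
lemma mk_mul_sectionL_eq_iff (hW : IntertwinesConj D hpN) {γ γ' : Mp2Z} {G G' : SL(2, ℤ)}
    (hG : (γ : MpGL).mat = mapGL ℝ G) (hG' : (γ' : MpGL).mat = mapGL ℝ G') :
    (Quotient.mk (QuotientGroup.rightRel (Delta D)) (xiP D p hpN * sectionL D γ) =
      Quotient.mk (QuotientGroup.rightRel (Delta D)) (xiP D p hpN * sectionL D γ')) ↔
      (p : ℤ) ^ 2 ∣ G' 1 0 * G 1 1 - G' 1 1 * G 1 0 := by
  have hmat : ((γ' * γ⁻¹ : Mp2Z) : MpGL).mat = mapGL ℝ (G' * G⁻¹) := by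
    rw [Subgroup.coe_mul, Subgroup.coe_inv, MpGL.mul_mat, MpGL.inv_mat, hG, hG', map_mul, map_inv]
  have hentry : (G' * G⁻¹) 1 0 = G' 1 0 * G 1 1 - G' 1 1 * G 1 0 := by
    change (G'.1 * adjugate G.1) 1 0 = _
    rw [Matrix.mul_apply, adjugate_fin_two, Fin.sum_univ_two]
    simp
    rfl
  rw [← hentry, ← exists_conj_iff hmat, Quotient.eq, QuotientGroup.rightRel_apply, _root_.mul_inv_rev,
    mul_assoc, ← mul_assoc (sectionL D γ'), ← map_inv, ← map_mul, ← mul_assoc]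
  constructor
  · rintro ⟨g, hg⟩
    refine ⟨g, ?_⟩
    have h1 : sectionL D g * xiP D p hpN = xiP D p hpN * sectionL D (γ' * γ⁻¹) := by
      rw [hg, inv_mul_cancel_right]
    exact congrArg Prod.fst h1
  · rintro ⟨g, hg⟩
    refine ⟨g, ?_⟩
    rw [eq_mul_inv_iff_mul_eq]
    refine Prod.ext hg (Prod.ext ?_ (Units.ext ?_))
    · change 1 * _ = _ * 1
      rw [one_mul, mul_one]
    · exact (hW _ _ hg).symm

lemma cosets_eq_range :
    cosets (xiP D p hpN) = Set.range fun γ : Mp2Z =>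
      Quotient.mk (QuotientGroup.rightRel (Delta D)) (xiP D p hpN * sectionL D γ) := by
  ext x
  constructor
  · rintro ⟨y, hy, rfl⟩
    rw [DoubleCoset.mem_doubleCoset] at hy
    obtain ⟨_, ⟨g, rfl⟩, _, ⟨γ, rfl⟩, rfl⟩ := hy
    refine ⟨γ, Quotient.sound ?_⟩
    change QuotientGroup.rightRel _ _ _
    rw [QuotientGroup.rightRel_apply]
    exact ⟨g, by group⟩
  · rintro ⟨γ, rfl⟩
    refine ⟨_, ?_, rfl⟩
    rw [DoubleCoset.mem_doubleCoset]
    exact ⟨1, one_mem _, _, ⟨γ, rfl⟩, by rw [one_mul]⟩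

/-- A modular form is invariant under `Δ`. -/
lemma slash_sectionL_mul {w : ℤ} {f : ℍ → GroupAlg A} (hf : IsModularForm D w f) (γ : Mp2Z)
    (x : Ambient D) : slash w f (sectionL D γ * x) = slash w f x := by
  funext τ
  have h1 : (sectionL D γ * x).1 = (γ : MpGL) * x.1 := rfl
  have h2 : (sectionL D γ * x).2.2 = (weilRep D).toHomUnits γ * x.2.2 := rfl
  have h3 : (((weilRep D).toHomUnits γ)⁻¹ : (Module.End ℂ (GroupAlg A))ˣ) =
      (weilRep D).toHomUnits γ⁻¹ := (map_inv _ _).symm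
  have h4 : (((weilRep D).toHomUnits γ⁻¹ : (Module.End ℂ (GroupAlg A))ˣ) :
      Module.End ℂ (GroupAlg A)) = weilRep D γ⁻¹ := rfl
  rw [slash, slash, h1, h2, _root_.mul_inv_rev, h3, Units.val_mul, h4, Module.End.mul_apply, MpGL.mul_mat,
    MpGL.mul_φ, map_mul, Mp2Z.det_eq_one, one_mul, mul_smul, hf.transform, map_smul, map_smul,
    ← Module.End.mul_apply (weilRep D γ⁻¹), ← map_mul, inv_mul_cancel, map_one,
    Module.End.one_apply, smul_smul (_ ^ (-w)), mul_zpow, mul_right_comm]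
  congr 2
  have := (γ : MpGL).ne_zero (x.1.mat • τ)
  rw [_root_.zpow_neg, inv_mul_cancel₀ (zpow_ne_zero _ this), one_mul]

lemma slash_out {w : ℤ} {f : ℍ → GroupAlg A} (hf : IsModularForm D w f) (x : Ambient D) :
    slash w f (Quotient.mk (QuotientGroup.rightRel (Delta D)) x).out = slash w f x := by
  have h := Quotient.mk_out (s := QuotientGroup.rightRel (Delta D)) x
  change QuotientGroup.rightRel _ _ _ at h
  rw [QuotientGroup.rightRel_apply] at h
  obtain ⟨γ, hγ⟩ := h
  rw [← slash_sectionL_mul hf γ, hγ, inv_mul_cancel_right]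

/-- The Hecke operator as a sum over a system of representatives of the bottom rows. -/
lemma heckeT_eq_sum (hW : IntertwinesConj D hpN) {ι : Type*} [Fintype ι] {γ : ι → Mp2Z}
    {G : ι → SL(2, ℤ)} (hG : ∀ i, (γ i : MpGL).mat = mapGL ℝ (G i))
    (hinj : ∀ i j, (p : ℤ) ^ 2 ∣ G j 1 0 * G i 1 1 - G j 1 1 * G i 1 0 → i = j)
    (hsurj : ∀ c d : ℤ, IsCoprime c d → ∃ i, (p : ℤ) ^ 2 ∣ c * G i 1 1 - d * G i 1 0) :
    (cosets (xiP D p hpN)).Finite ∧ ∀ {w : ℤ} {f : ℍ → GroupAlg A}, IsModularForm D w f →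
      heckeT w f (xiP D p hpN) =
        ((((matP p).det.val) ^ ((w : ℝ) / 4 - 1) : ℝ) : ℂ) •
          ∑ i, slash w f (xiP D p hpN * sectionL D (γ i)) := by
  have hrange : cosets (xiP D p hpN) = Set.range fun i =>
      Quotient.mk (QuotientGroup.rightRel (Delta D)) (xiP D p hpN * sectionL D (γ i)) := by
    rw [cosets_eq_range]
    refine Set.Subset.antisymm ?_ ?_
    · rintro _ ⟨δ, rfl⟩
      obtain ⟨H, hH⟩ := Mp2Z.exists_mapGL δ
      obtain ⟨i, hi⟩ := hsurj (H 1 0) (H 1 1) (H.isCoprime_row 1)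
      exact ⟨i, (mk_mul_sectionL_eq_iff hW (hG i) hH).mpr hi⟩
    · rintro _ ⟨i, rfl⟩
      exact ⟨γ i, rfl⟩
  refine ⟨hrange ▸ Set.finite_range _, fun {w f} hf => ?_⟩
  rw [heckeT, hrange, finsum_mem_range, finsum_eq_sum_of_fintype]
  · simp only [slash_out hf]
    rfl
  · intro i j hij
    exact hinj i j ((mk_mul_sectionL_eq_iff hW (hG i) (hG j)).mp hij)

end cosets

end

end WeilHecke

/-! ### The action of the representatives -/

namespace WeilHecke

noncomputable section

open Matrix
open Matrix.SpecialLinearGroup (mapGL)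

lemma coe_mpS_inv_smul (τ : ℍ) : (((mpS : MpGL).mat⁻¹ • τ : ℍ) : ℂ) = -1 / τ := by
  have h := coe_mpS_smul ((mpS : MpGL).mat⁻¹ • τ)
  rw [smul_inv_smul] at h
  have h1 := ne_zero ((mpS : MpGL).mat⁻¹ • τ)
  rw [h]
  field_simp

lemma coe_mpT_pow_smul (b : ℕ) (τ : ℍ) :
    ((((mpT ^ b : Mp2Z) : MpGL).mat • τ : ℍ) : ℂ) = τ + b := by
  induction b generalizing τ with
  | zero => simp
  | succ b ih =>
    rw [pow_succ, Subgroup.coe_mul, MpGL.mul_mat, mul_smul, ih, coe_mpT_smul]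
    push_cast; ring

lemma mpT_pow_φ (b : ℕ) (τ : ℍ) : ((mpT ^ b : Mp2Z) : MpGL).φ τ = 1 := by
  induction b generalizing τ with
  | zero => simp
  | succ b ih => rw [pow_succ, Subgroup.coe_mul, MpGL.mul_φ, ih, mpT_φ, one_mul]

lemma sq_mul_cpow_half {c : ℝ} (hc : 0 < c) (z : ℂ) :
    ((c : ℂ) ^ 2 * z) ^ (1 / 2 : ℂ) = c * z ^ (1 / 2 : ℂ) := by
  rcases eq_or_ne z 0 with rfl | hz
  · rw [mul_zero, Complex.zero_cpow (by norm_num), mul_zero]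
  have hc2 : ((c : ℂ) ^ 2 * z) ≠ 0 :=
    mul_ne_zero (pow_ne_zero 2 (Complex.ofReal_ne_zero.mpr hc.ne')) hz
  have h1 : (((Real.log (c ^ 2) : ℝ)) : ℂ) * (1 / 2) = (Real.log c : ℝ) := by
    rw [Real.log_pow]; push_cast; ring
  rw [Complex.cpow_def_of_ne_zero hc2, Complex.cpow_def_of_ne_zero hz, ← Complex.ofReal_pow,
    Complex.log_ofReal_mul (by positivity) hz, add_mul, Complex.exp_add, h1, ← Complex.ofReal_exp,
    Real.exp_log hc]

variable {p : ℕ} [hp : Fact p.Prime]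

lemma matP_det : (matP p).det.val = (p : ℝ) ^ 2 := by
  rw [GeneralLinearGroup.val_det_apply, matP_coe, det_fin_two_of]
  ring

lemma matP_det_rpow (s : ℝ) : (matP p).det.val ^ s = (p : ℝ) ^ (2 * s) := by
  rw [matP_det, ← Real.rpow_natCast, ← Real.rpow_mul (Nat.cast_nonneg p), Nat.cast_ofNat]

section slash

variable {A : Type*} [AddCommGroup A] [Fintype A] {D : DiscriminantForm A}
  {hpN : p.Coprime D.level} {w : ℤ} {f : ℍ → GroupAlg A}

lemma slash_xiP (τ : ℍ) : slash w f (xiP D p hpN * sectionL D 1) τ =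
    (((p : ℝ) ^ ((w : ℝ) / 2) : ℝ) : ℂ) •
      fun x => f (matP p • τ) (D.unitMul (ZMod.unitOfCoprime p hpN)⁻¹ x) := by
  rw [map_one, mul_one, slash]
  change ((((matP p).det.val) ^ ((w : ℝ) / 4) : ℝ) : ℂ) • ((1 : ℂ) ^ (-w)) • (_ : GroupAlg A) = _
  rw [_root_.one_zpow, one_smul, matP_det_rpow,
    show 2 * ((w : ℝ) / 4) = w / 2 by ring]
  rfl

omit hp in
/-- The operator of the Hecke element is conjugate to its inverse under `ρ(S)`. -/
lemma diagOp_mul_weilS_mul_diagOp :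
    (diagOp D (ZMod.unitOfCoprime p hpN) : Module.End ℂ (GroupAlg A)) * (weilS D *
      (diagOp D (ZMod.unitOfCoprime p hpN) : Module.End ℂ (GroupAlg A))) = weilS D := by
  refine LinearMap.ext fun f => funext fun y => ?_
  rw [Module.End.mul_apply, Module.End.mul_apply, diagOp_apply, weilS_apply, weilS_apply]
  congr 1
  refine Fintype.sum_equiv (D.unitMul (ZMod.unitOfCoprime p hpN)) _ _ fun x => ?_
  rw [diagOp_apply, unitMul_apply, bilin_nsmul_right, D.bilin_comm (p • x), bilin_nsmul_right,
    D.bilin_comm y]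

/-- The cosets of `α S T^b`: modulo `Δ` on the left the matrix becomes `(1, b; 0, p²)`. -/
lemma slash_xiP_mul_S_mul_T_pow (hT : weilRep D mpT = weilT D) (hS : weilRep D mpS = weilS D)
    (hf : IsModularForm D w f) {b : ℕ} (hb : D.level ∣ b) (τ : ℍ) :
    ∃ τ' : ℍ, (τ' : ℂ) = (τ + b) / p ^ 2 ∧
      slash w f (xiP D p hpN * sectionL D (mpS * mpT ^ b)) τ =
        (((p : ℝ) ^ (-(w : ℝ) / 2) : ℝ) : ℂ) • fun x => f τ' (p • x) := by
  set x := xiP D p hpN * sectionL D (mpS * mpT ^ b) with hx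
  have hp0 : (p : ℂ) ≠ 0 := Nat.cast_ne_zero.mpr hp.out.ne_zero
  set β : MpGL := (mpS : MpGL)⁻¹ * (alphaP p * (mpS * (mpT ^ b : Mp2Z))) with hβ
  have h1 : (sectionL D mpS⁻¹ * x).1 = β := rfl
  have hTb : weilRep D (mpT ^ b) = 1 := by
    refine LinearMap.ext fun g => funext fun y => ?_
    obtain ⟨c, rfl⟩ := hb
    rw [weilRep_T_pow hT, mul_comm D.level c, mul_smul, level_nsmul_q, smul_zero, e_zero, one_mul]
    rfl
  have h2 : (sectionL D mpS⁻¹ * x).2.2 = (diagOp D (ZMod.unitOfCoprime p hpN))⁻¹ := by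
    rw [eq_inv_iff_mul_eq_one]
    refine Units.ext ?_
    change weilRep D mpS⁻¹ * ((diagOp D (ZMod.unitOfCoprime p hpN) : Module.End ℂ (GroupAlg A)) *
      weilRep D (mpS * mpT ^ b)) * (diagOp D (ZMod.unitOfCoprime p hpN) :
        Module.End ℂ (GroupAlg A)) = 1
    rw [map_mul, hTb, mul_one, hS, mul_assoc, mul_assoc, diagOp_mul_weilS_mul_diagOp, ← hS,
      ← map_mul, inv_mul_cancel, map_one]
  have hsm : ((β.mat • τ : ℍ) : ℂ) = (τ + b) / p ^ 2 := by
    have hne := ne_zero (((mpT ^ b : Mp2Z) : MpGL).mat • τ)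
    rw [coe_mpT_pow_smul] at hne
    rw [hβ, MpGL.mul_mat, MpGL.mul_mat, MpGL.mul_mat, mul_smul, mul_smul, mul_smul, MpGL.inv_mat,
      coe_mpS_inv_smul, alphaP_mat, coe_matP_smul, coe_mpS_smul, coe_mpT_pow_smul]
    field_simp
  have hφ : β.φ τ = p := by
    have hne := ne_zero (β.mat • τ)
    have h3 : β.φ τ = ((mpS : MpGL).φ (β.mat • τ))⁻¹ *
        (mpS : MpGL).φ (((mpT ^ b : Mp2Z) : MpGL).mat • τ) := by
      rw [hβ, MpGL.mul_φ, MpGL.mul_φ, MpGL.mul_φ, alphaP_φ, mpT_pow_φ, one_mul, mul_one,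
        MpGL.inv_φ]
      simp only [MpGL.mul_mat, MpGL.inv_mat, mul_smul]
    rw [h3, mpS_φ, mpS_φ, hsm, coe_mpT_pow_smul]
    rw [hsm] at hne
    have h4 := sq_mul_cpow_half (c := p) (Nat.cast_pos.mpr hp.out.pos) ((τ + b) / p ^ 2)
    rw [Complex.ofReal_natCast, mul_div_cancel₀ _ (pow_ne_zero 2 hp0)] at h4
    rw [h4]
    have h5 : ((τ + b) / p ^ 2 : ℂ) ^ (1 / 2 : ℂ) ≠ 0 := by
      rw [Ne, Complex.cpow_eq_zero_iff]; tauto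
    field_simp
  have hdet : β.mat.det = (matP p).det := by
    rw [hβ]
    simp only [MpGL.mul_mat, MpGL.inv_mat, map_mul, map_inv, Mp2Z.det_eq_one, alphaP_mat]
    simp
  refine ⟨β.mat • τ, hsm, ?_⟩
  rw [← slash_sectionL_mul hf mpS⁻¹, slash, h1, h2, inv_inv, hφ, hdet, matP_det_rpow, smul_smul]
  congr 1
  · rw [← Complex.ofReal_natCast, ← Complex.ofReal_zpow, ← Complex.ofReal_mul,
      ← Real.rpow_intCast, ← Real.rpow_add (Nat.cast_pos.mpr hp.out.pos)]
    congr 2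
    push_cast
    ring
  · funext x
    rw [diagOp_apply]

lemma exists_translation (h : ℤ) : ∃ β : MpGL,
    (β.mat : Matrix (Fin 2) (Fin 2) ℝ) = !![(p : ℝ), h; 0, p] ∧
      ∀ τ, β.φ τ = (Real.sqrt p : ℝ) := by
  have hp0 : (p : ℝ) ≠ 0 := Nat.cast_ne_zero.mpr hp.out.ne_zero
  refine ⟨⟨GeneralLinearGroup.mkOfDetNeZero !![(p : ℝ), h; 0, p] (by
    rw [det_fin_two_of, mul_zero, sub_zero]; exact mul_ne_zero hp0 hp0),
    fun _ => (Real.sqrt p : ℝ), ?_, mdifferentiable_const, fun τ => ?_⟩, rfl, fun _ => rfl⟩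
  · rw [GeneralLinearGroup.val_det_apply]
    change 0 < det !![(p : ℝ), h; 0, p]
    rw [det_fin_two_of, mul_zero, sub_zero]
    positivity
  · rw [← Complex.ofReal_pow, Real.sq_sqrt (Nat.cast_nonneg p)]
    simp [denom, GeneralLinearGroup.mkOfDetNeZero]

/-- For `γ` with bottom row `(p, h)`, the matrix `αγ` is equivalent to `(p, h; 0, p)`. If the
operator attached to it is the scalar `t⁻¹`, the coset acts by a translation. -/
lemma slash_xiP_mul (hf : IsModularForm D w f) {γ : Mp2Z} {G : SL(2, ℤ)}
    (hG : (γ : MpGL).mat = mapGL ℝ G) {h : ℤ} (hc : G 1 0 = p) (hd : G 1 1 = h) {t : ℂ}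
    (ht : ∀ (γ' : Mp2Z) (β : MpGL), (∀ τ, β.φ τ = (Real.sqrt p : ℝ)) →
      (β.mat : Matrix (Fin 2) (Fin 2) ℝ) = !![(p : ℝ), h; 0, p] → alphaP p * γ = γ' * β →
      t • ((diagOp D (ZMod.unitOfCoprime p hpN) : Module.End ℂ (GroupAlg A)) * weilRep D γ) =
        weilRep D γ') (τ : ℍ) :
    ∃ τ' : ℍ, (τ' : ℂ) = τ + h / p ∧ slash w f (xiP D p hpN * sectionL D γ) τ = t • f τ' := by
  have hp0 : (p : ℂ) ≠ 0 := Nat.cast_ne_zero.mpr hp.out.ne_zero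
  obtain ⟨β, hβ, hφ⟩ := exists_translation (p := p) h
  have hdetG : G 0 0 * G 1 1 - G 0 1 * G 1 0 = 1 := by
    have := G.det_coe
    rwa [det_fin_two] at this
  rw [hc, hd] at hdetG
  let H : SL(2, ℤ) := ⟨!![p * G 0 0, -1; 1, 0], by rw [det_fin_two_of]; ring⟩
  have hH : mapGL ℝ H * β.mat = matP p * mapGL ℝ G := by
    have h0 : ((G 0 0 : ℤ) : ℝ) * h - G 0 1 * p = 1 := by exact_mod_cast hdetG
    ext i j
    rw [Units.val_mul, Units.val_mul, Matrix.mul_apply, Matrix.mul_apply]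
    simp only [Fin.sum_univ_two, mapGL_apply, matP_apply, hβ]
    fin_cases i <;> fin_cases j <;> simp [H, hc, hd]
    · ring
    · linear_combination (p : ℝ) * h0
  obtain ⟨γ', hγ'⟩ : ∃ γ' : Mp2Z, (γ' : MpGL) = alphaP p * γ * β⁻¹ := by
    refine ⟨⟨_, H, ?_⟩, rfl⟩
    change mapGL ℝ H = matP p * (γ : MpGL).mat * β.mat⁻¹
    rw [hG, ← hH, mul_inv_cancel_right]
  have hγβ : alphaP p * γ = γ' * β := by rw [hγ', inv_mul_cancel_right]
  have ht' := ht γ' β hφ hβ hγβ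
  have ht0 : t ≠ 0 := by
    rintro rfl
    rw [zero_smul] at ht'
    exact weilRep_ne_zero γ' ht'.symm
  have hdet : β.mat.det.val = (matP p).det.val := by
    rw [matP_det, GeneralLinearGroup.val_det_apply, hβ, det_fin_two_of]
    ring
  have hβpos : 0 < β.mat.det.val := β.det_pos
  have hsm : ((β.mat • τ : ℍ) : ℂ) = τ + h / p := by
    rw [coe_smul_of_det_pos hβpos, num, denom, hβ]
    simp
    field_simp
  have h1 : (sectionL D γ'⁻¹ * (xiP D p hpN * sectionL D γ)).1 = β := by
    change (γ' : MpGL)⁻¹ * (alphaP p * γ) = β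
    rw [hγβ, inv_mul_cancel_left]
  have h2 : ((((sectionL D γ'⁻¹ * (xiP D p hpN * sectionL D γ)).2.2)⁻¹ :
      (Module.End ℂ (GroupAlg A))ˣ) : Module.End ℂ (GroupAlg A)) = t • 1 := by
    refine Units.inv_eq_of_mul_eq_one_right ?_
    change weilRep D γ'⁻¹ * ((diagOp D (ZMod.unitOfCoprime p hpN) : Module.End ℂ (GroupAlg A)) *
      weilRep D γ) * t • 1 = 1
    rw [mul_smul_comm, mul_one, ← mul_smul_comm, ht', ← map_mul, inv_mul_cancel, map_one]
  refine ⟨β.mat • τ, hsm, ?_⟩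
  rw [← slash_sectionL_mul hf γ'⁻¹, slash, h1, h2, hφ, hdet, matP_det_rpow, smul_smul,
    LinearMap.smul_apply, Module.End.one_apply]
  have h3 : ((((p : ℝ) ^ (2 * ((w : ℝ) / 4)) : ℝ) : ℂ) * (Real.sqrt p : ℝ) ^ (-w)) = 1 := by
    have hpp : (0 : ℝ) < p := Nat.cast_pos.mpr hp.out.pos
    rw [← Complex.ofReal_zpow, ← Complex.ofReal_mul, Real.sqrt_eq_rpow, ← Real.rpow_intCast,
      ← Real.rpow_mul hpp.le, ← Real.rpow_add hpp]
    rw [show 2 * ((w : ℝ) / 4) + 1 / 2 * ((-w : ℤ) : ℝ) = 0 by push_cast; ring, Real.rpow_zero,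
      Complex.ofReal_one]
  rw [h3, one_smul]

end slash

end

end WeilHecke

namespace WeilHecke

noncomputable section

open Matrix
open Matrix.SpecialLinearGroup (mapGL)

variable {p : ℕ} [hp : Fact p.Prime] {A : Type*} [AddCommGroup A] [Fintype A]
  {D : DiscriminantForm A} {hpN : p.Coprime D.level}

lemma isCoprime_sq_of_not_dvd {p : ℕ} [hp : Fact p.Prime] {c : ℤ} (h : ¬ (p : ℤ) ∣ c) :
    IsCoprime ((p : ℤ) ^ 2) c :=
  ((Nat.prime_iff_prime_int.mp hp.out).coprime_iff_not_dvd.mpr h).pow_left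

lemma exists_zmod_sub_dvd (m : ℕ) [NeZero m] {c : ℤ} (h : IsCoprime (m : ℤ) c) (d : ℤ) :
    ∃ j : ZMod m, (m : ℤ) ∣ c * j.val - d := by
  obtain ⟨u, v, huv⟩ := h
  refine ⟨((v * d : ℤ) : ZMod m), ?_⟩
  rw [← ZMod.intCast_zmod_eq_zero_iff_dvd]
  push_cast
  rw [ZMod.natCast_zmod_val]
  have h1 := congrArg (Int.cast : ℤ → ZMod m) huv
  push_cast at h1
  rw [ZMod.natCast_self, mul_zero, zero_add] at h1
  linear_combination (d : ZMod m) * h1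

lemma zmod_eq_of_dvd_mul_sub {m : ℕ} [NeZero m] {c : ℤ} (h : IsCoprime (m : ℤ) c) {i j : ZMod m}
    (hij : (m : ℤ) ∣ c * ((i.val : ℤ) - j.val)) : i = j := by
  have h1 := h.dvd_of_dvd_mul_left hij
  rw [← ZMod.intCast_zmod_eq_zero_iff_dvd] at h1
  push_cast at h1
  rw [ZMod.natCast_zmod_val, ZMod.natCast_zmod_val, sub_eq_zero] at h1
  exact h1

/-- The points of the projective line over `ℤ/p²` are represented by the rows `(0, 1)`, `(1, N j)`
with `j` modulo `p²`, and `(p, N' u)` with `u` a unit modulo `p`. -/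
lemma exists_representatives (hW : IntertwinesConj D hpN) {N N' : ℕ} (hN : ¬ p ∣ N)
    (hN' : ¬ p ∣ N') : ∃ (γ : (ZMod p)ˣ → Mp2Z) (G : (ZMod p)ˣ → SL(2, ℤ)),
      (∀ u, (γ u : MpGL).mat = mapGL ℝ (G u)) ∧ (∀ u, G u 1 0 = p) ∧
      (∀ u, G u 1 1 = N' * (u : ZMod p).val) ∧ (cosets (xiP D p hpN)).Finite ∧
      ∀ {w : ℤ} {f : ℍ → GroupAlg A}, IsModularForm D w f → heckeT w f (xiP D p hpN) =
        ((((matP p).det.val) ^ ((w : ℝ) / 4 - 1) : ℝ) : ℂ) •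
          (slash w f (xiP D p hpN * sectionL D 1) +
            ∑ j : ZMod (p ^ 2), slash w f (xiP D p hpN * sectionL D (mpS * mpT ^ (N * j.val))) +
            ∑ u, slash w f (xiP D p hpN * sectionL D (γ u))) := by
  have hpp := Nat.prime_iff_prime_int.mp hp.out
  have : NeZero (p ^ 2) := ⟨pow_ne_zero 2 hp.out.ne_zero⟩
  have hNZ : ¬ (p : ℤ) ∣ N := by rwa [Int.natCast_dvd_natCast]
  have hNZ' : ¬ (p : ℤ) ∣ N' := by rwa [Int.natCast_dvd_natCast]
  have hu : ∀ u : (ZMod p)ˣ, ¬ (p : ℤ) ∣ (u : ZMod p).val := fun u h => by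
    rw [Int.natCast_dvd_natCast, ← ZMod.natCast_eq_zero_iff, ZMod.natCast_zmod_val] at h
    exact u.ne_zero h
  have hNu : ∀ u : (ZMod p)ˣ, ¬ (p : ℤ) ∣ N' * (u : ZMod p).val := fun u h =>
    (hpp.dvd_or_dvd h).elim hNZ' (hu u)
  have hrow : ∀ u : (ZMod p)ˣ, ∃ G : SL(2, ℤ), G 1 0 = p ∧ G 1 1 = N' * (u : ZMod p).val := fun u =>
    IsCoprime.exists_SL2_row (hpp.coprime_iff_not_dvd.mpr (hNu u)) 1
  choose G hG0 hG1 using hrow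
  choose γ hγ using fun u => exists_mp2Z (G u)
  have hp2 : ¬ (p : ℤ) ^ 2 ∣ 1 := fun h => hpp.not_dvd_one (dvd_trans (dvd_pow_self _ two_ne_zero) h)
  have hp1 : ¬ (p : ℤ) ^ 2 ∣ p := fun h => by
    rw [sq] at h
    exact hpp.not_dvd_one ((mul_dvd_mul_iff_left hpp.ne_zero).mp (by rwa [mul_one]))
  let γ' : Option (ZMod (p ^ 2)) ⊕ (ZMod p)ˣ → Mp2Z :=
    Sum.elim (fun o => o.elim 1 fun j => mpS * mpT ^ (N * j.val)) γ
  let G' : Option (ZMod (p ^ 2)) ⊕ (ZMod p)ˣ → SL(2, ℤ) :=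
    Sum.elim (fun o => o.elim 1 fun j => ModularGroup.S * ModularGroup.T ^ (N * j.val)) G
  have hmat : ∀ i, (γ' i : MpGL).mat = mapGL ℝ (G' i) := by
    rintro ((_ | j) | u)
    · simp [γ', G']
    · have h : ((mpT ^ (N * j.val) : Mp2Z) : MpGL).mat = mapGL ℝ (ModularGroup.T ^ (N * j.val)) := by
        change MpGL.proj _ = _
        rw [SubmonoidClass.coe_pow, map_pow, map_pow]
        rfl
      change (mpS : MpGL).mat * _ = mapGL ℝ (ModularGroup.S * ModularGroup.T ^ (N * j.val))
      rw [map_mul, ← h, mpS_mat]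
    · exact hγ u
  have row0 : G' (Sum.inl none) 1 0 = 0 ∧ G' (Sum.inl none) 1 1 = 1 := ⟨rfl, rfl⟩
  have row1 : ∀ j : ZMod (p ^ 2), G' (Sum.inl (some j)) 1 0 = 1 ∧
      G' (Sum.inl (some j)) 1 1 = N * j.val := fun j => by
    have hmul : ∀ X Y : SL(2, ℤ), (X * Y).1 = X.1 * Y.1 := fun _ _ => rfl
    have h : (G' (Sum.inl (some j))).1 = !![0, -1; 1, ((N * j.val : ℕ) : ℤ)] := by
      change (ModularGroup.S * ModularGroup.T ^ (N * j.val)).1 = _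
      rw [hmul, coe_T_pow, show (ModularGroup.S).1 = !![0, -1; 1, 0] from rfl]
      simp
    constructor
    · rw [h]; rfl
    · rw [h]; push_cast; rfl
  have row2 : ∀ u, G' (Sum.inr u) 1 0 = p ∧ G' (Sum.inr u) 1 1 = N' * (u : ZMod p).val :=
    fun u => ⟨hG0 u, hG1 u⟩
  have hpsq : (p : ℤ) ∣ (p : ℤ) ^ 2 := dvd_pow_self _ two_ne_zero
  obtain ⟨hfin, hsum⟩ := heckeT_eq_sum hW hmat (by
    rintro ((_ | i) | u) ((_ | j) | v) h
    · rfl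
    · rw [(row1 j).1, (row1 j).2, row0.1, row0.2] at h
      exact absurd (by simpa using h) hp2
    · rw [(row2 v).1, (row2 v).2, row0.1, row0.2] at h
      exact absurd (by simpa using h) hp1
    · rw [(row1 i).1, (row1 i).2, row0.1, row0.2] at h
      exact absurd (by simpa using h) hp2
    · rw [(row1 i).1, (row1 i).2, (row1 j).1, (row1 j).2] at h
      congr 2
      apply zmod_eq_of_dvd_mul_sub (c := N)
      · push_cast; exact isCoprime_sq_of_not_dvd hNZ
      · push_cast
        rwa [one_mul, mul_one, ← mul_sub] at h
    · rw [(row1 i).1, (row1 i).2, (row2 v).1, (row2 v).2, mul_one] at h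
      exact absurd ((dvd_sub_right (dvd_mul_right _ _)).mp (dvd_trans hpsq h)) (hNu v)
    · rw [(row2 u).1, (row2 u).2, row0.1, row0.2] at h
      exact absurd (by simpa using h) hp1
    · rw [(row1 j).1, (row1 j).2, (row2 u).1, (row2 u).2, one_mul] at h
      exact absurd ((dvd_sub_left (dvd_mul_left _ _)).mp (dvd_trans hpsq h)) (hNu u)
    · rw [(row2 u).1, (row2 u).2, (row2 v).1, (row2 v).2, sq, mul_comm (_ * _) (p : ℤ), ← mul_sub,
        mul_dvd_mul_iff_left hpp.ne_zero] at h
      congr 1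
      refine Units.ext (zmod_eq_of_dvd_mul_sub (c := N') (hpp.coprime_iff_not_dvd.mpr hNZ') ?_)
      rwa [← mul_sub] at h) (by
    intro c d hcd
    by_cases hc : (p : ℤ) ∣ c
    · have hd : ¬ (p : ℤ) ∣ d := fun hd => hpp.not_isUnit (hcd.isUnit_of_dvd' hc hd)
      obtain ⟨c₀, rfl⟩ := hc
      by_cases hc₀ : (p : ℤ) ∣ c₀
      · refine ⟨Sum.inl none, ?_⟩
        rw [row0.1, row0.2, mul_zero, sub_zero, mul_one, sq]
        exact mul_dvd_mul_left _ hc₀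
      · have hcop : IsCoprime (p : ℤ) (c₀ * N') :=
          hpp.coprime_iff_not_dvd.mpr fun h => (hpp.dvd_or_dvd h).elim hc₀ hNZ'
        obtain ⟨j, hj⟩ := exists_zmod_sub_dvd p hcop d
        have hj0 : j ≠ 0 := by
          rintro rfl
          rw [ZMod.val_zero, Nat.cast_zero, mul_zero, zero_sub, dvd_neg] at hj
          exact hd hj
        refine ⟨Sum.inr (Units.mk0 j hj0), ?_⟩
        rw [(row2 _).1, (row2 _).2, sq, Units.val_mk0, mul_comm d, mul_assoc, ← mul_sub,
          ← mul_assoc c₀]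
        exact mul_dvd_mul_left _ hj
    · have hcop : IsCoprime (((p ^ 2 : ℕ) : ℤ)) (c * N) := by
        push_cast
        exact isCoprime_sq_of_not_dvd fun h => (hpp.dvd_or_dvd h).elim hc hNZ
      obtain ⟨j, hj⟩ := exists_zmod_sub_dvd (p ^ 2) hcop d
      refine ⟨Sum.inl (some j), ?_⟩
      rw [(row1 _).1, (row1 _).2, mul_one, ← mul_assoc]
      push_cast at hj
      exact hj)
  refine ⟨γ, G, hγ, hG0, hG1, hfin, fun {w f} hf => ?_⟩
  rw [hsum hf, Fintype.sum_sum_type, Fintype.sum_option]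
  rfl

end

end WeilHecke

/-! ### Fourier expansions -/

namespace WeilHecke

noncomputable section

variable {A : Type*} [AddCommGroup A] [Fintype A] {D : DiscriminantForm A}

omit [Fintype A] in
lemma isExponent_iff {x : A} {n₀ n : ℚ} (h₀ : IsExponent D x n₀) :
    IsExponent D x n ↔ ∃ m : ℤ, n = n₀ + m := by
  rw [IsExponent, ← show (n₀ : QModZ) = D.q x from h₀, qmodz_coe_eq_coe_iff]

omit [Fintype A] in
/-- Every class in `ℚ/ℤ` has a representative `n₀ ≤ 0`. -/
lemma exists_exponent (D : DiscriminantForm A) (x : A) : ∃ n₀ : ℚ, IsExponent D x n₀ ∧ n₀ ≤ 0 := by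
  obtain ⟨n, hn⟩ := QuotientAddGroup.mk_surjective (D.q x)
  refine ⟨n - ⌈n⌉, ?_, by have := Int.le_ceil n; linarith⟩
  rw [IsExponent, ← hn]
  exact qmodz_coe_eq_coe_iff.mpr ⟨-⌈n⌉, by push_cast; ring⟩

omit [Fintype A] in
lemma isFourierExpansion_unique {f : ℍ → GroupAlg A} {c c' : A → ℚ → ℂ}
    (h : IsFourierExpansion D f c) (h' : IsFourierExpansion D f c') : c = c' := by
  funext x n
  by_cases hn : IsExponent D x n
  swap
  · rw [h.support x n hn, h'.support x n hn]
  have hinj : Function.Injective fun m : ℤ => n + m := fun a b hab => by simpa using hab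
  -- on the line `im τ = 1` the difference of the two expansions is a Fourier series
  have key := fourier_coeff_eq_zero
    (c := fun m : ℤ => (c x (n + m) - c' x (n + m)) * Complex.exp (-(2 * Real.pi * m))) fun t => by
      let τ : ℍ := ⟨⟨t, 1⟩, one_pos⟩
      have hτ : (τ : ℂ) = t + Complex.I := by
        apply Complex.ext <;> simp [τ]
      have h1 := (h.hasSum τ x).sub (h'.hasSum τ x)
      rw [sub_self, ← hinj.hasSum_iff] at h1
      · have h2 := h1.mul_left (Complex.exp (-(2 * Real.pi * Complex.I * (n * (τ : ℂ)))))
        rw [mul_zero] at h2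
        refine h2.congr_fun fun m => ?_
        simp only [Function.comp_apply]
        rw [mul_assoc, ← Complex.exp_add, ← sub_mul, mul_left_comm (Complex.exp _),
          ← Complex.exp_add, hτ]
        congr 2
        push_cast
        ring_nf
        rw [Complex.I_sq]
        ring
      · intro k hk
        have hk' : ¬ IsExponent D x k := fun H => by
          obtain ⟨m, hm⟩ := (isExponent_iff hn).mp H
          exact hk ⟨m, hm.symm⟩
        rw [h.support x k hk', h'.support x k hk']
        simp
  have h3 := congrFun key 0
  simp only [Int.cast_zero, add_zero, Pi.zero_apply, mul_eq_zero, Complex.exp_ne_zero, or_false,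
    sub_eq_zero] at h3
  exact h3

/-- A modular form has a Fourier expansion: for a representative `n₀ ≤ 0` of `λ²/2` the function
`e(-n₀τ) f_λ(τ)` has period one and is bounded at infinity. -/
lemma exists_isFourierExpansion (hT : weilRep D mpT = weilT D) {w : ℤ} {f : ℍ → GroupAlg A}
    (hf : IsModularForm D w f) : ∃ c, IsFourierExpansion D f c := by
  have hper : ∀ (τ : ℍ) (x : A), f ((mpT : MpGL).mat • τ) x = e (D.q x) * f τ x := fun τ x => by
    rw [hf.transform, mpT_φ, one_zpow, one_smul, hT]
    rfl
  have key : ∀ x : A, ∃ (n₀ : ℚ) (a : ℕ → ℂ), IsExponent D x n₀ ∧ ∀ τ : ℍ,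
      HasSum (fun m : ℕ => a m * Complex.exp (2 * Real.pi * Complex.I * ((n₀ + m : ℚ) * (τ : ℂ))))
        (f τ x) := by
    intro x
    obtain ⟨n₀, hn₀, hle⟩ := exists_exponent D x
    let g : ℍ → ℂ := fun τ => Complex.exp (-(2 * Real.pi * Complex.I * (n₀ * (τ : ℂ)))) * f τ x
    have hgT : ∀ τ : ℍ, g ((mpT : MpGL).mat • τ) = g τ := fun τ => by
      simp only [g]
      rw [hper, coe_mpT_smul, ← show (n₀ : QModZ) = D.q x from hn₀, e_coe, ← mul_assoc,
        ← Complex.exp_add]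
      congr 2
      ring
    have hgper : Function.Periodic (g ∘ ofComplex) (1 : ℝ) := fun z => by
      simp only [Function.comp_apply]
      by_cases hz : 0 < z.im
      · have hz' : 0 < (z + (1 : ℝ)).im := by simpa using hz
        rw [ofComplex_apply_of_im_pos hz, ofComplex_apply_of_im_pos hz', ← hgT ⟨z, hz⟩]
        congr 1
        apply UpperHalfPlane.ext
        rw [coe_mpT_smul]
        simp
      · have hz' : (z + (1 : ℝ)).im ≤ 0 := by simpa using hz
        rw [ofComplex_apply_of_im_nonpos hz', ofComplex_apply_of_im_nonpos (not_lt.mp hz)]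
    have hgholo : MDiff g := by
      refine MDifferentiable.mul ?_ (hf.holo x)
      rw [UpperHalfPlane.mdifferentiable_iff]
      have h : DifferentiableOn ℂ
          (fun z : ℂ => Complex.exp (-(2 * Real.pi * Complex.I * (n₀ * z)))) {z | 0 < z.im} := by
        fun_prop
      exact h.congr fun z hz => by simp [ofComplex_apply_of_im_pos hz]
    have hgbdd : IsBoundedAtImInfty g := by
      obtain ⟨M, B, hMB⟩ := isBoundedAtImInfty_iff.mp (hf.bounded x)
      refine isBoundedAtImInfty_iff.mpr ⟨M, B, fun τ hτ => ?_⟩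
      have h1 : ‖Complex.exp (-(2 * Real.pi * Complex.I * (n₀ * (τ : ℂ))))‖ ≤ 1 := by
        rw [Complex.norm_exp, Real.exp_le_one_iff]
        have h2 : (-(2 * Real.pi * Complex.I * (n₀ * (τ : ℂ)))).re = 2 * Real.pi * n₀ * τ.im := by
          simp
          ring
        rw [h2]
        have h3 : (n₀ : ℝ) ≤ 0 := by exact_mod_cast hle
        have h4 := mul_pos Real.two_pi_pos τ.im_pos
        nlinarith
      calc ‖g τ‖ ≤ 1 * ‖f τ x‖ := by
            rw [norm_mul]; exact mul_le_mul_of_nonneg_right h1 (norm_nonneg _)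
        _ ≤ M := by rw [one_mul]; exact hMB τ hτ
    refine ⟨n₀, fun m => (qExpansion 1 g).coeff m, hn₀, fun τ => ?_⟩
    have h1 := (hasSum_qExpansion one_pos hgper hgholo hgbdd τ).mul_left
      (Complex.exp (2 * Real.pi * Complex.I * (n₀ * (τ : ℂ))))
    have h2 : Complex.exp (2 * Real.pi * Complex.I * (n₀ * (τ : ℂ))) * g τ = f τ x := by
      simp only [g]
      rw [← mul_assoc, ← Complex.exp_add, add_neg_cancel, Complex.exp_zero, one_mul]
    rw [h2] at h1
    refine h1.congr_fun fun m => ?_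
    rw [smul_eq_mul, mul_left_comm (Complex.exp _), Function.Periodic.qParam, ← Complex.exp_nat_mul,
      ← Complex.exp_add]
    congr 2
    push_cast
    ring
  choose n₀ a hn₀ ha using key
  have hinj : ∀ x, Function.Injective fun m : ℕ => n₀ x + m := fun x i j hij => by simpa using hij
  refine ⟨fun x => Function.extend (fun m : ℕ => n₀ x + m) (a x) 0, fun x n hn => ?_, fun τ x => ?_⟩
  · refine Function.extend_apply' _ _ _ ?_
    rintro ⟨m, rfl⟩
    exact hn ((isExponent_iff (hn₀ x)).mpr ⟨m, by push_cast; rfl⟩)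
  · rw [← (hinj x).hasSum_iff]
    · refine (ha x τ).congr_fun fun m => ?_
      simp only [Function.comp_apply]
      rw [(hinj x).extend_apply]
    · intro n hn
      rw [Function.extend_apply' _ _ _ (fun ⟨m, hm⟩ => hn ⟨m, hm⟩)]
      simp

end

end WeilHecke

/-! ### Quadratic Gauss sums and reciprocity -/

namespace WeilHecke

noncomputable section

variable {p : ℕ} [hp : Fact p.Prime]

/-- The complex-valued quadratic character modulo `p`. -/
def chiP (p : ℕ) [Fact p.Prime] : MulChar (ZMod p) ℂ :=
  (quadraticChar (ZMod p)).ringHomComp (Int.castRingHom ℂ)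

lemma chiP_apply (u : ZMod p) : chiP p u = (quadraticChar (ZMod p) u : ℂ) := rfl

/-- The Gauss sum of the quadratic character. -/
def gaussQ (p : ℕ) [Fact p.Prime] : ℂ := gaussSum (chiP p) ZMod.stdAddChar

lemma ringChar_ne_two (hp2 : p ≠ 2) : ringChar (ZMod p) ≠ 2 := by
  rwa [ZMod.ringChar_zmod_n]

lemma chiP_ne_one (hp2 : p ≠ 2) : chiP p ≠ 1 := by
  obtain ⟨a, ha⟩ := quadraticChar_exists_neg_one (ringChar_ne_two hp2)
  intro h
  have h1 : chiP p a = -1 := by rw [chiP_apply, ha]; simp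
  have ha0 : a ≠ 0 := by rintro rfl; simp at ha
  rw [h, MulChar.one_apply (isUnit_iff_ne_zero.mpr ha0)] at h1
  norm_num at h1

lemma chiP_mul_self {u : ZMod p} (hu : u ≠ 0) : chiP p u * chiP p u = 1 := by
  rw [← map_mul, ← sq, chiP_apply, quadraticChar_sq_one' hu, Int.cast_one]

lemma sum_chiP_mul_stdAddChar (hp2 : p ≠ 2) (u : ZMod p) :
    ∑ y, chiP p y * ZMod.stdAddChar (u * y) = chiP p u * gaussQ p := by
  rcases eq_or_ne u 0 with rfl | hu
  · rw [MulChar.map_zero, zero_mul]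
    simp only [zero_mul, AddChar.map_zero_eq_one, mul_one]
    exact MulChar.sum_eq_zero_of_ne_one (chiP_ne_one hp2)
  · have h := gaussSum_mulShift (chiP p) ZMod.stdAddChar (Units.mk0 u hu)
    rw [Units.val_mk0] at h
    rw [gaussQ, ← h, ← mul_assoc, chiP_mul_self hu, one_mul]
    rfl

/-- There are `1 + χ(y)` square roots of `y`. -/
lemma gaussP_eq (hp2 : p ≠ 2) {u : ZMod p} (hu : u ≠ 0) : gaussP p u = chiP p u * gaussQ p := by
  have h1 : ∀ y : ZMod p, ((Finset.univ.filter fun x : ZMod p => x ^ 2 = y).card : ℂ) =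
      chiP p y + 1 := fun y => by
    have := quadraticChar_card_sqrts (ringChar_ne_two hp2) y
    have h2 : ((Finset.univ.filter fun x : ZMod p => x ^ 2 = y).card : ℤ) =
        quadraticChar (ZMod p) y + 1 := by
      rw [← this]
      congr 2
      ext x
      simp
    rw [chiP_apply]
    exact_mod_cast h2
  have h3 : ∑ y : ZMod p, (ZMod.stdAddChar (u * y) : ℂ) = 0 := by
    have h4 := AddChar.sum_mulShift (R' := ℂ) u (ZMod.isPrimitive_stdAddChar p)
    rw [if_neg hu] at h4
    rw [Nat.cast_zero] at h4
    rw [← h4]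
    exact Finset.sum_congr rfl fun y _ => by rw [mul_comm]
  rw [gaussP, ← sum_chiP_mul_stdAddChar hp2,
    ← Finset.sum_fiberwise (s := Finset.univ) (g := fun x : ZMod p => x ^ 2)]
  have h5 : ∀ y : ZMod p, ∑ x ∈ Finset.univ.filter (fun x : ZMod p => x ^ 2 = y),
      (ZMod.stdAddChar (u * x ^ 2) : ℂ) = (chiP p y + 1) * ZMod.stdAddChar (u * y) := fun y => by
    rw [← h1, Finset.sum_congr rfl fun x hx => by rw [(Finset.mem_filter.mp hx).2],
      Finset.sum_const, nsmul_eq_mul]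
  rw [Finset.sum_congr rfl fun y _ => h5 y]
  simp only [add_mul, one_mul]
  rw [Finset.sum_add_distrib, h3, add_zero]

lemma gaussQ_sq (hp2 : p ≠ 2) : gaussQ p ^ 2 = chiP p (-1) * p := by
  have hq : (chiP p).IsQuadratic :=
    (quadraticChar_isQuadratic (ZMod p)).comp (Int.castRingHom ℂ)
  have h := gaussSum_sq (chiP_ne_one hp2) hq (ZMod.isPrimitive_stdAddChar p)
  rw [ZMod.card] at h
  exact h

lemma chiP_neg_one (hp2 : p ≠ 2) : chiP p (-1) = epsilon p ^ 2 := by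
  have h := legendreSym.at_neg_one hp2
  have h1 : chiP p (-1) = (ZMod.χ₄ p : ℂ) := by
    rw [← h, legendreSym, chiP_apply, Int.cast_neg, Int.cast_one]
  have hodd : p % 2 = 1 := hp.out.eq_two_or_odd.resolve_left hp2
  rw [h1, epsilon, ZMod.χ₄_nat_eq_if_mod_four, if_neg (by omega)]
  split_ifs <;> simp

omit hp in
lemma epsilon_ne_zero : epsilon p ≠ 0 := by
  rw [epsilon]; split_ifs <;> simp

omit hp in
lemma epsilon_pow_four : epsilon p ^ 4 = 1 := by
  rw [epsilon]; split_ifs <;> simp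

lemma epsilon_mul_chiP_sign (hp2 : p ≠ 2) {a : ℤ} (ha : a ≠ 0) :
    epsilon p * chiP p (a.sign : ℤ) = epsilon p ^ a.sign := by
  rcases ha.lt_or_gt with h | h
  · rw [Int.sign_eq_neg_one_of_neg h, Int.cast_neg, Int.cast_one, chiP_neg_one hp2, zpow_neg_one,
      ← mul_right_inj' (epsilon_ne_zero (p := p)), mul_inv_cancel₀ epsilon_ne_zero,
      ← epsilon_pow_four (p := p)]
    ring
  · rw [Int.sign_eq_one_of_pos h, Int.cast_one, map_one, mul_one, zpow_one]

omit hp in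
lemma epsilon_zpow_sum {ι : Type*} (s : Finset ι) (a : ι → ℤ) :
    epsilon p ^ (∑ i ∈ s, a i) = ∏ i ∈ s, epsilon p ^ a i := by
  classical
  induction s using Finset.induction_on with
  | empty => simp
  | insert i s hi ih => rw [Finset.sum_insert hi, Finset.prod_insert hi, zpow_add₀ epsilon_ne_zero, ih]

omit hp in
lemma epsilon_zpow_congr {s t : ℤ} (h : (s : ZMod 8) = t) : epsilon p ^ s = epsilon p ^ t := by
  rw [ZMod.intCast_eq_intCast_iff_dvd_sub] at h
  obtain ⟨k, hk⟩ := h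
  rw [show t = s + 4 * (2 * k) by push_cast at hk; linarith, zpow_add₀ epsilon_ne_zero, zpow_mul,
    show (4 : ℤ) = ((4 : ℕ) : ℤ) from rfl, zpow_natCast, epsilon_pow_four, one_zpow, mul_one]

lemma epsilon_zpow_chi_four (hp2 : p ≠ 2) {b : ℕ} (hb : Odd b) :
    epsilon p ^ (ZMod.χ₄ b : ℤ) * (-1) ^ (p / 2 * (b / 2)) = epsilon p := by
  have hodd : p % 2 = 1 := hp.out.eq_two_or_odd.resolve_left hp2
  have hb' : b % 2 = 1 := Nat.odd_iff.mp hb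
  have hp4 : p % 4 = 1 ∨ p % 4 = 3 := by omega
  have hb4 : b % 4 = 1 ∨ b % 4 = 3 := by omega
  rcases hp4 with h | h
  · have h1 : Even (p / 2 * (b / 2)) := Even.mul_right ⟨p / 4, by omega⟩ _
    rw [h1.neg_one_pow, epsilon, if_pos h, one_zpow, mul_one]
  · rw [epsilon, if_neg (by omega), ZMod.χ₄_nat_eq_if_mod_four, if_neg (by omega)]
    rcases hb4 with h2 | h2
    · have h1 : Even (p / 2 * (b / 2)) := Even.mul_left ⟨b / 4, by omega⟩ _
      rw [if_pos h2, h1.neg_one_pow, zpow_one, mul_one]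
    · have h1 : Odd (p / 2 * (b / 2)) := Odd.mul ⟨p / 4, by omega⟩ ⟨b / 4, by omega⟩
      rw [if_neg (by omega), h1.neg_one_pow, zpow_neg_one, Complex.inv_I]
      ring

lemma kronecker_neg_one {b : ℕ} (hb : b ≠ 0) : kronecker (-1) b = ZMod.χ₄ (ordCompl[2] b : ℕ) := by
  have h : Odd (ordCompl[2] b) := by
    rw [← Nat.not_even_iff_odd, even_iff_two_dvd]
    exact Nat.not_dvd_ordCompl Nat.prime_two hb
  rw [kronecker, jacobiSym.at_neg_one h, show ZMod.χ₈ ((-1 : ℤ) : ZMod 8) = 1 from by decide,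
    one_pow, one_mul]

lemma chiP_natCast (b : ℕ) : chiP p (b : ZMod p) = (jacobiSym b p : ℂ) := by
  rw [← jacobiSym.legendreSym.to_jacobiSym, legendreSym, chiP_apply, Int.cast_natCast]

lemma chiP_two (hp2 : p ≠ 2) : chiP p 2 = (ZMod.χ₈ p : ℂ) := by
  rw [← legendreSym.at_two hp2, legendreSym, chiP_apply]
  simp

/-- The sign in the middle coefficient. Multiplying out `|H|² |A| = ∏ 2|aᵢ|` the Legendre symbol of
`∏ aᵢ` becomes a Kronecker symbol of `|A|` by reciprocity, and the powers of `ε_p` collect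
`∑ sign aᵢ = sig(A)`. -/
lemma epsilon_mul_kronecker (hp2 : p ≠ 2) {n : ℕ} (hn : Odd n) {a : Fin n → ℤ}
    (hpa : ∀ i, ¬ (p : ℤ) ∣ 2 * a i) {H b : ℕ} (hHb : ∏ i, 2 * (a i).natAbs = H ^ 2 * b)
    {s : ZMod 8} (hs8 : Odd s) (hs : s = ((∑ i, (a i).sign : ℤ) : ZMod 8)) :
    epsilon p ^ ((s.val : ℤ) + kronecker (-1) b) * (kronecker p (b * 2 ^ s.val) : ℂ) =
      chiP p (-1) ^ ((n + 1) / 2) * chiP p ((∏ i, a i : ℤ) : ZMod p) := by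
  have hpp := Nat.prime_iff_prime_int.mp hp.out
  have ha0 : ∀ i, a i ≠ 0 := fun i h => hpa i (by rw [h, mul_zero]; exact dvd_zero _)
  have hprod0 : ((∏ i, 2 * (a i).natAbs : ℕ) : ZMod p) ≠ 0 := by
    rw [Ne, ZMod.natCast_eq_zero_iff, hp.out.prime.dvd_finsetProd_iff]
    rintro ⟨i, -, hi⟩
    apply hpa i
    rw [← Int.dvd_natAbs, Int.natAbs_mul]
    exact_mod_cast hi
  have hH0 : (H : ZMod p) ≠ 0 := by
    intro h; rw [hHb] at hprod0; push_cast at hprod0; rw [h] at hprod0; simp at hprod0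
  have hbp : (b : ZMod p) ≠ 0 := by
    intro h; rw [hHb] at hprod0; push_cast at hprod0; rw [h] at hprod0; simp at hprod0
  have hb0 : b ≠ 0 := by rintro rfl; simp at hbp
  set k := b.factorization 2 with hk
  set b' := ordCompl[2] b with hb'
  have hbb : b = 2 ^ k * b' := (Nat.ordProj_mul_ordCompl_eq_self b 2).symm
  have hb'odd : Odd b' := by
    rw [← Nat.not_even_iff_odd, even_iff_two_dvd]
    exact Nat.not_dvd_ordCompl Nat.prime_two hb0
  have h2p : (2 : ZMod p) ≠ 0 := by
    intro h
    have h' : ((2 : ℕ) : ZMod p) = 0 := by exact_mod_cast h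
    rw [ZMod.natCast_eq_zero_iff] at h'
    exact hp2 ((Nat.prime_dvd_prime_iff_eq hp.out Nat.prime_two).mp h')
  have hsodd : Odd s.val := by
    have h : ∀ s : ZMod 8, (∃ m, s = 2 * m + 1) → Odd s.val := by decide
    exact h s hs8
  -- the Legendre symbol of `∏ |aᵢ|`
  have h1 : chiP p ((∏ i, (a i).natAbs : ℕ) : ZMod p) = chiP p 2 ^ (n + k) * chiP p (b' : ZMod p) := by
    have h2 := congrArg (fun m : ℕ => chiP p (m : ZMod p)) hHb
    simp only [Finset.prod_mul_distrib, Finset.prod_const, Finset.card_univ, Fintype.card_fin] at h2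
    rw [hbb, Nat.cast_mul, Nat.cast_mul, Nat.cast_mul, map_mul, map_mul, map_mul, Nat.cast_pow,
      Nat.cast_pow, Nat.cast_pow, map_pow, map_pow, map_pow, Nat.cast_ofNat, sq,
      chiP_mul_self hH0, one_mul] at h2
    have h3 : chiP p 2 ^ n * chiP p 2 ^ n = 1 := by rw [← mul_pow, chiP_mul_self h2p, one_pow]
    calc chiP p ((∏ i, (a i).natAbs : ℕ) : ZMod p)
        = chiP p 2 ^ n * (chiP p 2 ^ n * chiP p ((∏ i, (a i).natAbs : ℕ) : ZMod p)) := by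
          rw [← mul_assoc, h3, one_mul]
      _ = _ := by rw [h2, pow_add, mul_assoc]
  -- the signs
  have h2 : chiP p (-1) ^ ((n + 1) / 2) * ∏ i, chiP p ((a i).sign : ZMod p) =
      epsilon p ^ ((s.val : ℤ) + 1) := by
    obtain ⟨m, hm⟩ := hn
    have h3 : 2 * ((n + 1) / 2) = 1 + n := by omega
    have h4 : epsilon p ^ n = ∏ _i : Fin n, epsilon p := by simp
    have h5 : ((s.val : ℤ) : ZMod 8) = ((∑ i, (a i).sign : ℤ) : ZMod 8) := by
      rw [Int.cast_natCast, ZMod.natCast_zmod_val, hs]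
    rw [chiP_neg_one hp2, ← pow_mul, h3, pow_add, pow_one, h4, mul_assoc, ← Finset.prod_mul_distrib,
      Finset.prod_congr rfl fun i _ => epsilon_mul_chiP_sign hp2 (ha0 i), ← epsilon_zpow_sum,
      ← epsilon_zpow_congr h5, zpow_add₀ epsilon_ne_zero, zpow_one, mul_comm]
  have h3 : chiP p ((∏ i, a i : ℤ) : ZMod p) = (∏ i, chiP p ((a i).sign : ZMod p)) *
      chiP p ((∏ i, (a i).natAbs : ℕ) : ZMod p) := by
    rw [← map_prod, ← map_mul]
    congr 1
    push_cast
    rw [← Finset.prod_mul_distrib]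
    refine Finset.prod_congr rfl fun i _ => ?_
    have := congrArg (Int.cast : ℤ → ZMod p) (Int.sign_mul_natAbs (a i)).symm
    rwa [Int.cast_mul, Int.cast_natCast] at this
  have h4 : (kronecker p (b * 2 ^ s.val) : ℂ) =
      chiP p 2 ^ (k + s.val) * ((-1) ^ (p / 2 * (b' / 2)) * chiP p (b' : ZMod p)) := by
    have hodd : Odd p := hp.out.odd_of_ne_two hp2
    have hf : (b * 2 ^ s.val).factorization 2 = k + s.val := by
      rw [Nat.factorization_mul hb0 (by positivity), Nat.Prime.factorization_pow Nat.prime_two]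
      simp [hk]
    have hc : ordCompl[2] (b * 2 ^ s.val) = b' := by
      have h5 : (2 ^ s.val).factorization 2 = s.val := by
        rw [Nat.Prime.factorization_pow Nat.prime_two]; simp
      rw [Nat.ordCompl_mul, h5, Nat.div_self (by positivity), mul_one]
    rw [kronecker, hc, hf, jacobiSym.quadratic_reciprocity hodd hb'odd, chiP_two hp2, chiP_natCast]
    push_cast
    rfl
  have h5 : chiP p 2 ^ (n + k) = chiP p 2 ^ (k + s.val) := by
    obtain ⟨m, hm⟩ := hn
    obtain ⟨l, hl⟩ := hsodd
    have h6 : chiP p 2 ^ 2 = 1 := by rw [sq, chiP_mul_self h2p]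
    rw [hm, hl, pow_add, pow_add _ k, pow_succ, pow_succ, pow_mul, pow_mul, h6, one_pow, one_pow,
      one_mul, mul_comm]
  have h6 := epsilon_zpow_chi_four hp2 hb'odd
  rw [h3, ← mul_assoc, h2, h1, h5, h4, kronecker_neg_one hb0, zpow_add₀ epsilon_ne_zero,
    zpow_add₀ epsilon_ne_zero, zpow_one, ← hb']
  linear_combination (epsilon p ^ (s.val : ℤ) * chiP p 2 ^ (k + s.val) * chiP p (b' : ZMod p)) * h6

end

end WeilHecke

/-! ### Fourier coefficients of the image under the Hecke operator -/

namespace WeilHecke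

noncomputable section

section exponents

variable {A : Type*} [AddCommGroup A] {D : DiscriminantForm A} {p : ℕ}

/-- Multiplication by `n` on `ℚ/ℤ`, on representatives. -/
lemma nsmul_coe_qmodz (m : ℕ) (n : ℚ) : m • (n : QModZ) = ((m * n : ℚ) : QModZ) := by
  rw [← QuotientAddGroup.mk_nsmul, nsmul_eq_mul]

lemma IsExponent.nsmul {x : A} {n : ℚ} (h : IsExponent D x n) :
    IsExponent D (p • x) ((p : ℚ) ^ 2 * n) := by
  rw [IsExponent, q_nsmul, ← show (n : QModZ) = D.q x from h, nsmul_coe_qmodz]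
  congr 1
  push_cast
  ring

variable [Fintype A]

lemma IsExponent.exists_int {x : A} {n : ℚ} (h : IsExponent D x n) {N : ℕ} (hN : D.level ∣ N) :
    ∃ m : ℤ, n * N = m := by
  obtain ⟨k, rfl⟩ := hN
  rw [← qmodz_coe_eq_zero_iff, mul_comm, ← nsmul_coe_qmodz, show (n : QModZ) = D.q x from h,
    mul_comm, mul_smul, level_nsmul_q, smul_zero]

lemma IsExponent.of_nsmul (hpN : p.Coprime D.level) {x : A} {n : ℚ}
    (h : IsExponent D (p • x) ((p : ℚ) ^ 2 * n)) {m : ℤ} (hm : n * D.level = m) :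
    IsExponent D x n := by
  have h1 : (p ^ 2) • ((n : QModZ) - D.q x) = 0 := by
    rw [IsExponent, q_nsmul] at h
    rw [smul_sub, nsmul_coe_qmodz, sq p, ← h]
    push_cast
    rw [sq, sub_self]
  have h2 : D.level • ((n : QModZ) - D.q x) = 0 := by
    rw [smul_sub, level_nsmul_q, sub_zero, nsmul_coe_qmodz, mul_comm, hm]
    exact qmodz_coe_eq_zero_iff.mpr ⟨m, rfl⟩
  have h3 := (Nat.Coprime.pow_left 2 hpN)
  rw [IsExponent, ← sub_eq_zero]
  have h4 := Nat.dvd_gcd (addOrderOf_dvd_of_nsmul_eq_zero h1) (addOrderOf_dvd_of_nsmul_eq_zero h2)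
  rw [h3, Nat.dvd_one, AddMonoid.addOrderOf_eq_one_iff] at h4
  exact h4

lemma nsmul_unitMul_inv (hpN : p.Coprime D.level) (x : A) :
    p • D.unitMul (ZMod.unitOfCoprime p hpN)⁻¹ x = x := by
  let _ := D.zmodModule
  rw [← unitMul_apply hpN]
  exact smul_inv_smul (ZMod.unitOfCoprime p hpN) x

end exponents

section sums

variable {p : ℕ} [hp : Fact p.Prime]

lemma sum_exp_zmod (m : ℕ) [NeZero m] (M : ℤ) :
    ∑ j : ZMod m, Complex.exp (2 * Real.pi * Complex.I * (M * j.val / m)) =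
      if (m : ℤ) ∣ M then (m : ℂ) else 0 := by
  have h := AddChar.sum_mulShift (R' := ℂ) (M : ZMod m) (ZMod.isPrimitive_stdAddChar m)
  simp only [ZMod.card, ZMod.intCast_zmod_eq_zero_iff_dvd] at h
  refine Eq.trans ?_ (h.trans (by split_ifs <;> simp))
  refine Finset.sum_congr rfl fun j _ => ?_
  have := exp_div_eq_stdAddChar m (M * j.val)
  push_cast at this
  rw [this, ZMod.natCast_zmod_val, mul_comm]

/-- The twisted sum over the residues prime to `p`. -/
lemma sum_units_chiP (hp2 : p ≠ 2) (N M : ℤ) :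
    ∑ u : (ZMod p)ˣ, chiP p (-(N * (u : ZMod p))) *
      Complex.exp (2 * Real.pi * Complex.I * (M * (u : ZMod p).val / p)) =
        chiP p (-N) * chiP p M * gaussQ p := by
  have h1 : ∀ y : ZMod p, chiP p (-(N * y)) *
      Complex.exp (2 * Real.pi * Complex.I * (M * y.val / p)) =
        chiP p (-N) * (chiP p y * ZMod.stdAddChar ((M : ZMod p) * y)) := fun y => by
    have := exp_div_eq_stdAddChar p (M * y.val)
    push_cast at this
    rw [this, ZMod.natCast_zmod_val, ← neg_mul, map_mul, mul_assoc]
  have h2 := sum_chiP_mul_stdAddChar hp2 (M : ZMod p)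
  rw [mul_assoc (chiP p (-(N : ZMod p))), ← h2, Finset.mul_sum,
    ← Finset.sum_congr rfl fun y _ => h1 y]
  refine Finset.sum_of_injOn (fun u : (ZMod p)ˣ => (u : ZMod p)) (fun u _ v _ h => Units.ext h)
    (by simp) (fun y _ hy => ?_) fun u _ => rfl
  have hy0 : y = 0 := by
    by_contra h
    exact hy ⟨Units.mk0 y h, by simp, rfl⟩
  rw [hy0, mul_zero, neg_zero, MulChar.map_zero, zero_mul]

/-- The residue of a rational number with denominator prime to `p`. -/
lemma ratCast_mul_of_int {n : ℚ} {N : ℕ} (hN : ¬ p ∣ N) {M : ℤ} (h : n * N = M) :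
    ((n : ℚ) : ZMod p) * N = M := by
  have hden : (n.den : ℚ) ≠ 0 := Nat.cast_ne_zero.mpr n.den_nz
  have h1 : n.num * N = M * n.den := by
    have h2 : (n.num : ℚ) * N = M * n.den := by
      rw [← h]; nth_rewrite 2 [← Rat.num_div_den n]; field_simp
    exact_mod_cast h2
  have h3 : (n.den : ℤ) ∣ N := by
    have h4 : (n.den : ℤ) ∣ n.num * N := h1 ▸ dvd_mul_left _ _
    have h5 : IsCoprime (n.den : ℤ) n.num := by
      rw [Int.isCoprime_iff_gcd_eq_one, Int.gcd_comm]; exact n.reduced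
    exact h5.dvd_of_dvd_mul_left h4
  have h6 : (n.den : ZMod p) ≠ 0 := by
    rw [Ne, ZMod.natCast_eq_zero_iff]
    exact fun h => hN (h.trans (Int.natCast_dvd_natCast.mp h3))
  rw [Rat.cast_def, div_mul_eq_mul_div, div_eq_iff h6]
  exact_mod_cast congrArg (Int.cast : ℤ → ZMod p) h1

lemma chiP_ratCast {n : ℚ} {N : ℕ} (hN : ¬ p ∣ N) {M : ℤ} (h : n * N = M) :
    chiP p (-(N : ℤ)) * chiP p M = chiP p (((-n : ℚ)) : ZMod p) := by
  have h1 := ratCast_mul_of_int hN h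
  have h2 : (N : ZMod p) ≠ 0 := by rwa [Ne, ZMod.natCast_eq_zero_iff]
  rw [← h1, ← map_mul, Rat.cast_neg, show -((N : ℤ) : ZMod p) * ((n : ZMod p) * N) =
    -(n : ZMod p) * (N * N) by push_cast; ring, map_mul, map_mul, chiP_mul_self h2, mul_one]

end sums

section hecke

variable {A : Type*} [AddCommGroup A] [Fintype A] {D : DiscriminantForm A} {p : ℕ}
  [hp : Fact p.Prime] {f : ℍ → GroupAlg A} {c : A → ℚ → ℂ}

open scoped Classical in
/-- The coset of `α`: only exponents divisible by `p²` occur. -/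
lemma hasSum_scale (hpN : p.Coprime D.level) (hc : IsFourierExpansion D f c) (τ : ℍ) (x : A) :
    HasSum (fun n : ℚ => (if IsExponent D x n then (if (p : ℤ) ^ 2 ∣ n.num then
        c (D.unitMul (ZMod.unitOfCoprime p hpN)⁻¹ x) (n / (p : ℚ) ^ 2) else 0) else 0) *
          Complex.exp (2 * Real.pi * Complex.I * (n * (τ : ℂ))))
      (f (matP p • τ) (D.unitMul (ZMod.unitOfCoprime p hpN)⁻¹ x)) := by
  set y := D.unitMul (ZMod.unitOfCoprime p hpN)⁻¹ x with hy
  have hxy : p • y = x := nsmul_unitMul_inv hpN x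
  have hp0 : (p : ℚ) ^ 2 ≠ 0 := pow_ne_zero 2 (Nat.cast_ne_zero.mpr hp.out.ne_zero)
  have h1 := hc.hasSum (matP p • τ) y
  rw [← (Equiv.divRight₀ ((p : ℚ) ^ 2) hp0).hasSum_iff] at h1
  refine h1.congr_fun fun n => ?_
  simp only [Function.comp_apply, Equiv.divRight₀_apply]
  rw [coe_matP_smul]
  have hexp : ((n / (p : ℚ) ^ 2 : ℚ) : ℂ) * (p ^ 2 * (τ : ℂ)) = n * τ := by
    have : (p : ℂ) ≠ 0 := Nat.cast_ne_zero.mpr hp.out.ne_zero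
    push_cast; field_simp
  rw [hexp]
  congr 1
  by_cases hn : IsExponent D y (n / (p : ℚ) ^ 2)
  · have h2 : IsExponent D x n := by
      have := hn.nsmul (p := p)
      rwa [hxy, mul_div_cancel₀ _ hp0] at this
    obtain ⟨m, hm⟩ := hn.exists_int dvd_rfl
    have h3 : (p : ℤ) ^ 2 ∣ n.num := by
      have h4 : n.num * D.level = (p : ℤ) ^ 2 * (m * n.den) := by
        have h5 : (n.num : ℚ) * D.level = (p : ℚ) ^ 2 * (m * n.den) := by
          rw [← hm, ← Rat.mul_den_eq_num, show ∀ a b c d : ℚ, a * (b / a * c * d) = a / a * (b * d * c)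
            from fun a b c d => by ring, div_self hp0, one_mul]
        exact_mod_cast h5
      have h5 : IsCoprime ((p : ℤ) ^ 2) D.level := (Nat.isCoprime_iff_coprime.mpr hpN).pow_left
      exact h5.dvd_of_dvd_mul_right ⟨_, h4⟩
    rw [if_pos h2, if_pos h3]
  · rw [hc.support y _ hn]
    split_ifs <;> rfl

open scoped Classical in
/-- The cosets of `α S T^b`: averaging over the translations keeps the exponents of `λ`. -/
lemma hasSum_average (hpN : p.Coprime D.level) (hc : IsFourierExpansion D f c) (τ : ℍ) (x : A)
    {τ' : ZMod (p ^ 2) → ℍ} (hτ' : ∀ j, (τ' j : ℂ) = (τ + (D.level * j.val : ℕ)) / p ^ 2) :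
    HasSum (fun n : ℚ => (if IsExponent D x n then c (p • x) ((p : ℚ) ^ 2 * n) else 0) *
      Complex.exp (2 * Real.pi * Complex.I * (n * (τ : ℂ))))
        (((p : ℂ) ^ 2)⁻¹ * haveI : NeZero (p ^ 2) := ⟨pow_ne_zero 2 hp.out.ne_zero⟩
          ∑ j : ZMod (p ^ 2), f (τ' j) (p • x)) := by
  have : NeZero (p ^ 2) := ⟨pow_ne_zero 2 hp.out.ne_zero⟩
  have hpc : (p : ℂ) ≠ 0 := Nat.cast_ne_zero.mpr hp.out.ne_zero
  have hp0 : (p : ℚ) ^ 2 ≠ 0 := pow_ne_zero 2 (Nat.cast_ne_zero.mpr hp.out.ne_zero)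
  have h1 := (hasSum_sum fun j (_ : j ∈ (Finset.univ : Finset (ZMod (p ^ 2)))) =>
    hc.hasSum (τ' j) (p • x)).mul_left (((p : ℂ) ^ 2)⁻¹)
  rw [← (Equiv.mulLeft₀ ((p : ℚ) ^ 2) hp0).hasSum_iff] at h1
  refine h1.congr_fun fun n => ?_
  simp only [Function.comp_apply, Equiv.mulLeft₀_apply]
  by_cases hn : IsExponent D (p • x) ((p : ℚ) ^ 2 * n)
  swap
  · rw [hc.support _ _ hn]; simp
  obtain ⟨M, hM⟩ := hn.exists_int dvd_rfl
  have hMc : (p : ℂ) ^ 2 * n * D.level = M := by exact_mod_cast congrArg (Rat.cast : ℚ → ℂ) hM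
  have h2 : ∀ j : ZMod (p ^ 2), c (p • x) ((p : ℚ) ^ 2 * n) * Complex.exp (2 * Real.pi *
      Complex.I * (((p : ℚ) ^ 2 * n : ℚ) * (τ' j : ℂ))) =
        c (p • x) ((p : ℚ) ^ 2 * n) * Complex.exp (2 * Real.pi * Complex.I * (n * (τ : ℂ))) *
          Complex.exp (2 * Real.pi * Complex.I * (M * j.val / (p ^ 2 : ℕ))) := fun j => by
    rw [mul_assoc (c (p • x) _), ← Complex.exp_add, hτ', ← hMc]
    congr 2
    push_cast
    field_simp
  rw [Finset.sum_congr rfl fun j _ => h2 j, ← Finset.mul_sum, sum_exp_zmod]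
  have h3 : ((p ^ 2 : ℕ) : ℤ) ∣ M ↔ IsExponent D x n := by
    constructor
    · rintro ⟨k, rfl⟩
      refine hn.of_nsmul hpN (m := k) ?_
      have h4 : (p : ℚ) ^ 2 * (n * D.level) = (p : ℚ) ^ 2 * k := by
        rw [← mul_assoc, hM]; push_cast; ring
      exact mul_left_cancel₀ hp0 h4
    · intro h
      obtain ⟨k, hk⟩ := h.exists_int dvd_rfl
      refine ⟨k, ?_⟩
      have h4 : (M : ℚ) = (p : ℚ) ^ 2 * k := by rw [← hM, ← hk]; ring
      exact_mod_cast h4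
  simp only [h3]
  split_ifs
  · push_cast; field_simp
  · simp

/-- The remaining cosets: the translations by fractions with denominator `p`, weighted by a
character, twist the coefficients by a Gauss sum. -/
lemma hasSum_twist (hp2 : p ≠ 2) (hc : IsFourierExpansion D f c) (τ : ℍ) (x : A)
    {N : ℕ} (hN : D.level ∣ N) (hNp : ¬ p ∣ N) {τ' : (ZMod p)ˣ → ℍ}
    (hτ' : ∀ u, (τ' u : ℂ) = τ + ((N * (u : ZMod p).val : ℤ) : ℂ) / p) :
    HasSum (fun n : ℚ => (gaussQ p * chiP p ((-n : ℚ) : ZMod p) * c x n) *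
      Complex.exp (2 * Real.pi * Complex.I * (n * (τ : ℂ))))
        (∑ u : (ZMod p)ˣ, chiP p (-((N : ℤ) * (u : ZMod p))) * f (τ' u) x) := by
  have hpc : (p : ℂ) ≠ 0 := Nat.cast_ne_zero.mpr hp.out.ne_zero
  have h1 := hasSum_sum fun u (_ : u ∈ (Finset.univ : Finset (ZMod p)ˣ)) =>
    (hc.hasSum (τ' u) x).mul_left (chiP p (-((N : ℤ) * (u : ZMod p))))
  refine h1.congr_fun fun n => ?_
  by_cases hn : IsExponent D x n
  swap
  · rw [hc.support _ _ hn]; simp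
  obtain ⟨M, hM⟩ := hn.exists_int hN
  have hMc : (n : ℂ) * N = M := by exact_mod_cast congrArg (Rat.cast : ℚ → ℂ) hM
  have h2 : ∀ u : (ZMod p)ˣ, chiP p (-((N : ℤ) * (u : ZMod p))) * (c x n *
      Complex.exp (2 * Real.pi * Complex.I * (n * (τ' u : ℂ)))) =
        c x n * Complex.exp (2 * Real.pi * Complex.I * (n * (τ : ℂ))) *
        (chiP p (-((N : ℤ) * (u : ZMod p))) *
          Complex.exp (2 * Real.pi * Complex.I * (M * (u : ZMod p).val / p))) := fun u => by
    have h3 : Complex.exp (2 * Real.pi * Complex.I * (n * (τ' u : ℂ))) =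
        Complex.exp (2 * Real.pi * Complex.I * (n * (τ : ℂ))) *
          Complex.exp (2 * Real.pi * Complex.I * (M * (u : ZMod p).val / p)) := by
      rw [← Complex.exp_add, hτ', ← hMc]
      congr 1
      push_cast
      field_simp
    rw [h3]
    ring
  rw [Finset.sum_congr rfl fun u _ => h2 u, ← Finset.mul_sum, sum_units_chiP hp2,
    chiP_ratCast hNp hM]
  ring

end hecke

end

end WeilHecke

/-! ### The Hecke operator as a sum of translates -/

namespace WeilHecke

noncomputable section

open Matrix.SpecialLinearGroup (mapGL)

section constants

variable {p : ℕ} [hp : Fact p.Prime] {n : ℕ} {a c : Fin n → ℤ} {N : ℤ}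

/-- The product of an odd number of quadratic Gauss sums depends on `u` through the quadratic
character. -/
lemma prod_gaussP (hp2 : p ≠ 2) (hn : Odd n) (hN : ¬ (p : ℤ) ∣ N) (hc : ∀ i, N = 4 * a i * c i)
    (u : (ZMod p)ˣ) :
    ∏ i, ((Real.sqrt p : ℝ) * gaussP p (-((c i * (u : ZMod p).val : ℤ) : ZMod p))) =
      ((Real.sqrt p : ℝ) * gaussQ p) ^ n * chiP p ((∏ i, a i : ℤ) : ZMod p) *
        chiP p (-(N * (u : ZMod p))) := by
  have hN0 : (N : ZMod p) ≠ 0 := by rwa [Ne, ZMod.intCast_zmod_eq_zero_iff_dvd]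
  have hNc : ∀ i, (N : ZMod p) = 4 * a i * c i := fun i => by
    have := congrArg (Int.cast : ℤ → ZMod p) (hc i)
    push_cast at this
    exact this
  have h1 : ∀ i, (Real.sqrt p : ℝ) * gaussP p (-((c i * (u : ZMod p).val : ℤ) : ZMod p)) =
      (Real.sqrt p : ℝ) * gaussQ p * chiP p (a i) * chiP p (-(N * (u : ZMod p))) := fun i => by
    have hci : (c i : ZMod p) ≠ 0 := fun h => hN0 (by rw [hNc i, h, mul_zero])
    have h2a : (2 * a i : ZMod p) ≠ 0 := fun h => hN0 (by
      rw [hNc i, show (4 * a i * c i : ZMod p) = 2 * a i * (2 * c i) by ring, h, zero_mul])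
    have h2 : -((c i * (u : ZMod p).val : ℤ) : ZMod p) = -(c i * (u : ZMod p)) := by
      push_cast; rw [ZMod.natCast_zmod_val]
    rw [h2, gaussP_eq hp2 (neg_ne_zero.mpr (mul_ne_zero hci u.ne_zero)), mul_assoc (_ * _) (chiP p _),
      ← map_mul, hNc i, show (a i * -(4 * a i * c i * (u : ZMod p)) : ZMod p) =
        2 * a i * (2 * a i) * -(c i * (u : ZMod p)) by ring, map_mul, map_mul _ (2 * _ : ZMod p),
      chiP_mul_self h2a]
    ring
  have h3 : chiP p (-(N * (u : ZMod p))) ^ n = chiP p (-(N * (u : ZMod p))) := by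
    obtain ⟨m, rfl⟩ := hn
    rw [pow_succ, pow_mul, sq, chiP_mul_self (neg_ne_zero.mpr (mul_ne_zero hN0 u.ne_zero)), one_pow,
      one_mul]
  rw [Finset.prod_congr rfl fun i _ => h1 i, Finset.prod_mul_distrib, Finset.prod_mul_distrib,
    Finset.prod_const, Finset.prod_const, Finset.card_univ, Fintype.card_fin, h3, Int.cast_prod,
    map_prod]

/-- Only an even power of the Gauss sum enters the twisted coefficient. -/
lemma rpow_mul_gaussQ (hp2 : p ≠ 2) (hn : Odd n) (s : ℝ) :
    (((p : ℝ) ^ (s - 2) : ℝ) : ℂ) * (((Real.sqrt p : ℝ) * gaussQ p) ^ n / (p : ℂ) ^ n) * gaussQ p =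
      (((p : ℝ) ^ (s - 3 / 2) : ℝ) : ℂ) * chiP p (-1) ^ ((n + 1) / 2) := by
  obtain ⟨m, rfl⟩ := hn
  have hp0 : (0 : ℝ) < p := Nat.cast_pos.mpr hp.out.pos
  have hpc : (p : ℂ) ≠ 0 := Nat.cast_ne_zero.mpr hp.out.ne_zero
  have h1 : ((Real.sqrt p : ℝ) : ℂ) ^ 2 = p := by
    rw [← Complex.ofReal_pow, Real.sq_sqrt hp0.le, Complex.ofReal_natCast]
  have h2 : (((p : ℝ) ^ (s - 3 / 2) : ℝ) : ℂ) = (((p : ℝ) ^ (s - 2) : ℝ) : ℂ) * (Real.sqrt p : ℝ) := by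
    rw [← Complex.ofReal_mul, Real.sqrt_eq_rpow, ← Real.rpow_add hp0]
    congr 2
    ring
  have h3 : (((Real.sqrt p : ℝ) : ℂ) * gaussQ p) ^ (2 * m + 1) * gaussQ p =
      (p : ℂ) ^ (2 * m + 1) * (Real.sqrt p : ℝ) * chiP p (-1) ^ (m + 1) := by
    calc _ = (((Real.sqrt p : ℝ) : ℂ) ^ 2) ^ m * (Real.sqrt p : ℝ) * (gaussQ p ^ 2) ^ (m + 1) := by
          ring
      _ = _ := by rw [h1, gaussQ_sq hp2]; ring
  rw [h2, show (2 * m + 1 + 1) / 2 = m + 1 by omega, mul_assoc, div_mul_eq_mul_div, h3]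
  field_simp

end constants

section hecke

variable {A : Type*} [AddCommGroup A] [Fintype A] {D : DiscriminantForm A} {p : ℕ}
  [hp : Fact p.Prime] {M : Type*} [AddCommGroup M] {n : ℕ} {a : Fin n → ℤ} [∀ i, NeZero (a i)]
  {r : M →+ DiagGroup a} {ψ : M →+ A}

lemma card_diagGroup : Fintype.card (DiagGroup a) = ∏ i, 2 * (a i).natAbs := by
  rw [Fintype.card_pi]
  exact Finset.prod_congr rfl fun i _ => ZMod.card _

lemma intertwinesConj (hpN : p.Coprime D.level) (hpa : ∀ i, ¬ (p : ℤ) ∣ 2 * a i)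
    (S : IsSubquotient D (diagQ a) (diagB a) r ψ)
    (hs : D.sig = ((∑ i, (a i).sign : ℤ) : ZMod 8)) : IntertwinesConj D hpN :=
  fun _ _ h => diagOp_weilRep hpN hpa S hs h

/-- The values of the Hecke operator as sums over the three kinds of cosets. -/
lemma heckeT_apply (hp2 : p ≠ 2) (hn : Odd n) (hpN : p.Coprime D.level)
    (hpa : ∀ i, ¬ (p : ℤ) ∣ 2 * a i) (S : IsSubquotient D (diagQ a) (diagB a) r ψ)
    (hs : D.sig = ((∑ i, (a i).sign : ℤ) : ZMod 8)) :
    (cosets (xiP D p hpN)).Finite ∧ ∃ N : ℕ, D.level ∣ N ∧ ¬ p ∣ N ∧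
      ∀ {w : ℤ} {f : ℍ → GroupAlg A}, IsModularForm D w f → ∀ τ : ℍ,
      ∃ (τ₁ : ZMod (p ^ 2) → ℍ) (τ₂ : (ZMod p)ˣ → ℍ),
        (∀ j, (τ₁ j : ℂ) = (τ + (D.level * j.val : ℕ)) / p ^ 2) ∧
        (∀ u, (τ₂ u : ℂ) = τ + ((N * (u : ZMod p).val : ℤ) : ℂ) / p) ∧
        ∀ x, heckeT w f (xiP D p hpN) τ x =
          (((p : ℝ) ^ ((w : ℝ) - 2) : ℝ) : ℂ) *
              f (matP p • τ) (D.unitMul (ZMod.unitOfCoprime p hpN)⁻¹ x) +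
            ((p : ℂ) ^ 2)⁻¹ * (haveI : NeZero (p ^ 2) := ⟨pow_ne_zero 2 hp.out.ne_zero⟩
              ∑ j : ZMod (p ^ 2), f (τ₁ j) (p • x)) +
            (((p : ℝ) ^ ((w : ℝ) / 2 - 2) : ℝ) : ℂ) *
              (((Real.sqrt p : ℝ) * gaussQ p) ^ n / (p : ℂ) ^ n *
                chiP p ((∏ i, a i : ℤ) : ZMod p)) *
              ∑ u : (ZMod p)ˣ, chiP p (-((N : ℤ) * (u : ZMod p))) * f (τ₂ u) x := by
  have : NeZero (p ^ 2) := ⟨pow_ne_zero 2 hp.out.ne_zero⟩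
  have hpp := Nat.prime_iff_prime_int.mp hp.out
  have hp0 : (0 : ℝ) < p := Nat.cast_pos.mpr hp.out.pos
  have hpc : (p : ℂ) ≠ 0 := Nat.cast_ne_zero.mpr hp.out.ne_zero
  obtain ⟨hT, hS⟩ := weilRep_spec S hs
  have hpl : ¬ p ∣ D.level := (Nat.Prime.coprime_iff_not_dvd hp.out).mp hpN
  have hp4 : ∀ i, ¬ (p : ℤ) ∣ 4 * a i := fun i h => by
    rw [show 4 * a i = 2 * (2 * a i) by ring] at h
    rcases hpp.dvd_or_dvd h with h | h
    · exact hpa i (h.mul_right _)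
    · exact hpa i h
  -- `N` is divisible by the level and by all `4aᵢ`, so that `b₁ = Nu/4aᵢ` is integral
  obtain ⟨N, hN, hNp, hc⟩ : ∃ N : ℕ, D.level ∣ N ∧ ¬ p ∣ N ∧
      ∀ i, ∃ c : ℤ, (N : ℤ) = 4 * a i * c := by
    refine ⟨D.level * (∏ i, 4 * a i).natAbs, dvd_mul_right _ _, fun h => ?_, fun i => ?_⟩
    · rcases hp.out.dvd_mul.mp h with h | h
      · exact hpl h
      · rw [← Int.natCast_dvd, hpp.dvd_finsetProd_iff] at h
        obtain ⟨i, -, hi⟩ := h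
        exact hp4 i hi
    · have h : 4 * a i ∣ ((D.level * (∏ i, 4 * a i).natAbs : ℕ) : ℤ) := by
        rw [Nat.cast_mul]
        exact (Int.dvd_natAbs.mpr (Finset.dvd_prod_of_mem _ (Finset.mem_univ i))).mul_left _
      exact h
  choose c hc using hc
  obtain ⟨γ, G, hγ, hG0, hG1, hfin, hsum⟩ :=
    exists_representatives (intertwinesConj hpN hpa S hs) hpl hNp
  refine ⟨hfin, N, hN, hNp, fun {w f} hf τ => ?_⟩
  choose τ₁ hτ₁ hs₁ using fun j : ZMod (p ^ 2) =>
    slash_xiP_mul_S_mul_T_pow (hpN := hpN) hT hS hf (dvd_mul_right D.level j.val) τ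
  have ht : ∀ u : (ZMod p)ˣ, ∃ τ' : ℍ, (τ' : ℂ) = τ + ((N * (u : ZMod p).val : ℤ) : ℂ) / p ∧
      slash w f (xiP D p hpN * sectionL D (γ u)) τ = (((Real.sqrt p : ℝ) * gaussQ p) ^ n *
        chiP p ((∏ i, a i : ℤ) : ZMod p) * chiP p (-((N : ℤ) * (u : ZMod p))) / (p : ℂ) ^ n) •
          f τ' := fun u => by
    refine slash_xiP_mul hf (hγ u) (hG0 u) (hG1 u) (fun γ' β hφ hβ hγβ => ?_) τ
    have h := gaussP_mul_weilRep hpN hpa S hs hφ (b := N * (u : ZMod p).val)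
      (b₁ := fun i => c i * (u : ZMod p).val) (fun i => by rw [hc i]; ring) hβ hγβ
      (by rw [hγ u]; simp [hG0 u]) (by rw [hγ u]; simp [hG1 u])
    rw [prod_gaussP hp2 hn (by rwa [Int.natCast_dvd_natCast]) hc u] at h
    rw [div_eq_inv_mul, ← smul_smul, h, smul_smul, inv_mul_cancel₀ (pow_ne_zero n hpc), one_smul]
  choose τ₂ hτ₂ hs₂ using ht
  refine ⟨τ₁, τ₂, hτ₁, hτ₂, fun x => ?_⟩
  rw [hsum hf, matP_det_rpow]
  simp only [Pi.smul_apply, Pi.add_apply, Finset.sum_apply, slash_xiP, hs₁, hs₂, smul_eq_mul]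
  rw [mul_add, mul_add, show 2 * ((w : ℝ) / 4 - 1) = w / 2 - 2 by ring, ← Finset.mul_sum]
  congr 1
  · congr 1
    · rw [← mul_assoc, ← Complex.ofReal_mul, ← Real.rpow_add hp0]
      congr 3
      ring
    · rw [← mul_assoc, ← Complex.ofReal_mul, ← Real.rpow_add hp0,
        show (w : ℝ) / 2 - 2 + -(w : ℝ) / 2 = -(2 : ℕ) by push_cast; ring, Real.rpow_neg hp0.le,
        Real.rpow_natCast]
      push_cast
      rfl
  · rw [mul_assoc, Finset.mul_sum, Finset.mul_sum]
    rw [Finset.mul_sum]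
    refine Finset.sum_congr rfl fun u _ => ?_
    ring

open scoped Classical in
/-- The Fourier coefficients of the image. The power of the Gauss sum and the Legendre symbol of
`∏ aᵢ` combine to the symbols in `|A|` and `sig(A)`. -/
lemma isFourierExpansion_heckeT (hodd : Odd D.sig) (hp2 : p ≠ 2) (hn : Odd n)
    (hpN : p.Coprime D.level) (hpa : ∀ i, ¬ (p : ℤ) ∣ 2 * a i)
    (S : IsSubquotient D (diagQ a) (diagB a) r ψ)
    (hs : D.sig = ((∑ i, (a i).sign : ℤ) : ZMod 8)) {w : ℤ} {f : ℍ → GroupAlg A} {c : A → ℚ → ℂ}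
    (hf : IsModularForm D w f) (hc : IsFourierExpansion D f c) :
    IsFourierExpansion D (heckeT w f (xiP D p hpN)) fun x n => if IsExponent D x n then
      c (p • x) ((p : ℚ) ^ 2 * n)
        + epsilon p ^ ((D.sig.val : ℤ) + kronecker (-1) (Fintype.card A))
          * (kronecker p (Fintype.card A * 2 ^ D.sig.val) : ℂ)
          * (((p : ℝ) ^ ((w : ℝ) / 2 - 3 / 2) : ℝ) : ℂ)
          * (quadraticChar (ZMod p) ((-n : ℚ) : ZMod p) : ℂ)
          * c x n
        + (((p : ℝ) ^ ((w : ℝ) - 2) : ℝ) : ℂ)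
          * (if (p : ℤ) ^ 2 ∣ n.num then
              c (D.unitMul (ZMod.unitOfCoprime p hpN)⁻¹ x) (n / (p : ℚ) ^ 2) else 0)
      else 0 := by
  refine ⟨fun x n h => if_neg h, fun τ x => ?_⟩
  obtain ⟨-, N, hN, hNp, H⟩ := heckeT_apply hp2 hn hpN hpa S hs
  obtain ⟨τ₁, τ₂, hτ₁, hτ₂, h⟩ := H hf τ
  rw [h x]
  have hHb := S.card_eq
  rw [card_diagGroup] at hHb
  refine ((((hasSum_scale hpN hc τ x).mul_left _).add (hasSum_average hpN hc τ x hτ₁)).add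
    ((hasSum_twist hp2 hc τ x hN hNp hτ₂).mul_left _)).congr_fun fun m => ?_
  rw [epsilon_mul_kronecker hp2 hn hpa hHb hodd hs, ← chiP_apply]
  have hg := rpow_mul_gaussQ hp2 hn ((w : ℝ) / 2)
  split_ifs with h1 h2
  · linear_combination
      -(chiP p ((∏ i, a i : ℤ) : ZMod p) * chiP p ((-m : ℚ) : ZMod p) * c x m *
        Complex.exp (2 * Real.pi * Complex.I * (m * (τ : ℂ)))) * hg
  · linear_combination
      -(chiP p ((∏ i, a i : ℤ) : ZMod p) * chiP p ((-m : ℚ) : ZMod p) * c x m *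
        Complex.exp (2 * Real.pi * Complex.I * (m * (τ : ℂ)))) * hg
  · rw [hc.support x m h1]
    ring

end hecke

end

end WeilHecke

theorem mainTheorem3 {A : Type*} [AddCommGroup A] [Fintype A] (D : DiscriminantForm A)
    (hodd : Odd D.sig) (w : ℤ) (hw : Odd w)
    (p : ℕ) [Fact p.Prime] (hpN : p.Coprime D.level)
    (f : ℍ → GroupAlg A) (hf : IsModularForm D w f) :
    xiP D p hpN ∈ Q2 D ∧
    (cosets (xiP D p hpN)).Finite ∧
    (∃! c : A → ℚ → ℂ, IsFourierExpansion D f c) ∧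
    (∃! b : A → ℚ → ℂ, IsFourierExpansion D (heckeT w f (xiP D p hpN)) b) ∧
    ∀ c b : A → ℚ → ℂ, IsFourierExpansion D f c →
      IsFourierExpansion D (heckeT w f (xiP D p hpN)) b →
      ∀ (x : A) (n : ℚ), IsExponent D x n →
        b x n = c (p • x) ((p : ℚ) ^ 2 * n)
          + epsilon p ^ ((D.sig.val : ℤ) + kronecker (-1) (Fintype.card A))
            * (kronecker p (Fintype.card A * 2 ^ D.sig.val) : ℂ)
            * (((p : ℝ) ^ ((w : ℝ) / 2 - 3 / 2) : ℝ) : ℂ)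
            * (quadraticChar (ZMod p) ((-n : ℚ) : ZMod p) : ℂ)
            * c x n
          + (((p : ℝ) ^ ((w : ℝ) - 2) : ℝ) : ℂ)
            * (if (p : ℤ) ^ 2 ∣ n.num then
                c (D.unitMul (ZMod.unitOfCoprime p hpN)⁻¹ x) (n / (p : ℚ) ^ 2) else 0) := by
  obtain ⟨hp2, l, a, ha, M, _, r, ψ, hl, hpa, S, hs⟩ := exists_isSubquotient hodd hpN
  obtain ⟨hT, hS⟩ := weilRep_spec S hs
  have hexp := fun c hc => isFourierExpansion_heckeT hodd hp2 hl hpN hpa S hs (c := c) hf hc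
  obtain ⟨c₀, hc₀⟩ := exists_isFourierExpansion hT hf
  refine ⟨xiP_mem_Q2 hpN hT hS, (heckeT_apply hp2 hl hpN hpa S hs).1,
    ⟨c₀, hc₀, fun c hc => isFourierExpansion_unique hc hc₀⟩,
    ⟨_, hexp c₀ hc₀, fun b hb => isFourierExpansion_unique hb (hexp c₀ hc₀)⟩,
    fun c b hc hb x n hn => ?_⟩
  rw [isFourierExpansion_unique hb (hexp c hc)]
  exact if_pos hn
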